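/- Let $D$ be an infinite set of data values. Fix infinite sets of element names, attribute names and variables (names are finite words over a two-letter alphabet). An XML tree is a finite nonempty unranked ordered tree in which every vertex carries an element name and a partial function assigning values in $D$ to attributes from a finite set of attribute names. Location paths $p$ and filter expressions $e$ are generated by $$p ::= \mathit{axis}::\nu\,[e_1]\cdots[e_k] \;\mid\; p/p \;\mid\; (p \mid p),\qquad e ::= p \;\mid\; \$x=@a \;\mid\; \$x\neq @a \;\mid\; e \text{ or } e,$$ where $k\ge 0$, $\mathit{axis}$ is one of self, child, descendant, the node test $\nu$ is an element name or the wildcard $*$, $x$ is a variable and $a$ is an attribute name. This is the fragment $\mathrm{XP}(/,/\!/,[\,],|,*,\mathrm{xvars},\neq)$. For a tree $t$ and an assignment $\rho$ of values in $D$ to all variables, $p$ denotes a binary relation $[\![p]\!]_t^\rho$ on the vertices of $t$: a pair $(u,v)$ belongs to the relation of $\mathit{axis}::\nu[e_1]\cdots[e_k]$ if $v$ is $u$ itself, a child of $u$, or a proper descendant of $u$, according to the axis, $v$ satisfies the node test, and every $e_i$ holds at $v$; $/$ is composition and $\mid$ is union. A filter $p$ holds at $v$ if $(v,w)\in[\![p]\!]_t^\rho$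 for some $w$; $\$x=@a$ (respectively $\$x\ne@a$) holds at $v$ if $v$ has an $a$-attribute and its value is equal to (respectively different from) $\rho(x)$; "or" is disjunction. Write $t\models^\rho p$ if $(\varepsilon,v)\in[\![p]\!]_t^\rho$ for some vertex $v$, where $\varepsilon$ is the root. Under the XPath semantics for variables, $p\subseteq q$ means that for every tree $t$ and every assignment $\rho$, $t\models^\rho p$ implies $t\models^\rho q$. Theorem. The problem of deciding, for two such location paths $p,q$ (written as words over a fixed finite alphabet, with names spelled out letter by letter), whether $p\subseteq q$, is in PSPACE: it is decided by a deterministic machine using space polynomial in the length of the input. -/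

import Mathlib

namespace XPathVars

/-- Element names, attribute names and variable names: all finite words over a two-letter
alphabet (in particular there are infinitely many of each). -/
abbrev Name : Type := List Bool

/-! ### XML trees -/

/-- Vertices are addressed by the sequence of child positions on the path from the root
(positions are counted from `0`); the root is `[]`. -/
abbrev Vertex : Type := List ℕ

/-- A finite, nonempty, unranked ordered tree whose vertices carry an element name and, for each
attribute of some finite set, possibly a data value from `D`. The functions `lab` and `attr` are
only ever consulted at vertices of `dom`; `attr v a = none` means that `v` has no `a`-attribute. -/
structure XMLTree (D : Type*) where
  dom : Finset Vertex
  root_mem : [] ∈ dom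
  parent_mem : ∀ (v : Vertex) (i : ℕ), v ++ [i] ∈ dom → v ∈ dom
  sibling_mem : ∀ (v : Vertex) (i : ℕ), v ++ [i + 1] ∈ dom → v ++ [i] ∈ dom
  lab : Vertex → Name
  attr : Vertex → Name → Option D
  finite_attr : {a : Name | ∃ v ∈ dom, attr v a ≠ none}.Finite

/-! ### Syntax of XPath expressions with variables -/

inductive Axis where
  | self
  | child
  | descendant

inductive NodeTest where
  | label (s : Name)
  | wildcard

mutual
/-- Location paths: `axis :: test [e₁] ⋯ [eₖ]`, `p / q` and `p | q`. -/
inductive LPath where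
  | step (a : Axis) (n : NodeTest) (fs : Filters)
  | comp (p q : LPath)
  | union (p q : LPath)
/-- Filter expressions: a location path, `$x = @a`, `$x ≠ @a`, or `e₁ or e₂`. -/
inductive Expr where
  | path (p : LPath)
  | eq (x a : Name)
  | ne (x a : Name)
  | or (e₁ e₂ : Expr)
/-- Finite lists of filter expressions. -/
inductive Filters where
  | nil
  | cons (e : Expr) (fs : Filters)
end

/-! ### Semantics -/

section Semantics

variable {D : Type*}

/-- The pairs of vertices of `t` related by an axis; `descendant` is proper. -/
def Axis.Rel (t : XMLTree D) (a : Axis) (u v : Vertex) : Prop :=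
  u ∈ t.dom ∧ v ∈ t.dom ∧
    match a with
    | .self => v = u
    | .child => ∃ i : ℕ, v = u ++ [i]
    | .descendant => ∃ w : Vertex, w ≠ [] ∧ v = u ++ w

def NodeTest.Holds (t : XMLTree D) (v : Vertex) : NodeTest → Prop
  | .label s => t.lab v = s
  | .wildcard => True

mutual
/-- The binary relation on the vertices of `t` defined by a location path, relative to the
variable assignment `ρ`. -/
def LPath.Sem (t : XMLTree D) (ρ : Name → D) : LPath → Vertex → Vertex → Prop
  | .step a n fs, u, v => a.Rel t u v ∧ n.Holds t v ∧ Filters.Holds t ρ fs v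
  | .comp p q, u, v => ∃ w, LPath.Sem t ρ p u w ∧ LPath.Sem t ρ q w v
  | .union p q, u, v => LPath.Sem t ρ p u v ∨ LPath.Sem t ρ q u v
/-- The truth value of a filter expression at a vertex. Both kinds of comparison require that
the attribute is present. -/
def Expr.Holds (t : XMLTree D) (ρ : Name → D) : Expr → Vertex → Prop
  | .path p, v => ∃ w, LPath.Sem t ρ p v w
  | .eq x a, v => ∃ d, t.attr v a = some d ∧ ρ x = d
  | .ne x a, v => ∃ d, t.attr v a = some d ∧ ρ x ≠ d
  | .or e₁ e₂, v => Expr.Holds t ρ e₁ v ∨ Expr.Holds t ρ e₂ v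
/-- All filters of the list hold at the vertex. -/
def Filters.Holds (t : XMLTree D) (ρ : Name → D) : Filters → Vertex → Prop
  | .nil, _ => True
  | .cons e fs, v => Expr.Holds t ρ e v ∧ Filters.Holds t ρ fs v
end

/-- `t` matches `p` under `ρ`: some vertex is selected from the root. -/
def Matches (t : XMLTree D) (ρ : Name → D) (p : LPath) : Prop :=
  ∃ v, p.Sem t ρ [] v

end Semantics

/-- Boolean containment under the XPath semantics for variables, over data values from `D`. -/
def Contained (D : Type*) (p q : LPath) : Prop :=
  ∀ (t : XMLTree D) (ρ : Name → D), Matches t ρ p → Matches t ρ q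

/-! ### Expressions as words over a finite alphabet

The binary operators are written in prefix notation, so no parentheses are needed. -/

inductive Sym where
  | self | child | descendant
  | star
  | bit0 | bit1 | eon
  | lbr | rbr
  | slash | bar | or
  | eq | ne
  deriving DecidableEq

instance : Fintype Sym where
  elems := {.self, .child, .descendant, .star, .bit0, .bit1, .eon, .lbr, .rbr, .slash, .bar, .or,
    .eq, .ne}
  complete x := by cases x <;> decide

/-- The letters of the name, followed by an end marker. -/
def encName : Name → List Sym
  | [] => [.eon]
  | false :: s => .bit0 :: encName s
  | true :: s => .bit1 :: encName s

def Axis.enc : Axis → List Sym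
  | .self => [.self]
  | .child => [.child]
  | .descendant => [.descendant]

def NodeTest.enc : NodeTest → List Sym
  | .label s => encName s
  | .wildcard => [.star]

mutual
def LPath.enc : LPath → List Sym
  | .step a n fs => a.enc ++ (n.enc ++ Filters.enc fs)
  | .comp p q => .slash :: (LPath.enc p ++ LPath.enc q)
  | .union p q => .bar :: (LPath.enc p ++ LPath.enc q)
def Expr.enc : Expr → List Sym
  | .path p => LPath.enc p
  | .eq x a => .eq :: (encName x ++ encName a)
  | .ne x a => .ne :: (encName x ++ encName a)
  | .or e₁ e₂ => .or :: (Expr.enc e₁ ++ Expr.enc e₂)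
/-- Every filter is preceded by `lbr`; the list ends with `rbr`. -/
def Filters.enc : Filters → List Sym
  | .nil => [.rbr]
  | .cons e fs => .lbr :: (Expr.enc e ++ Filters.enc fs)
end

/-- An instance of the containment problem: the two expressions one after the other. -/
def encPair (p q : LPath) : List Sym := p.enc ++ q.enc

/-- The containment problem as a language; ill-formed words are not in it. -/
def containment (D : Type*) : Language Sym :=
  {w | ∃ p q : LPath, w = encPair p q ∧ Contained D p q}

/-! The encoding is unambiguous. -/

theorem encName_inj (s s' : Name) (l l' : List Sym) (h : encName s ++ l = encName s' ++ l') :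
    s = s' ∧ l = l' := by
  induction s generalizing s' with
  | nil =>
    rcases s' with _ | ⟨_ | _, s'⟩ <;> simp_all [encName]
  | cons b s ih =>
    rcases s' with _ | ⟨_ | _, s'⟩ <;> rcases b with _ | _ <;> simp [encName] at h ⊢ <;>
      exact ih _ h

theorem NodeTest.enc_inj (n n' : NodeTest) (l l' : List Sym) (h : n.enc ++ l = n'.enc ++ l') :
    n = n' ∧ l = l' := by
  rcases n with s | _ <;> rcases n' with s' | _
  · simpa [NodeTest.enc] using encName_inj s s' l l' h
  · rcases s with _ | ⟨_ | _, s⟩ <;> simp [NodeTest.enc, encName] at h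
  · rcases s' with _ | ⟨_ | _, s'⟩ <;> simp [NodeTest.enc, encName] at h
  · simpa [NodeTest.enc] using h

mutual
theorem LPath.enc_inj (p p' : LPath) (l l' : List Sym) (h : p.enc ++ l = p'.enc ++ l') :
    p = p' ∧ l = l' := by
  match p, p' with
  | .step a n fs, .step a' n' fs' =>
    have ha : a = a' ∧ n.enc ++ (fs.enc ++ l) = n'.enc ++ (fs'.enc ++ l') := by
      cases a <;> cases a' <;> simp_all [LPath.enc, Axis.enc]
    obtain ⟨hn, h2⟩ := NodeTest.enc_inj _ _ _ _ ha.2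
    obtain ⟨hf, h3⟩ := Filters.enc_inj fs fs' _ _ h2
    exact ⟨by rw [ha.1, hn, hf], h3⟩
  | .comp p q, .comp p' q' =>
    simp only [LPath.enc, List.cons_append, List.append_assoc, List.cons.injEq, true_and] at h
    obtain ⟨h1, h2⟩ := LPath.enc_inj p p' _ _ h
    obtain ⟨h3, h4⟩ := LPath.enc_inj q q' _ _ h2
    exact ⟨by rw [h1, h3], h4⟩
  | .union p q, .union p' q' =>
    simp only [LPath.enc, List.cons_append, List.append_assoc, List.cons.injEq, true_and] at h
    obtain ⟨h1, h2⟩ := LPath.enc_inj p p' _ _ h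
    obtain ⟨h3, h4⟩ := LPath.enc_inj q q' _ _ h2
    exact ⟨by rw [h1, h3], h4⟩
  | .step a _ _, .comp _ _ => cases a <;> simp [LPath.enc, Axis.enc] at h
  | .step a _ _, .union _ _ => cases a <;> simp [LPath.enc, Axis.enc] at h
  | .comp _ _, .step a _ _ => cases a <;> simp [LPath.enc, Axis.enc] at h
  | .union _ _, .step a _ _ => cases a <;> simp [LPath.enc, Axis.enc] at h
  | .comp _ _, .union _ _ => simp [LPath.enc] at h
  | .union _ _, .comp _ _ => simp [LPath.enc] at h
theorem Expr.enc_inj (e e' : Expr) (l l' : List Sym) (h : e.enc ++ l = e'.enc ++ l') :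
    e = e' ∧ l = l' := by
  match e, e' with
  | .path p, .path p' =>
    obtain ⟨h1, h2⟩ := LPath.enc_inj p p' l l' (by simpa [Expr.enc] using h)
    exact ⟨by rw [h1], h2⟩
  | .eq x a, .eq x' a' =>
    simp only [Expr.enc, List.cons_append, List.append_assoc, List.cons.injEq, true_and] at h
    obtain ⟨h1, h2⟩ := encName_inj _ _ _ _ h
    obtain ⟨h3, h4⟩ := encName_inj _ _ _ _ h2
    exact ⟨by rw [h1, h3], h4⟩
  | .ne x a, .ne x' a' =>
    simp only [Expr.enc, List.cons_append, List.append_assoc, List.cons.injEq, true_and] at h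
    obtain ⟨h1, h2⟩ := encName_inj _ _ _ _ h
    obtain ⟨h3, h4⟩ := encName_inj _ _ _ _ h2
    exact ⟨by rw [h1, h3], h4⟩
  | .or e f, .or e' f' =>
    simp only [Expr.enc, List.cons_append, List.append_assoc, List.cons.injEq, true_and] at h
    obtain ⟨h1, h2⟩ := Expr.enc_inj e e' _ _ h
    obtain ⟨h3, h4⟩ := Expr.enc_inj f f' _ _ h2
    exact ⟨by rw [h1, h3], h4⟩
  | .path (.step a _ _), .eq _ _ => cases a <;> simp [Expr.enc, LPath.enc, Axis.enc] at h
  | .path (.step a _ _), .ne _ _ => cases a <;> simp [Expr.enc, LPath.enc, Axis.enc] at h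
  | .path (.step a _ _), .or _ _ => cases a <;> simp [Expr.enc, LPath.enc, Axis.enc] at h
  | .eq _ _, .path (.step a _ _) => cases a <;> simp [Expr.enc, LPath.enc, Axis.enc] at h
  | .ne _ _, .path (.step a _ _) => cases a <;> simp [Expr.enc, LPath.enc, Axis.enc] at h
  | .or _ _, .path (.step a _ _) => cases a <;> simp [Expr.enc, LPath.enc, Axis.enc] at h
  | .path (.comp _ _), .eq _ _ => simp [Expr.enc, LPath.enc] at h
  | .path (.comp _ _), .ne _ _ => simp [Expr.enc, LPath.enc] at h
  | .path (.comp _ _), .or _ _ => simp [Expr.enc, LPath.enc] at h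
  | .eq _ _, .path (.comp _ _) => simp [Expr.enc, LPath.enc] at h
  | .ne _ _, .path (.comp _ _) => simp [Expr.enc, LPath.enc] at h
  | .or _ _, .path (.comp _ _) => simp [Expr.enc, LPath.enc] at h
  | .path (.union _ _), .eq _ _ => simp [Expr.enc, LPath.enc] at h
  | .path (.union _ _), .ne _ _ => simp [Expr.enc, LPath.enc] at h
  | .path (.union _ _), .or _ _ => simp [Expr.enc, LPath.enc] at h
  | .eq _ _, .path (.union _ _) => simp [Expr.enc, LPath.enc] at h
  | .ne _ _, .path (.union _ _) => simp [Expr.enc, LPath.enc] at h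
  | .or _ _, .path (.union _ _) => simp [Expr.enc, LPath.enc] at h
  | .eq _ _, .ne _ _ => simp [Expr.enc] at h
  | .eq _ _, .or _ _ => simp [Expr.enc] at h
  | .ne _ _, .eq _ _ => simp [Expr.enc] at h
  | .ne _ _, .or _ _ => simp [Expr.enc] at h
  | .or _ _, .eq _ _ => simp [Expr.enc] at h
  | .or _ _, .ne _ _ => simp [Expr.enc] at h
theorem Filters.enc_inj (f f' : Filters) (l l' : List Sym) (h : f.enc ++ l = f'.enc ++ l') :
    f = f' ∧ l = l' := by
  match f, f' with
  | .nil, .nil => simpa [Filters.enc] using h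
  | .cons e fs, .cons e' fs' =>
    simp only [Filters.enc, List.cons_append, List.append_assoc, List.cons.injEq, true_and] at h
    obtain ⟨h1, h2⟩ := Expr.enc_inj e e' _ _ h
    obtain ⟨h3, h4⟩ := Filters.enc_inj fs fs' _ _ h2
    exact ⟨by rw [h1, h3], h4⟩
  | .nil, .cons _ _ => simp [Filters.enc] at h
  | .cons _ _, .nil => simp [Filters.enc] at h
end

theorem encPair_inj (p q p' q' : LPath) (h : encPair p q = encPair p' q') : p = p' ∧ q = q' := by
  obtain ⟨h1, h2⟩ := LPath.enc_inj p p' _ _ h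
  exact ⟨h1, (LPath.enc_inj q q' [] [] (by simpa using h2)).1⟩

/-! ### Polynomial space -/

/-- The number of memory cells in use in a configuration of a deterministic multi-stack machine
(two stacks amount to one work tape). -/
def cfgSpace (tm : Turing.FinTM2) (c : tm.Cfg) : ℕ :=
  letI := tm.kFin
  ∑ k : tm.K, (Turing.TM2.Cfg.stk c k).length

/-- The configurations that occur in the run of `tm` on an input word. -/
def Occurs (tm : Turing.FinTM2) (w : List (tm.Γ tm.k₀)) (c : tm.Cfg) : Prop :=
  Turing.TM2.Reaches tm.m (Turing.initList tm w) c

/-- The deterministic machine `tm`, with the input symbols represented on its input stack by `inp`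
and the accepting internal states `acc`, decides `L` in space `s`: on every input word `w` it
halts, in an accepting state exactly when `w ∈ L`, and every configuration of the run uses at most
`s |w|` cells (those holding the input included). -/
def DecidesInSpace {α : Type} (tm : Turing.FinTM2) (inp : α → tm.Γ tm.k₀) (acc : Set tm.σ)
    (L : Language α) (s : ℕ → ℕ) : Prop :=
  ∀ w : List α,
    (∃ c : tm.Cfg, Occurs tm (w.map inp) c ∧ Turing.TM2.Cfg.l c = none ∧
      (Turing.TM2.Cfg.var c ∈ acc ↔ w ∈ L)) ∧
    ∀ c : tm.Cfg, Occurs tm (w.map inp) c → cfgSpace tm c ≤ s w.length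

/-- The languages over the finite alphabet `α` that are decided by a deterministic machine, with
finite stack alphabets, in space bounded by a polynomial in the length of the input. -/
def PSPACE (α : Type) [Finite α] : Set (Language α) :=
  {L | ∃ (tm : Turing.FinTM2) (inp : α → tm.Γ tm.k₀) (acc : Set tm.σ) (P : Polynomial ℕ),
    (∀ k, Finite (tm.Γ k)) ∧ DecidesInSpace tm inp acc L (fun n => P.eval n)}

end XPathVars

namespace XPathVars

-- Small counterexamples. If containment fails, some pair (t, ρ) matches p but not q. The language
-- is positive, so the match of p is witnessed by at most |p| vertices (`LPath.exists_witness`). Let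
-- W consist of these vertices and the root, and let n be the length of the input. Replace the
-- stretch between each w ∈ W and its closest proper ancestor in W by a private path with at most M
-- = n + 2 neutral vertices. A neutral vertex has no attributes and a label too long to occur in the
-- input. The order on W and the edges between members of W survive, so p still matches
-- (`homOn_embed`).
--
-- Suppose q matched the new tree. At most |q| vertices would witness this, so every path that was
-- really shortened has a neutral vertex that is neither a witness nor the root (`exists_isGap`).
-- Cut the path just below that vertex, push its lower part down to w and its upper part up to the
-- ancestor. This maps the new tree to t; it preserves the descendant relation and every child edge
-- except those at the cuts, which the witnesses do not use (`place_step`, `homOn_place`). Hence q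
-- would match t, a contradiction.
--
-- Data values are only ever compared with variables, so a value can be replaced by the list of
-- those variables of the input that have it (`valueCode`). The result is a certificate of
-- polynomial size (`exists_isCex_of_not_contained`). Conversely, a certificate of any size unfolds
-- to a genuine counterexample over every infinite D, because its values come from a countable set
-- (`not_contained_of_isCex`).
--
-- Polynomial space. Containment is decided by trying all certificates up to the bound. One of them
-- is checked by evaluating the input word from right to left on a stack whose items are explicit
-- relations on the vertices of the certificate (`eval`, `isCex`). The search takes exponential time
-- but stores one candidate at a time. It is deterministic, so passing to the complement is free.
--
-- To avoid programming Turing machines, one machine is written that interprets a small language on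
-- stacks of binary trees (`within_run`). The class `PS` of functions computed by its programs in
-- polynomial space is closed under composition, folds, loops whose states stay polynomially small,
-- and exhaustive search (`PS.while`, `PS.exists_tree`). It then remains to write `isCex` as a
-- functional program.

/-! ### A stack language on binary trees -/

/-- Binary trees, the data of the stack language. -/
inductive SExp where
  | nil
  | cons (a b : SExp)
  deriving DecidableEq

/-- The prefix notation of a tree. -/
def SExp.word : SExp → List Bool
  | .nil => [false]
  | .cons a b => true :: (a.word ++ b.word)

/-- The length of the prefix notation. -/
def SExp.size : SExp → ℕ
  | .nil => 1
  | .cons a b => a.size + b.size + 1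

@[simp] theorem SExp.length_word (x : SExp) : x.word.length = x.size := by
  induction x with
  | nil => rfl
  | cons a b iha ihb => simp [SExp.word, SExp.size, iha, ihb]

theorem SExp.size_pos (x : SExp) : 0 < x.size := by
  cases x <;> simp [SExp.size]

/-- Programs acting on a stack of trees. -/
inductive Prog where
  | nop | nil | cons | uncons | dup | swap | drop
  | seq (p q : Prog)
  | ite (p q : Prog)
  | loop (p : Prog)

/-- The total size of a stack of trees. -/
def wt (s : List SExp) : ℕ := (s.map SExp.size).sum

@[simp] theorem wt_nil : wt [] = 0 := rfl
@[simp] theorem wt_cons (x : SExp) (s : List SExp) : wt (x :: s) = x.size + wt s := by simp [wt]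

/-- `Run B p s s'`: the program `p` transforms the stack `s` into `s'`, and all stacks that occur
on the way have total size at most `B`. A conditional removes the tree on top of the stack; a loop
does so before each round and ends when that tree is `nil`. -/
inductive Run (B : ℕ) : Prog → List SExp → List SExp → Prop
  | nop {s} : wt s ≤ B → Run B .nop s s
  | nil {s} : wt s + 1 ≤ B → Run B .nil s (.nil :: s)
  | cons {x y s} : wt (.cons x y :: s) ≤ B → Run B .cons (x :: y :: s) (.cons x y :: s)
  | uncons {x y s} : wt (.cons x y :: s) ≤ B → Run B .uncons (.cons x y :: s) (x :: y :: s)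
  | dup {x s} : wt (x :: x :: s) ≤ B → Run B .dup (x :: s) (x :: x :: s)
  | swap {x y s} : wt (x :: y :: s) ≤ B → Run B .swap (x :: y :: s) (y :: x :: s)
  | drop {x s} : wt (x :: s) ≤ B → Run B .drop (x :: s) s
  | seq {p q s s' s''} : Run B p s s' → Run B q s' s'' → Run B (.seq p q) s s''
  | ite_true {p q a b s s'} : wt (.cons a b :: s) ≤ B → Run B p s s' →
      Run B (.ite p q) (.cons a b :: s) s'
  | ite_false {p q s s'} : wt (.nil :: s) ≤ B → Run B q s s' → Run B (.ite p q) (.nil :: s) s'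
  | loop_done {p s} : wt (.nil :: s) ≤ B → Run B (.loop p) (.nil :: s) s
  | loop_step {p a b s s' s''} : wt (.cons a b :: s) ≤ B → Run B p s s' →
      Run B (.loop p) s' s'' → Run B (.loop p) (.cons a b :: s) s''

theorem Run.mono {B B' : ℕ} {p s s'} (h : Run B p s s') (hB : B ≤ B') : Run B' p s s' := by
  induction h with
  | nop h => exact .nop (h.trans hB)
  | nil h => exact .nil (h.trans hB)
  | cons h => exact .cons (h.trans hB)
  | uncons h => exact .uncons (h.trans hB)
  | dup h => exact .dup (h.trans hB)
  | swap h => exact .swap (h.trans hB)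
  | drop h => exact .drop (h.trans hB)
  | seq _ _ h1 h2 => exact .seq h1 h2
  | ite_true h _ h1 => exact .ite_true (h.trans hB) h1
  | ite_false h _ h1 => exact .ite_false (h.trans hB) h1
  | loop_done h => exact .loop_done (h.trans hB)
  | loop_step h _ _ h1 h2 => exact .loop_step (h.trans hB) h1 h2

theorem Run.wt_le {B : ℕ} {p s s'} (h : Run B p s s') : wt s ≤ B := by
  induction h with
  | nil h => omega
  | cons h | uncons h => simp only [wt_cons, SExp.size] at h ⊢; omega
  | dup h => simp only [wt_cons] at h ⊢; omega
  | seq _ _ h _ => exact h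
  | _ => assumption

theorem Run.wt_le' {B : ℕ} {p s s'} (h : Run B p s s') : wt s' ≤ B := by
  induction h with
  | nil h => simp only [wt_cons, SExp.size]; omega
  | uncons h => simp only [wt_cons, SExp.size] at h ⊢; omega
  | swap h => simp only [wt_cons] at h ⊢; omega
  | drop h | loop_done h => simp only [wt_cons] at h; omega
  | _ => assumption

/-- The subprograms of a program. -/
def Prog.subs : Prog → List Prog
  | .seq p q => .seq p q :: (p.subs ++ q.subs)
  | .ite p q => .ite p q :: (p.subs ++ q.subs)
  | .loop p => .loop p :: p.subs
  | p => [p]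

theorem Prog.self_mem_subs (p : Prog) : p ∈ p.subs := by
  cases p <;> simp [Prog.subs]

theorem Prog.subs_trans {p q r : Prog} (h : p ∈ q.subs) (h' : q ∈ r.subs) : p ∈ r.subs := by
  induction r with
  | seq a b iha ihb | ite a b iha ihb =>
    simp only [Prog.subs, List.mem_cons, List.mem_append] at h'
    rcases h' with rfl | h' | h'
    · exact h
    · simp [Prog.subs, iha h']
    · simp [Prog.subs, ihb h']
  | loop a iha =>
    simp only [Prog.subs, List.mem_cons] at h'
    rcases h' with rfl | h'
    · exact h
    · simp [Prog.subs, iha h']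
  | _ =>
    simp only [Prog.subs, List.mem_singleton] at h'
    subst h'
    exact h

theorem Prog.seq_left {p q r : Prog} (h : .seq p q ∈ r.subs) : p ∈ r.subs :=
  Prog.subs_trans (by simp [Prog.subs, Prog.self_mem_subs]) h
theorem Prog.seq_right {p q r : Prog} (h : .seq p q ∈ r.subs) : q ∈ r.subs :=
  Prog.subs_trans (by simp [Prog.subs, Prog.self_mem_subs]) h
theorem Prog.ite_left {p q r : Prog} (h : .ite p q ∈ r.subs) : p ∈ r.subs :=
  Prog.subs_trans (by simp [Prog.subs, Prog.self_mem_subs]) h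
theorem Prog.ite_right {p q r : Prog} (h : .ite p q ∈ r.subs) : q ∈ r.subs :=
  Prog.subs_trans (by simp [Prog.subs, Prog.self_mem_subs]) h
theorem Prog.loop_body {p r : Prog} (h : .loop p ∈ r.subs) : p ∈ r.subs :=
  Prog.subs_trans (by simp [Prog.subs, Prog.self_mem_subs]) h

/-- A bound on the number of pending instructions during the execution of a program. -/
def Prog.height : Prog → ℕ
  | .seq p q => p.height + q.height + 1
  | .ite p q => p.height + q.height + 1
  | .loop p => p.height + 2
  | _ => 1

theorem Prog.height_pos (p : Prog) : 0 < p.height := by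
  cases p <;> simp [Prog.height]

/-! ### The machine that runs a program -/

/-- The stacks: the input, the pending instructions, the trees (in prefix notation), two auxiliary
mkStk and a counter. -/
inductive Stk where
  | inp | ctl | main | aux | aux2 | cnt
  deriving DecidableEq

instance : Fintype Stk where
  elems := {.inp, .ctl, .main, .aux, .aux2, .cnt}
  complete x := by cases x <;> decide

/-- The common alphabet of all stacks: input symbols, subprograms and bits. -/
abbrev Cell (α : Type) (P : Prog) : Type := α ⊕ {p : Prog // p ∈ P.subs} ⊕ Bool

namespace Cell
variable {α : Type} {P : Prog}
abbrev sym (a : α) : Cell α P := .inl a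
abbrev ins (p : Prog) (h : p ∈ P.subs) : Cell α P := .inr (.inl ⟨p, h⟩)
abbrev bit (b : Bool) : Cell α P := .inr (.inr b)
end Cell

/-- The labels `swapA` to `dupD` are passes that move words between stacks. A move reverses a word,
so every copy of a tree is moved an even number of times before it rests on `main`. -/
inductive Lbl (α : Type) (P : Prog) where
  | start | load | enter (a : α) | fetch | exec (p : {p : Prog // p ∈ P.subs})
  | drop | swapA | swapB | swapC | swapD | dupA | dupB | dupC | dupD

instance (α : Type) (P : Prog) [Finite α] : Finite (Lbl α P) := by
  have : Finite {p : Prog // p ∈ P.subs} := (List.finite_toSet P.subs).to_subtype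
  let f : Lbl α P → (α ⊕ {p : Prog // p ∈ P.subs}) ⊕ Fin 13 := fun l => match l with
    | .start => .inr 0 | .load => .inr 1 | .enter a => .inl (.inl a) | .fetch => .inr 2
    | .exec p => .inl (.inr p) | .drop => .inr 3 | .swapA => .inr 4 | .swapB => .inr 5
    | .swapC => .inr 6 | .swapD => .inr 7 | .dupA => .inr 8 | .dupB => .inr 9
    | .dupC => .inr 10 | .dupD => .inr 11
  refine Finite.of_injective f ?_
  intro a b h
  cases a <;> cases b <;> simp_all [f]

section Machine
variable {α : Type} (P : Prog) (code : α → SExp)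

abbrev MStmt (α : Type) (P : Prog) : Type :=
  Turing.TM2.Stmt (fun _ : Stk => Cell α P) (Lbl α P) (Option (Cell α P))

open Turing.TM2.Stmt

/-- Jump to a label with an empty register. -/
abbrev jump (l : Lbl α P) : MStmt α P := load (fun _ => none) (goto fun _ => l)

/-- Push a word, its first letter ending up on top. -/
def pushWord (w : List Bool) (q : MStmt α P) : MStmt α P :=
  match w with
  | [] => q
  | b :: w => pushWord w (push .main (fun _ => .bit b) q)

def isTrue : Option (Cell α P) → Bool
  | some (.inr (.inr b)) => b
  | _ => false

/-- One round of moving a tree from `main` to the stack `tgt`. The counter holds the number of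
trees still to be moved after the current one. -/
def scanStmt (l : Lbl α P) (tgt : Option Stk) (next : MStmt α P) : MStmt α P :=
  let q : MStmt α P := branch (isTrue P) (push .cnt (fun _ => .bit true) (jump P l))
    (pop .cnt (fun _ o => o) (branch Option.isSome (jump P l) next))
  pop .main (fun _ o => o) <| match tgt with
    | none => q
    | some k => push k (fun s => s.getD (.bit false)) q

/-- One round of emptying a stack. -/
def moveStmt (l : Lbl α P) (src : Stk) (tgt : List Stk) (next : MStmt α P) : MStmt α P :=
  pop src (fun _ o => o) <| branch Option.isSome
    (tgt.foldr (fun k q => push k (fun s => s.getD (.bit false)) q) (jump P l)) next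

/-- The code of a single instruction. -/
def execStmt : {p : Prog // p ∈ P.subs} → MStmt α P
  | ⟨.nop, _⟩ => jump P .fetch
  | ⟨.nil, _⟩ => push .main (fun _ => .bit false) (jump P .fetch)
  | ⟨.cons, _⟩ => push .main (fun _ => .bit true) (jump P .fetch)
  | ⟨.uncons, _⟩ => pop .main (fun _ o => o) (jump P .fetch)
  | ⟨.dup, _⟩ => jump P .dupA
  | ⟨.swap, _⟩ => jump P .swapA
  | ⟨.drop, _⟩ => jump P .drop
  | ⟨.seq p q, h⟩ => push .ctl (fun _ => .ins q (Prog.seq_right h)) <|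
      push .ctl (fun _ => .ins p (Prog.seq_left h)) (jump P .fetch)
  | ⟨.ite p q, h⟩ => peek .main (fun _ o => o) <| branch (isTrue P)
      (push .ctl (fun _ => .ins p (Prog.ite_left h)) (jump P .drop))
      (push .ctl (fun _ => .ins q (Prog.ite_right h)) (jump P .drop))
  | ⟨.loop p, h⟩ => peek .main (fun _ o => o) <| branch (isTrue P)
      (push .ctl (fun _ => .ins (.loop p) h) <|
        push .ctl (fun _ => .ins p (Prog.loop_body h)) (jump P .drop))
      (jump P .drop)

/-- The code of the machine: the input is turned into a list of trees on `main`, then the program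
is run. -/
def machineCode : Lbl α P → MStmt α P
  | .start => moveStmt P .start .inp [.aux] <|
      push .ctl (fun _ => .ins P P.self_mem_subs) <|
      push .main (fun _ => .bit false) (jump P .load)
  | .load => pop .aux (fun _ o => o) <| goto fun s => match s with
      | some (.inl a) => .enter a
      | _ => .fetch
  | .enter a => pushWord P (code a).word <| push .main (fun _ => .bit true) (jump P .load)
  | .fetch => pop .ctl (fun _ o => o) <| branch Option.isSome
      (goto fun s => match s with
        | some (.inr (.inl p)) => .exec p
        | _ => .fetch)
      -- No instruction is pending: the first letter of the result stays in the register, where it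
      -- decides acceptance.
      (peek .main (fun _ o => o) halt)
  | .exec p => execStmt P p
  | .drop => scanStmt P .drop none (jump P .fetch)
  | .swapA => scanStmt P .swapA (some .aux) (jump P .swapB)
  | .swapB => scanStmt P .swapB (some .aux2) (jump P .swapC)
  | .swapC => moveStmt P .swapC .aux [.main] (jump P .swapD)
  | .swapD => moveStmt P .swapD .aux2 [.main] (jump P .fetch)
  | .dupA => scanStmt P .dupA (some .aux) (jump P .dupB)
  | .dupB => moveStmt P .dupB .aux [.main, .aux2] (jump P .dupC)
  | .dupC => moveStmt P .dupC .aux2 [.aux] (jump P .dupD)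
  | .dupD => moveStmt P .dupD .aux [.main] (jump P .fetch)

abbrev MCfg (α : Type) (P : Prog) : Type :=
  Turing.TM2.Cfg (fun _ : Stk => Cell α P) (Lbl α P) (Option (Cell α P))

-- Configurations and runs within a space bound

variable {P}

/-- The contents of all stacks. -/
def mkStk (inp ctl main aux aux2 cnt : List (Cell α P)) : Stk → List (Cell α P)
  | .inp => inp | .ctl => ctl | .main => main | .aux => aux | .aux2 => aux2 | .cnt => cnt

section
variable (i t m a b c x : List (Cell α P))

@[simp] theorem mkStk_inp : mkStk i t m a b c .inp = i := rfl
@[simp] theorem mkStk_ctl : mkStk i t m a b c .ctl = t := rfl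
@[simp] theorem mkStk_main : mkStk i t m a b c .main = m := rfl
@[simp] theorem mkStk_aux : mkStk i t m a b c .aux = a := rfl
@[simp] theorem mkStk_aux2 : mkStk i t m a b c .aux2 = b := rfl
@[simp] theorem mkStk_cnt : mkStk i t m a b c .cnt = c := rfl

@[simp] theorem update_mkStk_inp :
    Function.update (mkStk i t m a b c) .inp x = mkStk x t m a b c := by
  funext k; cases k <;> simp [Function.update, mkStk]
@[simp] theorem update_mkStk_ctl :
    Function.update (mkStk i t m a b c) .ctl x = mkStk i x m a b c := by
  funext k; cases k <;> simp [Function.update, mkStk]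
@[simp] theorem update_mkStk_main :
    Function.update (mkStk i t m a b c) .main x = mkStk i t x a b c := by
  funext k; cases k <;> simp [Function.update, mkStk]
@[simp] theorem update_mkStk_aux :
    Function.update (mkStk i t m a b c) .aux x = mkStk i t m x b c := by
  funext k; cases k <;> simp [Function.update, mkStk]
@[simp] theorem update_mkStk_aux2 :
    Function.update (mkStk i t m a b c) .aux2 x = mkStk i t m a x c := by
  funext k; cases k <;> simp [Function.update, mkStk]
@[simp] theorem update_mkStk_cnt :
    Function.update (mkStk i t m a b c) .cnt x = mkStk i t m a b x := by
  funext k; cases k <;> simp [Function.update, mkStk]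
end

/-- The number of cells in use. -/
def space (c : MCfg α P) : ℕ := ∑ k : Stk, (c.stk k).length

@[simp] theorem space_mkStk (l : Option (Lbl α P)) (v) (i t m a b c : List (Cell α P)) :
    space ⟨l, v, mkStk i t m a b c⟩
      = i.length + t.length + m.length + a.length + b.length + c.length := by
  have : (Finset.univ : Finset Stk) = {.inp, .ctl, .main, .aux, .aux2, .cnt} := rfl
  simp [space, this, add_assoc]

/-- The machine gets from one configuration to another with all configurations on the way using
at most `B` cells. -/
inductive Within (B : ℕ) : MCfg α P → MCfg α P → Prop
  | refl {c} : space c ≤ B → Within B c c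
  | head {c d e} : space c ≤ B → Turing.TM2.step (machineCode P code) c = some d →
      Within B d e → Within B c e

variable {code}

theorem Within.trans {B : ℕ} {c d e : MCfg α P} (h : Within code B c d) (h' : Within code B d e) :
    Within code B c e := by
  induction h with
  | refl _ => exact h'
  | head h1 h2 _ ih => exact .head h1 h2 (ih h')

theorem Within.mono {B B' : ℕ} {c d : MCfg α P} (h : Within code B c d) (hB : B ≤ B') :
    Within code B' c d := by
  induction h with
  | refl h => exact .refl (h.trans hB)
  | head h1 h2 _ ih => exact .head (h1.trans hB) h2 ih

/-- A run that ends in a halting configuration contains all reachable configurations. -/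
theorem Within.space_le {B : ℕ} {c d : MCfg α P} (h : Within code B c d)
    (hd : Turing.TM2.step (machineCode P code) d = none) (e : MCfg α P)
    (he : Turing.TM2.Reaches (machineCode P code) c e) : space e ≤ B := by
  induction h with
  | refl h =>
    rcases Relation.ReflTransGen.cases_head he with rfl | ⟨x, hx, _⟩
    · exact h
    · rw [hd] at hx; simp at hx
  | head h1 h2 h3 ih =>
    rcases Relation.ReflTransGen.cases_head he with rfl | ⟨x, hx, hxe⟩
    · exact h1
    · rw [h2] at hx
      obtain rfl : _ = x := by simpa using hx
      exact ih hd hxe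

theorem Within.reaches {B : ℕ} {c d : MCfg α P} (h : Within code B c d) :
    Turing.TM2.Reaches (machineCode P code) c d := by
  induction h with
  | refl _ => exact .refl
  | head _ h2 _ ih => exact .head h2 ih

theorem Within.step {B : ℕ} {l : Lbl α P} {v} {S : Stk → List (Cell α P)} {d : MCfg α P}
    (h : Turing.TM2.stepAux (machineCode P code l) v S = d)
    (h1 : space (P := P) ⟨some l, v, S⟩ ≤ B) (h2 : space d ≤ B) :
    Within code B ⟨some l, v, S⟩ d :=
  .head h1 (by simp [← h]) (.refl h2)

/-- A loop that moves the symbols of a list one at a time. -/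
theorem Within.move {B N : ℕ} {l : Lbl α P} {c : MCfg α P}
    (F : List (Cell α P) → List (Cell α P) → Stk → List (Cell α P))
    (h1 : ∀ x xs ys, Turing.TM2.stepAux (machineCode P code l) none (F (x :: xs) ys)
      = ⟨some l, none, F xs (x :: ys)⟩)
    (hs : ∀ xs ys, xs.length + ys.length ≤ N → space (P := P) ⟨some l, none, F xs ys⟩ ≤ B)
    (hc : space c ≤ B) (xs ys : List (Cell α P)) (hN : xs.length + ys.length ≤ N)
    (h2 : Turing.TM2.stepAux (machineCode P code l) none (F [] (xs.reverse ++ ys)) = c) :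
    Within code B ⟨some l, none, F xs ys⟩ c := by
  induction xs generalizing ys with
  | nil => exact .step h2 (hs _ _ hN) hc
  | cons x xs ih =>
    simp only [List.length_cons] at hN
    refine .head (hs _ _ (by simpa using hN)) (by rw [Turing.TM2.step, h1]) (ih _ ?_ ?_)
    · simp only [List.length_cons]; omega
    · simpa using h2

/-- A word over the bits as a list of cells. -/
def bits (w : List Bool) : List (Cell α P) := w.map Cell.bit

@[simp] theorem bits_nil : bits (α := α) (P := P) [] = [] := rfl
@[simp] theorem bits_cons (b : Bool) (w : List Bool) :
    bits (α := α) (P := P) (b :: w) = Cell.bit b :: bits w := rfl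
@[simp] theorem bits_append (w w' : List Bool) :
    bits (α := α) (P := P) (w ++ w') = bits w ++ bits w' := by simp [bits]
@[simp] theorem length_bits (w : List Bool) :
    (bits (α := α) (P := P) w).length = w.length := by simp [bits]

/-- Moving a tree when the counter is positive. -/
theorem Within.scan_inner {B N C : ℕ} {l : Lbl α P}
    (F : List (Cell α P) → List (Cell α P) → List (Cell α P) → Stk → List (Cell α P))
    (ht : ∀ m a c, Turing.TM2.stepAux (machineCode P code l) none (F (.bit true :: m) a c)
      = ⟨some l, none, F m (.bit true :: a) (.bit true :: c)⟩)
    (hf : ∀ m a x c, Turing.TM2.stepAux (machineCode P code l) none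
      (F (.bit false :: m) a (x :: c)) = ⟨some l, none, F m (.bit false :: a) c⟩)
    (hs : ∀ m a c, m.length + a.length ≤ N → c.length ≤ C →
      space (P := P) ⟨some l, none, F m a c⟩ ≤ B)
    (x : SExp) (m a : List (Cell α P)) (k) (c : List (Cell α P))
    (hN : x.size + m.length + a.length ≤ N) (hC : c.length + 1 + x.size ≤ C) :
    Within code B ⟨some l, none, F (bits x.word ++ m) a (k :: c)⟩
      ⟨some l, none, F m ((bits x.word).reverse ++ a) c⟩ := by
  induction x generalizing m a k c with
  | nil =>
    simp only [SExp.size] at hN hC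
    refine .step ?_ (hs _ _ _ ?_ ?_) (hs _ _ _ ?_ ?_)
    · simpa [SExp.word] using hf m a k c
    all_goals try simp [SExp.word]
    all_goals omega
  | cons x y ihx ihy =>
    simp only [SExp.size] at hN hC
    have e : bits (α := α) (P := P) (SExp.cons x y).word ++ m
        = .bit true :: (bits x.word ++ (bits y.word ++ m)) := by simp [SExp.word]
    rw [e]
    refine .head (hs _ _ _ ?_ ?_) (by rw [Turing.TM2.step, ht]) ?_
    · simp [SExp.length_word]; omega
    · simp; omega
    refine (ihx _ _ _ _ ?_ ?_).trans ?_
    · simp [SExp.length_word]; omega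
    · simp; omega
    have e' : (bits (α := α) (P := P) (SExp.cons x y).word).reverse ++ a
        = (bits y.word).reverse ++ ((bits x.word).reverse ++ (.bit true :: a)) := by
      simp [SExp.word]
    rw [e']
    refine ihy _ _ _ _ ?_ ?_
    · simp [SExp.length_word]; omega
    · omega

/-- Moving a tree when the counter is zero. -/
theorem Within.scan {B N C : ℕ} {l next : Lbl α P}
    (F : List (Cell α P) → List (Cell α P) → List (Cell α P) → Stk → List (Cell α P))
    (ht : ∀ m a c, Turing.TM2.stepAux (machineCode P code l) none (F (.bit true :: m) a c)
      = ⟨some l, none, F m (.bit true :: a) (.bit true :: c)⟩)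
    (hf : ∀ m a x c, Turing.TM2.stepAux (machineCode P code l) none
      (F (.bit false :: m) a (x :: c)) = ⟨some l, none, F m (.bit false :: a) c⟩)
    (hn : ∀ m a, Turing.TM2.stepAux (machineCode P code l) none
      (F (.bit false :: m) a []) = ⟨some next, none, F m (.bit false :: a) []⟩)
    (hs : ∀ l m a c, m.length + a.length ≤ N → c.length ≤ C →
      space (P := P) ⟨some l, none, F m a c⟩ ≤ B)
    (x : SExp) (m a : List (Cell α P))
    (hN : x.size + m.length + a.length ≤ N) (hC : x.size ≤ C) :
    Within code B ⟨some l, none, F (bits x.word ++ m) a []⟩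
      ⟨some next, none, F m ((bits x.word).reverse ++ a) []⟩ := by
  induction x generalizing m a with
  | nil =>
    simp only [SExp.size] at hN hC
    refine .step ?_ (hs _ _ _ _ ?_ ?_) (hs _ _ _ _ ?_ ?_)
    · simpa [SExp.word] using hn m a
    all_goals simp [SExp.word]
    all_goals omega
  | cons x y ihx ihy =>
    simp only [SExp.size] at hN hC
    have e : bits (α := α) (P := P) (SExp.cons x y).word ++ m
        = .bit true :: (bits x.word ++ (bits y.word ++ m)) := by simp [SExp.word]
    rw [e]
    refine .head (hs _ _ _ _ ?_ ?_) (by rw [Turing.TM2.step, ht]) ?_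
    · simp [SExp.length_word]; omega
    · simp
    refine (Within.scan_inner F ht hf (hs l) x _ _ _ _ ?_ ?_).trans ?_
    · simp [SExp.length_word]; omega
    · simp; omega
    have e' : (bits (α := α) (P := P) (SExp.cons x y).word).reverse ++ a
        = (bits y.word).reverse ++ ((bits x.word).reverse ++ (.bit true :: a)) := by
      simp [SExp.word]
    rw [e']
    refine ihy _ _ ?_ ?_
    · simp [SExp.length_word]; omega
    · omega

-- Simulation of programs

/-- The stack of trees as a word on `main`. -/
def cells : List SExp → List (Cell α P)
  | [] => []
  | x :: s => bits x.word ++ cells s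

@[simp] theorem cells_nil : cells (α := α) (P := P) [] = [] := rfl
@[simp] theorem cells_cons (x : SExp) (s : List SExp) :
    cells (α := α) (P := P) (x :: s) = bits x.word ++ cells s := rfl
@[simp] theorem length_cells (s : List SExp) : (cells (α := α) (P := P) s).length = wt s := by
  induction s with
  | nil => rfl
  | cons x s ih => simp [ih, SExp.length_word]

/-- The configurations between two instructions. -/
abbrev atFetch (t : List (Cell α P)) (s : List SExp) : MCfg α P :=
  ⟨some .fetch, none, mkStk [] t (cells s) [] [] []⟩

-- The term `2 * B` pays once for the trees and once for the unary counter, which never exceeds the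
-- size of the tree being moved.
variable (code) in
theorem within_drop {B : ℕ} (t : List (Cell α P)) (x : SExp) (s : List SExp)
    (hB : wt (x :: s) ≤ B) :
    Within code (t.length + 2 * B) ⟨some .drop, none, mkStk [] t (cells (x :: s)) [] [] []⟩
      (atFetch t s) := by
  refine Within.scan (N := wt (x :: s)) (C := x.size) (next := .fetch)
    (fun m _ c => mkStk [] t m [] [] c) ?_ ?_ ?_ ?_ x (cells s) [] ?_ le_rfl
  · intros; simp [machineCode, scanStmt, isTrue]
  · intros; simp [machineCode, scanStmt, isTrue]
  · intros; simp [machineCode, scanStmt, isTrue]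
  · intro l m a c h1 h2; simp at h1 hB ⊢; omega
  · simp

variable (code) in
theorem within_swap {B : ℕ} (t : List (Cell α P)) (x y : SExp) (s : List SExp)
    (hB : wt (x :: y :: s) ≤ B) :
    Within code (t.length + 2 * B)
      ⟨some .swapA, none, mkStk [] t (cells (x :: y :: s)) [] [] []⟩
      (atFetch t (y :: x :: s)) := by
  have hB' := hB
  simp only [wt_cons] at hB'
  refine (Within.scan (N := wt (x :: y :: s)) (C := x.size) (next := .swapB)
    (fun m a c => mkStk [] t m a [] c) ?_ ?_ ?_ ?_ x (cells (y :: s)) [] ?_ le_rfl).trans ?_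
  · intros; simp [machineCode, scanStmt, isTrue]
  · intros; simp [machineCode, scanStmt, isTrue]
  · intros; simp [machineCode, scanStmt, isTrue]
  · intro l m a c h1 h2; simp at h1 hB ⊢; omega
  · simp
  refine (Within.scan (N := wt (y :: s)) (C := y.size) (next := .swapC)
    (fun m a c => mkStk [] t m ((bits x.word).reverse ++ []) a c)
    ?_ ?_ ?_ ?_ y (cells s) [] ?_ le_rfl).trans ?_
  · intros; simp [machineCode, scanStmt, isTrue]
  · intros; simp [machineCode, scanStmt, isTrue]
  · intros; simp [machineCode, scanStmt, isTrue]
  · intro l m a c h1 h2; simp [SExp.length_word] at h1 hB ⊢; omega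
  · simp
  refine (Within.move (N := x.size) (l := .swapC)
    (c := ⟨some .swapD, none, mkStk [] t (bits x.word ++ cells s) [] (bits y.word).reverse []⟩)
    (fun b a => mkStk [] t (a ++ cells s) b ((bits y.word).reverse ++ []) []) ?_ ?_ ?_
    ((bits x.word).reverse ++ []) [] ?_ ?_).trans ?_
  · intros; simp [machineCode, moveStmt]
  · intro xs ys h; simp [SExp.length_word]; omega
  · simp [SExp.length_word]; omega
  · simp [SExp.length_word]
  · simp [machineCode, moveStmt]
  refine (Within.move (N := y.size) (l := .swapD)
    (fun b a => mkStk [] t (a ++ (bits x.word ++ cells s)) [] b []) ?_ ?_ ?_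
    (bits y.word).reverse [] ?_ ?_)
  · intros; simp [machineCode, moveStmt]
  · intro xs ys h; simp [SExp.length_word]; omega
  · simp [SExp.length_word]; omega
  · simp [SExp.length_word]
  · simp [machineCode, moveStmt]

variable (code) in
theorem within_dup {B : ℕ} (t : List (Cell α P)) (x : SExp) (s : List SExp)
    (hB : wt (x :: x :: s) ≤ B) :
    Within code (t.length + 2 * B)
      ⟨some .dupA, none, mkStk [] t (cells (x :: s)) [] [] []⟩
      (atFetch t (x :: x :: s)) := by
  have hB' := hB
  simp only [wt_cons] at hB'
  refine (Within.scan (N := wt (x :: s)) (C := x.size) (next := .dupB)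
    (fun m a c => mkStk [] t m a [] c) ?_ ?_ ?_ ?_ x (cells s) [] ?_ le_rfl).trans ?_
  · intros; simp [machineCode, scanStmt, isTrue]
  · intros; simp [machineCode, scanStmt, isTrue]
  · intros; simp [machineCode, scanStmt, isTrue]
  · intro l m a c h1 h2; simp at h1 hB ⊢; omega
  · simp
  refine (Within.move (N := x.size) (l := .dupB)
    (c := ⟨some .dupC, none, mkStk [] t (bits x.word ++ cells s) [] (bits x.word) []⟩)
    (fun b a => mkStk [] t (a ++ cells s) b a []) ?_ ?_ ?_
    ((bits x.word).reverse ++ []) [] ?_ ?_).trans ?_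
  · intros; simp [machineCode, moveStmt]
  · intro xs ys h; simp; omega
  · simp [SExp.length_word]; omega
  · simp [SExp.length_word]
  · simp [machineCode, moveStmt]
  refine (Within.move (N := x.size) (l := .dupC)
    (c := ⟨some .dupD, none, mkStk [] t (bits x.word ++ cells s) (bits x.word).reverse [] []⟩)
    (fun b a => mkStk [] t (bits x.word ++ cells s) a b []) ?_ ?_ ?_
    (bits x.word) [] ?_ ?_).trans ?_
  · intros; simp [machineCode, moveStmt]
  · intro xs ys h; simp [SExp.length_word]; omega
  · simp [SExp.length_word]; omega
  · simp [SExp.length_word]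
  · simp [machineCode, moveStmt]
  refine (Within.move (N := x.size) (l := .dupD)
    (fun b a => mkStk [] t (a ++ (bits x.word ++ cells s)) b [] []) ?_ ?_ ?_
    (bits x.word).reverse [] ?_ ?_)
  · intros; simp [machineCode, moveStmt]
  · intro xs ys h; simp [SExp.length_word]; omega
  · simp [SExp.length_word]; omega
  · simp [SExp.length_word]
  · simp [machineCode, moveStmt]

theorem step_fetch_ins (p : Prog) (h : p ∈ P.subs) (t m : List (Cell α P)) :
    Turing.TM2.stepAux (machineCode P code .fetch) none (mkStk [] (.ins p h :: t) m [] [] [])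
      = ⟨some (.exec ⟨p, h⟩), some (.ins p h), mkStk [] t m [] [] []⟩ := by
  simp [machineCode]

/-- The machine runs programs. -/
theorem within_run {B : ℕ} {p : Prog} {s s' : List SExp} (hr : Run B p s s') :
    ∀ (h : p ∈ P.subs) (t : List (Cell α P)),
      Within code (t.length + p.height + 2 * B) (atFetch (.ins p h :: t) s) (atFetch t s') := by
  -- Fetching frees the cell of the instruction, which `height_pos` has paid for; only the code of
  -- the instruction remains to be followed.
  have hd : ∀ {p : Prog} {s : List SExp} (h : p ∈ P.subs) (t : List (Cell α P)) (d : MCfg α P),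
      wt s ≤ B →
      Within code (t.length + p.height + 2 * B)
        ⟨some (.exec ⟨p, h⟩), some (.ins p h), mkStk [] t (cells s) [] [] []⟩ d →
      Within code (t.length + p.height + 2 * B) (atFetch (.ins p h :: t) s) d := by
    intro p s h t d hs hw
    refine .head ?_ (by rw [atFetch, Turing.TM2.step, step_fetch_ins]) hw
    have := p.height_pos
    simp; omega
  induction hr with
  | nop hB =>
    intro h t
    refine hd h t _ hB (.step ?_ ?_ ?_)
    · simp [machineCode, execStmt]
    all_goals simp [Prog.height]; omega
  | nil hB =>
    intro h t
    refine hd h t _ (by omega) (.step ?_ ?_ ?_)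
    · simp [machineCode, execStmt, SExp.word]
    all_goals simp [Prog.height, SExp.size]; omega
  | cons hB =>
    intro h t
    simp [SExp.size] at hB
    refine hd h t _ (by simp; omega) (.step ?_ ?_ ?_)
    · simp [machineCode, execStmt, SExp.word]
    all_goals simp [Prog.height, SExp.size]; omega
  | uncons hB =>
    intro h t
    simp [SExp.size] at hB
    refine hd h t _ (by simp [SExp.size]; omega) (.step ?_ ?_ ?_)
    · simp [machineCode, execStmt, SExp.word]
    all_goals simp [Prog.height, SExp.size]; omega
  | @dup x s hB =>
    intro h t
    have := hB
    simp at this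
    refine hd h t _ (by simp; omega) (.head ?_ (by simp [machineCode, execStmt])
      ((within_dup code t x s hB).mono (by omega)))
    simp [Prog.height]; omega
  | @swap x y s hB =>
    intro h t
    have := hB
    simp at this
    refine hd h t _ hB (.head ?_ (by simp [machineCode, execStmt])
      ((within_swap code t x y s hB).mono (by omega)))
    simp [Prog.height]; omega
  | @drop x s hB =>
    intro h t
    have := hB
    simp at this
    refine hd h t _ hB (.head ?_ (by simp [machineCode, execStmt])
      ((within_drop code t x s hB).mono (by omega)))
    simp [Prog.height]; omega
  | @seq p q s s' s'' _ _ ih1 ih2 =>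
    intro h t
    -- While `p` runs, `q` occupies one more cell of `ctl`; the height of `seq` allows for it.
    have h1 := ih1 (Prog.seq_left h) (.ins q (Prog.seq_right h) :: t)
    have h2 := ih2 (Prog.seq_right h) t
    have hs : wt s ≤ B := Run.wt_le ‹_›
    refine hd h t _ hs (.head ?_ (by simp [machineCode, execStmt]) ((h1.mono ?_).trans
      (h2.mono ?_)))
    all_goals simp [Prog.height]; try omega
  | @ite_true p q a b s s' hB _ ih =>
    intro h t
    have h1 := ih (Prog.ite_left h) t
    have := hB
    simp at this
    refine hd h t _ hB (.head ?_ (by simp [machineCode, execStmt, SExp.word, isTrue])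
      (((within_drop code (.ins p (Prog.ite_left h) :: t) _ s hB).mono ?_).trans (h1.mono ?_)))
    all_goals simp [Prog.height]; try omega
  | @ite_false p q s s' hB _ ih =>
    intro h t
    have h1 := ih (Prog.ite_right h) t
    have := hB
    simp at this
    refine hd h t _ hB (.head ?_ (by simp [machineCode, execStmt, SExp.word, isTrue])
      (((within_drop code (.ins q (Prog.ite_right h) :: t) _ s hB).mono ?_).trans (h1.mono ?_)))
    all_goals simp [Prog.height]; try omega
  | @loop_done p s hB =>
    intro h t
    have := hB
    simp at this
    refine hd h t _ hB (.head ?_ (by simp [machineCode, execStmt, SExp.word, isTrue])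
      ((within_drop code t _ s hB).mono ?_))
    all_goals simp [Prog.height]; try omega
  | @loop_step p a b s s' s'' hB _ _ ih1 ih2 =>
    intro h t
    have h1 := ih1 (Prog.loop_body h) (.ins (.loop p) h :: t)
    have h2 := ih2 h t
    have := hB
    simp at this
    refine hd h t _ hB (.head ?_ (by simp [machineCode, execStmt, SExp.word, isTrue])
      (((within_drop code (.ins p (Prog.loop_body h) :: .ins (.loop p) h :: t) _ s hB).mono
        ?_).trans ((h1.mono ?_).trans (h2.mono ?_))))
    all_goals simp [Prog.height]; try omega

-- Loading the input

theorem stepAux_pushWord (w : List Bool) (q : MStmt α P) (v) (t m a : List (Cell α P)) :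
    Turing.TM2.stepAux (pushWord P w q) v (mkStk [] t m a [] [])
      = Turing.TM2.stepAux q v (mkStk [] t (bits w ++ m) a [] []) := by
  induction w generalizing q with
  | nil => rfl
  | cons b w ih => simp [pushWord, ih]

/-- The tree that represents a list. -/
def listTree : List SExp → SExp
  | [] => .nil
  | x :: l => .cons x (listTree l)

/-- Each letter still unread will add at least one cell to the finished tree, so the size of that
tree bounds the space of the whole loading phase. -/
theorem length_add_size_listTree_le (w w' : List SExp) :
    w.length + (listTree w').size ≤ (listTree (w ++ w')).size := by
  induction w with
  | nil => simp
  | cons x w ih => simp only [List.length_cons, List.cons_append, listTree, SExp.size]; omega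

/-- Reading the input. -/
theorem within_load {B : ℕ} (t : List (Cell α P)) (w w' : List α)
    (hB : t.length + (listTree ((w.reverse ++ w').map code)).size ≤ B) :
    Within code B
      ⟨some .load, none, mkStk [] t (cells [listTree (w'.map code)]) (w.map Cell.sym) [] []⟩
      (atFetch t [listTree ((w.reverse ++ w').map code)]) := by
  have hle : ∀ w w' : List α, w.length + (listTree (w'.map code)).size
      ≤ (listTree ((w.reverse ++ w').map code)).size := by
    intro w w'
    have := length_add_size_listTree_le (w.reverse.map code) (w'.map code)
    simpa using this
  induction w generalizing w' with
  | nil =>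
    refine .step ?_ ?_ ?_
    · simp [machineCode]
    all_goals simp at hB ⊢; omega
  | cons a w ih =>
    have h1 := hle (a :: w) w'
    have h2 := hle w (a :: w')
    simp only [List.reverse_cons, List.append_assoc, List.singleton_append,
      List.length_cons] at hB h1 ⊢
    refine .head (d := ⟨some (.enter a), some (.sym a),
      mkStk [] t (cells [listTree (w'.map code)]) (w.map Cell.sym) [] []⟩) ?_
      (by simp [machineCode]) (.head ?_ (by rw [Turing.TM2.step]) ?_)
    · simp; omega
    · simp; omega
    · convert ih (a :: w') hB using 1
      simp [machineCode, stepAux_pushWord, listTree, SExp.word]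

end Machine

-- From programs to languages in `PSPACE`

section Decide
open Turing
variable {α : Type} [Fintype α]

/-- The machine that runs a program. -/
noncomputable def machine (P : Prog) (code : α → SExp) : FinTM2 :=
  letI : Finite {p : Prog // p ∈ P.subs} := (List.finite_toSet P.subs).to_subtype
  letI : Fintype (Cell α P) := Fintype.ofFinite _
  { K := Stk
    k₀ := .inp
    k₁ := .inp
    Γ := fun _ => Cell α P
    Λ := Lbl α P
    main := .start
    ΛFin := Fintype.ofFinite _
    σ := Option (Cell α P)
    initialState := none
    m := machineCode P code }

/-- A language is in `PSPACE` if some program computes its characteristic function in polynomial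
space. -/
theorem mem_PSPACE_of_run {L : Language α} (p : Prog) (code : α → SExp) (Q : Polynomial ℕ)
    (h : ∀ w : List α, ∃ r : SExp,
      Run (Q.eval w.length) p [listTree (w.map code)] [r] ∧ (r ≠ .nil ↔ w ∈ L)) :
    L ∈ PSPACE α := by
  have hfin : Finite {q : Prog // q ∈ p.subs} := (List.finite_toSet p.subs).to_subtype
  refine ⟨machine p code, Cell.sym, {s | isTrue p s = true},
    -- `.X + 2` covers the moment when the input has been reversed and the program and an empty tree
    -- have been pushed; the rest is the cost of `within_run`.
    .X + 2 + .C p.height + 2 * Q, fun _ => inferInstanceAs (Finite (Cell α p)), ?_⟩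
  intro w
  obtain ⟨r, hr, hL⟩ := h w
  set B := Q.eval w.length with hBdef
  have hB := hr.wt_le
  have hlen : w.length + 1 ≤ B := by
    have := length_add_size_listTree_le (w.map code) []
    simp [listTree, SExp.size] at this hB
    omega
  have hrB : r.size ≤ B := by simpa using hr.wt_le'
  have hinit : initList (machine p code) (w.map Cell.sym)
      = (⟨some .start, none, mkStk (w.map Cell.sym) [] [] [] [] []⟩ : MCfg α p) := by
    refine congrArg (TM2.Cfg.mk _ _) (funext fun k => ?_)
    cases k <;> rfl
  have hrun : Within code (w.length + 2 + p.height + 2 * B)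
      (⟨some .start, none, mkStk (w.map Cell.sym) [] [] [] [] []⟩ : MCfg α p)
      ⟨none, (cells [r]).head?, mkStk [] [] (cells [r]) [] [] []⟩ := by
    refine (Within.move (N := w.length) (l := .start)
      (c := ⟨some .load, none, mkStk [] [.ins p p.self_mem_subs] (cells [listTree []])
        (w.reverse.map Cell.sym) [] []⟩)
      (fun b a => mkStk b [] [] a [] []) ?_ ?_ ?_ (w.map Cell.sym) [] ?_ ?_).trans ?_
    · intros; simp [machineCode, moveStmt]
    · intro xs ys h; simp; omega
    · simp [listTree, SExp.size]; omega
    · simp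
    · simp [machineCode, moveStmt, listTree, SExp.word]
    have h1 := within_load (code := code) (B := 1 + B) [.ins p p.self_mem_subs] w.reverse []
      (by simp at hB ⊢; omega)
    have h2 := within_run (code := code) hr p.self_mem_subs []
    rw [List.reverse_reverse, List.append_nil] at h1
    refine (h1.mono (B' := w.length + 2 + p.height + 2 * B) (by omega)).trans
      ((h2.mono (by simp)).trans (.step ?_ ?_ ?_))
    · simp [machineCode]
    · simp; omega
    · simp; omega
  have hocc : ∀ c : MCfg α p, Occurs (machine p code) (w.map Cell.sym) c ↔
      TM2.Reaches (machineCode p code) ⟨some .start, none, mkStk (w.map Cell.sym) [] [] [] [] []⟩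
        c := by
    intro c
    unfold Occurs
    rw [hinit]
    rfl
  refine ⟨⟨_, (hocc _).2 hrun.reaches, rfl, ?_⟩, fun c hc => ?_⟩
  · rw [← hL]
    change isTrue p (cells [r]).head? = true ↔ _
    cases r <;> simp [SExp.word, isTrue]
  · have := hrun.space_le rfl c ((hocc c).1 hc)
    simp only [Polynomial.eval_add, Polynomial.eval_mul, Polynomial.eval_X, Polynomial.eval_C,
      Polynomial.eval_ofNat]
    exact this

end Decide

/-! ### Functions computable in polynomial space -/

/-- Types whose elements are represented by trees. -/
class Coded (α : Type) where
  enc : α → SExp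
  inj : Function.Injective enc

open Coded

/-- The size of the representation. -/
def sz {α : Type} [Coded α] (a : α) : ℕ := (enc a).size

instance : Coded SExp := ⟨fun x => x, fun _ _ h => h⟩

instance : Coded Bool :=
  ⟨fun b => if b then .cons .nil .nil else .nil, by intro a b; cases a <;> cases b <;> simp⟩

instance {α β : Type} [Coded α] [Coded β] : Coded (α × β) :=
  ⟨fun x => .cons (enc x.1) (enc x.2), by
    rintro ⟨a, b⟩ ⟨a', b'⟩ h
    simp only [SExp.cons.injEq] at h
    rw [inj h.1, inj h.2]⟩

theorem listTree_injective : Function.Injective listTree := by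
  intro l
  induction l with
  | nil => intro l' h; cases l' <;> simp_all [listTree]
  | cons a l ih =>
    intro l' h
    cases l' with
    | nil => simp [listTree] at h
    | cons b l' =>
      simp only [listTree, SExp.cons.injEq] at h
      rw [h.1, ih h.2]

instance {α : Type} [Coded α] : Coded (List α) :=
  ⟨fun l => listTree (l.map enc), fun _ _ h =>
    List.map_injective_iff.2 inj (listTree_injective h)⟩

-- Sizes of representations

section
variable {α β : Type} [Coded α] [Coded β]

@[simp] theorem enc_true : enc true = .cons .nil .nil := rfl
@[simp] theorem enc_false : enc false = .nil := rfl
@[simp] theorem enc_sexp (x : SExp) : enc x = x := rfl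
@[simp] theorem enc_pair (a : α) (b : β) : enc (a, b) = .cons (enc a) (enc b) := rfl
theorem enc_prod (x : α × β) : enc x = .cons (enc x.1) (enc x.2) := rfl
@[simp] theorem enc_nil : enc ([] : List α) = .nil := rfl
@[simp] theorem enc_cons (a : α) (l : List α) : enc (a :: l) = .cons (enc a) (enc l) := rfl

theorem sz_pos (a : α) : 0 < sz a := SExp.size_pos _
@[simp] theorem sz_pair (a : α) (b : β) : sz (a, b) = sz a + sz b + 1 := rfl
theorem sz_prod (x : α × β) : sz x = sz x.1 + sz x.2 + 1 := rfl
@[simp] theorem sz_nil : sz ([] : List α) = 1 := rfl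
@[simp] theorem sz_cons (a : α) (l : List α) : sz (a :: l) = sz a + sz l + 1 := rfl
@[simp] theorem sz_false : sz false = 1 := rfl
@[simp] theorem sz_true : sz true = 3 := rfl
theorem sz_bool (b : Bool) : sz b ≤ 3 := by cases b <;> simp
theorem size_enc (a : α) : (enc a).size = sz a := rfl
theorem size_listTree (l : List α) : (listTree (l.map enc)).size = sz l := rfl

theorem sz_list (l : List α) : sz l = (l.map fun a => sz a + 1).sum + 1 := by
  induction l with
  | nil => rfl
  | cons a l ih => simp [ih]; omega

theorem length_lt_sz (l : List α) : l.length < sz l := by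
  induction l with
  | nil => simp
  | cons a l ih => simp; omega

@[simp] theorem sz_append (l l' : List α) : sz (l ++ l') + 1 = sz l + sz l' := by
  simp [sz_list]; omega

@[simp] theorem sz_reverse (l : List α) : sz l.reverse = sz l := by
  simp [sz_list, List.sum_reverse]

theorem sz_le_of_mem {a : α} {l : List α} (h : a ∈ l) : sz a + 1 ≤ sz l := by
  rw [sz_list]
  have := List.single_le_sum (l := l.map fun a => sz a + 1) (by simp) (sz a + 1)
    (List.mem_map_of_mem h)
  omega

theorem sz_sublist {l l' : List α} (h : l.Sublist l') : sz l ≤ sz l' := by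
  induction h with
  | slnil => simp
  | cons a _ ih => simp; omega
  | cons_cons a _ ih => simp; omega

theorem sz_list_le {l : List α} {n B : ℕ} (hl : l.length ≤ n) (hB : ∀ a ∈ l, sz a ≤ B) :
    sz l ≤ n * (B + 1) + 1 := by
  rw [sz_list]
  have := List.sum_le_card_nsmul (l.map fun a => sz a + 1) (B + 1) (by
    intro x hx
    obtain ⟨a, ha, rfl⟩ := List.mem_map.1 hx
    have := hB a ha
    omega)
  simp only [List.length_map, smul_eq_mul] at this
  have := Nat.mul_le_mul_right (B + 1) hl
  omega
end

/-- Coefficients are natural numbers, so polynomials are monotone. This allows space bounds to be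
composed. -/
theorem eval_mono (P : Polynomial ℕ) {m n : ℕ} (h : m ≤ n) : P.eval m ≤ P.eval n := by
  rw [Polynomial.eval_eq_sum, Polynomial.eval_eq_sum]
  refine Finset.sum_le_sum fun i _ => ?_
  exact Nat.mul_le_mul_left _ (Nat.pow_le_pow_left h i)

/-- The functions computed by programs in polynomial space. -/
@[fun_prop] def PS {α β : Type} [Coded α] [Coded β] (f : α → β) : Prop :=
  -- The stack `s` below the argument is arbitrary and enters the bound only by its own size; this
  -- is what makes programs composable.
  ∃ (p : Prog) (Q : Polynomial ℕ), ∀ (x : α) (s : List SExp),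
    Run (wt s + Q.eval (sz x)) p (enc x :: s) (enc (f x) :: s)

section
variable {α β γ δ : Type} [Coded α] [Coded β] [Coded γ] [Coded δ]

/-- The result is on the stack when the run ends, so the space bound is also a bound for its size.
-/
theorem PS.bound {f : α → β} (h : PS f) :
    ∃ Q : Polynomial ℕ, ∀ x, sz (f x) ≤ Q.eval (sz x) := by
  obtain ⟨p, Q, h⟩ := h
  refine ⟨Q, fun x => ?_⟩
  simpa [size_enc] using (h x []).wt_le'

/-- Functions that do not change the representation. -/
theorem PS.of_enc_eq {f : α → β} (h : ∀ x, enc (f x) = enc x) : PS f := by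
  refine ⟨.nop, .X, fun x s => ?_⟩
  rw [h]
  exact .nop (by simp [size_enc]; omega)

@[fun_prop] theorem PS.identity : PS (fun x : α => x) := .of_enc_eq fun _ => rfl

/-- A program that pushes a fixed tree. -/
def SExp.build : SExp → Prog
  | .nil => .nil
  | .cons a b => .seq b.build (.seq a.build .cons)

theorem SExp.run_build (c : SExp) (s : List SExp) {B : ℕ} (hB : wt s + c.size ≤ B) :
    Run B c.build s (c :: s) := by
  induction c generalizing s with
  | nil => exact .nil hB
  | cons a b iha ihb =>
    simp only [SExp.size] at hB
    refine .seq (ihb s (by omega)) (.seq (iha _ (by simp; omega)) (.cons ?_))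
    simp [SExp.size]; omega

@[fun_prop] theorem PS.const (c : β) : PS (fun _ : α => c) := by
  refine ⟨.seq .drop (enc c).build, .X + .C (sz c), fun x s => ?_⟩
  refine .seq (.drop ?_) (SExp.run_build _ _ ?_)
  · simp [size_enc]; omega
  · simp [size_enc]

@[fun_prop] theorem PS.comp {g : β → γ} {f : α → β} (hg : PS g) (hf : PS f) :
    PS (fun x => g (f x)) := by
  obtain ⟨q, Q, hq⟩ := hg
  obtain ⟨p, R, hp⟩ := hf
  refine ⟨.seq p q, R + Q.comp R, fun x s => .seq ((hp x s).mono ?_) ((hq (f x) s).mono ?_)⟩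
  · simp
  · have : sz (f x) ≤ R.eval (sz x) := by simpa [size_enc] using (hp x []).wt_le'
    have := eval_mono Q this
    simp; omega

@[fun_prop] theorem PS.pair {f : α → β} {g : α → γ} (hf : PS f) (hg : PS g) :
    PS (fun x => (f x, g x)) := by
  obtain ⟨p, Q, hp⟩ := hf
  obtain ⟨q, R, hq⟩ := hg
  refine ⟨.seq .dup (.seq q (.seq .swap (.seq p .cons))), 2 * .X + Q + 2 * R + 1, fun x s => ?_⟩
  have h1 : sz (f x) ≤ Q.eval (sz x) := by simpa [size_enc] using (hp x []).wt_le'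
  have h2 : sz (g x) ≤ R.eval (sz x) := by simpa [size_enc] using (hq x []).wt_le'
  refine .seq (.dup ?_) (.seq ((hq x (enc x :: s)).mono ?_) (.seq (.swap ?_)
    (.seq ((hp x (enc (g x) :: s)).mono ?_) (.cons ?_))))
  all_goals simp [size_enc, SExp.size]; omega

@[fun_prop] theorem PS.fst : PS (fun x : α × β => x.1) := by
  refine ⟨.seq .uncons (.seq .swap .drop), .X, fun x s => ?_⟩
  rw [enc_prod]
  refine .seq (.uncons ?_) (.seq (.swap ?_) (.drop ?_))
  all_goals simp [size_enc, SExp.size, sz_prod]; omega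

@[fun_prop] theorem PS.snd : PS (fun x : α × β => x.2) := by
  refine ⟨.seq .uncons .drop, .X, fun x s => ?_⟩
  rw [enc_prod]
  refine .seq (.uncons ?_) (.drop ?_)
  all_goals simp [size_enc, SExp.size, sz_prod]; omega

@[fun_prop] theorem PS.cond {c : α → Bool} {f g : α → β} (hc : PS c) (hf : PS f) (hg : PS g) :
    PS (fun x => bif c x then f x else g x) := by
  obtain ⟨r, S, hr⟩ := hc
  obtain ⟨p, Q, hp⟩ := hf
  obtain ⟨q, R, hq⟩ := hg
  refine ⟨.seq .dup (.seq r (.ite p q)), 2 * .X + Q + R + S + 3, fun x s => ?_⟩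
  refine .seq (.dup ?_) (.seq ((hr x (enc x :: s)).mono ?_) ?_)
  · simp [size_enc]; omega
  · simp [size_enc]; omega
  dsimp only
  cases c x
  · refine .ite_false ?_ ((hq x s).mono ?_)
    all_goals simp [size_enc, SExp.size]; omega
  · refine .ite_true ?_ ((hp x s).mono ?_)
    all_goals simp [size_enc, SExp.size]; omega

/-- A nonempty list has the same representation as the pair of its head and tail, so a single `cons`
with `x` builds the argument of `g`. -/
theorem PS.listCases {l : α → List β} {f : α → γ} {g : α × (β × List β) → γ} (hl : PS l)
    (hf : PS f) (hg : PS g) :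
    PS (fun x => match l x with | [] => f x | b :: t => g (x, b, t)) := by
  obtain ⟨r, S, hr⟩ := hl
  obtain ⟨p, Q, hp⟩ := hf
  obtain ⟨q, R, hq⟩ := hg
  refine ⟨.seq .dup (.seq r (.seq .dup (.ite (.seq .swap (.seq .cons q)) (.seq .drop p)))),
    2 * .X + Q + R.comp (.X + S + 1) + 2 * S + 3, fun x s => ?_⟩
  have h2 : sz (l x) ≤ S.eval (sz x) := by simpa [size_enc] using (hr x []).wt_le'
  refine .seq (.dup ?_) (.seq ((hr x (enc x :: s)).mono ?_) (.seq (.dup ?_) ?_))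
  · simp [size_enc]; omega
  · simp [size_enc]; omega
  · simp [size_enc]; omega
  dsimp only
  rcases h : l x with _ | ⟨b, t⟩
  · rw [h] at h2
    refine .ite_false ?_ (.seq (.drop ?_) ((hp x s).mono ?_))
    all_goals simp [size_enc, SExp.size] at h2 ⊢; omega
  · rw [h] at h2
    have h3 := eval_mono R (show sz (x, b, t) ≤ (.X + S + 1 : Polynomial ℕ).eval (sz x) by
      simp at h2 ⊢; omega)
    refine .ite_true ?_ (.seq (.swap ?_) (.seq (.cons ?_) ((hq (x, b, t) s).mono ?_)))
    all_goals simp [size_enc, size_listTree, SExp.size] at h2 h3 ⊢; omega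

/-- Loops: starting with `i x`, the function `f` is iterated as long as `c` holds, and `o` is
applied to the result. -/
theorem PS.while {c : α → Bool} {f : α → α} {i : β → α} {o : α → γ} {g : β → γ} (hc : PS c)
    (hf : PS f) (hi : PS i) (ho : PS o)
    (I : β → α → Prop) (μ : α → ℕ) (P : Polynomial ℕ) (h0 : ∀ x, I x (i x))
    (hstep : ∀ x y, I x y → c y = true → I x (f y) ∧ μ (f y) < μ y)
    (hend : ∀ x y, I x y → c y = false → o y = g x)
    (hsz : ∀ x y, I x y → sz y ≤ P.eval (sz x)) : PS g := by
  obtain ⟨r, S, hr⟩ := hc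
  obtain ⟨p, Q, hp⟩ := hf
  obtain ⟨q, R, hq⟩ := hi
  obtain ⟨q', R', hq'⟩ := ho
  -- The number of rounds never enters the bound: `μ` ensures termination only and may be
  -- exponential, while space depends on the size of one state.
  let body : Prog := .seq .dup (.seq r (.loop (.seq p (.seq .dup r))))
  have hbody : ∀ x s n y, μ y = n → I x y → ∃ y', I x y' ∧ c y' = false ∧
      Run (wt s + (R + R'.comp P + 2 * P + Q.comp P + S.comp P + 3).eval (sz x))
        body (enc y :: s) (enc y' :: s) := by
    intro x s n
    induction n using Nat.strong_induction_on with
    | _ n ih =>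
      intro y hn hI
      have hy := hsz x y hI
      have hS := eval_mono S hy
      have hQ := eval_mono Q hy
      have key : ∀ t, Run (wt s + (R + R'.comp P + 2 * P + Q.comp P + S.comp P + 3).eval (sz x))
          (.loop (.seq p (.seq .dup r))) (enc (c y) :: enc y :: s) t →
          Run (wt s + (R + R'.comp P + 2 * P + Q.comp P + S.comp P + 3).eval (sz x))
            body (enc y :: s) t := by
        intro t ht
        refine .seq (.dup ?_) (.seq ((hr y (enc y :: s)).mono ?_) ht)
        all_goals simp [size_enc]; omega
      cases h : c y
      · refine ⟨y, hI, h, key _ ?_⟩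
        rw [h]
        refine .loop_done ?_
        simp [size_enc, SExp.size]; omega
      · obtain ⟨h1, h2⟩ := hstep x y hI h
        obtain ⟨y', h3, h4, hrun⟩ := ih _ (hn ▸ h2) (f y) rfl h1
        simp only [body] at hrun
        refine ⟨y', h3, h4, key _ ?_⟩
        rw [h]
        -- The run obtained for `f y` begins with `dup` and the test. Taking these two off and
        -- putting them after `p` gives one complete round of the loop.
        cases hrun with
        | seq ha hb =>
          cases hb with
          | seq hb hc =>
            refine .loop_step ?_ (.seq ((hp y s).mono ?_) (.seq ha hb)) hc
            all_goals simp [size_enc, SExp.size]; omega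
  refine ⟨.seq q (.seq body q'), R + R'.comp P + 2 * P + Q.comp P + S.comp P + 3, fun x s => ?_⟩
  obtain ⟨y, h1, h2, h3⟩ := hbody x s _ _ rfl (h0 x)
  rw [← hend x y h1 h2]
  refine .seq ((hq x s).mono ?_) (.seq h3 ((hq' y s).mono ?_))
  · simp; omega
  · have := eval_mono R' (hsz x y h1)
    simp; omega

/-! Closure properties -/

@[fun_prop] theorem PS.not {f : α → Bool} (hf : PS f) : PS (fun x => !f x) := by
  have h : PS (fun x => bif f x then false else true) := by fun_prop
  convert h using 2 with x
  cases f x <;> rfl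

@[fun_prop] theorem PS.and {f g : α → Bool} (hf : PS f) (hg : PS g) :
    PS (fun x => f x && g x) := by
  have h : PS (fun x => bif f x then g x else false) := by fun_prop
  convert h using 2 with x
  cases f x <;> rfl

@[fun_prop] theorem PS.or {f g : α → Bool} (hf : PS f) (hg : PS g) :
    PS (fun x => f x || g x) := by
  have h : PS (fun x => bif f x then true else g x) := by fun_prop
  convert h using 2 with x
  cases f x <;> rfl

@[fun_prop] theorem PS.cons {f : α → β} {g : α → List β} (hf : PS f) (hg : PS g) :
    PS (fun x => f x :: g x) :=
  PS.comp (.of_enc_eq (f := fun p : β × List β => p.1 :: p.2) fun _ => rfl) (hf.pair hg)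

@[fun_prop] theorem PS.isEmpty {l : α → List β} (hl : PS l) : PS (fun x => (l x).isEmpty) := by
  have h := PS.listCases hl (PS.const (α := α) true) (PS.const (α := α × (β × List β)) false)
  convert h using 2 with x
  cases l x <;> rfl

@[fun_prop] theorem PS.tail {l : α → List β} (hl : PS l) : PS (fun x => (l x).tail) := by
  have h := PS.listCases hl (PS.const (α := α) ([] : List β))
    (g := fun p : α × (β × List β) => p.2.2) (by fun_prop)
  convert h using 2 with x
  cases l x <;> rfl

@[fun_prop] theorem PS.headD {l : α → List β} (hl : PS l) (d : β) :
    PS (fun x => (l x).headD d) := by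
  have h := PS.listCases hl (PS.const (α := α) d)
    (g := fun p : α × (β × List β) => p.2.1) (by fun_prop)
  convert h using 2 with x
  cases l x <;> rfl

/-- The left subtree, `nil` for the empty tree. -/
def SExp.car : SExp → SExp
  | .nil => .nil
  | .cons a _ => a

/-- The right subtree, `nil` for the empty tree. -/
def SExp.cdr : SExp → SExp
  | .nil => .nil
  | .cons _ b => b

/-- A tree read as a list. -/
def SExp.toList : SExp → List SExp
  | .nil => []
  | .cons a b => a :: b.toList

theorem SExp.enc_toList (x : SExp) : enc x.toList = x := by
  induction x with
  | nil => rfl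
  | cons a b _ ih => simp [SExp.toList, ih]

theorem SExp.toList_enc (l : List SExp) : (enc l).toList = l := by
  induction l with
  | nil => rfl
  | cons a l ih => simp [SExp.toList, ih]

@[fun_prop] theorem PS.toList {f : α → SExp} (hf : PS f) : PS (fun x => (f x).toList) :=
  PS.comp (g := SExp.toList) (.of_enc_eq fun x => x.enc_toList) hf

@[fun_prop] theorem PS.enc {f : α → β} (hf : PS f) : PS (fun x => Coded.enc (f x)) :=
  PS.comp (g := Coded.enc) (.of_enc_eq fun _ => rfl) hf

@[fun_prop] theorem PS.car {f : α → SExp} (hf : PS f) : PS (fun x => (f x).car) := by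
  have h : PS (fun x => (f x).toList.headD .nil) := by fun_prop
  convert h using 2 with x
  cases f x <;> rfl

@[fun_prop] theorem PS.cdr {f : α → SExp} (hf : PS f) : PS (fun x => (f x).cdr) := by
  have h : PS (fun x => Coded.enc (f x).toList.tail) := by fun_prop
  convert h using 2 with x
  cases f x
  · rfl
  · simp [SExp.toList, SExp.cdr, SExp.enc_toList]

@[fun_prop] theorem PS.scons {f g : α → SExp} (hf : PS f) (hg : PS g) :
    PS (fun x => SExp.cons (f x) (g x)) :=
  PS.comp (g := fun p : SExp × SExp => SExp.cons p.1 p.2) (.of_enc_eq fun _ => rfl)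
    (hf.pair hg)

/-- Left folds over a list whose intermediate results are of polynomial size. -/
theorem PS.foldl {l : α → List β} {i : α → γ} {h : α → γ → β → γ} (hl : PS l) (hi : PS i)
    (hh : PS fun p : α × (γ × β) => h p.1 p.2.1 p.2.2) (P : Polynomial ℕ)
    (hsz : ∀ x l₁ l₂, l x = l₁ ++ l₂ → sz (l₁.foldl (h x) (i x)) ≤ P.eval (sz x)) :
    PS (fun x => (l x).foldl (h x) (i x)) := by
  obtain ⟨Q, hQ⟩ := hl.bound
  -- A state consists of the parameter, the accumulator and the unread part of the list; the
  -- accumulator is the fold of the part already read.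
  · refine PS.while (c := fun y : α × (γ × List β) => !y.2.2.isEmpty)
      (f := fun y => match y.2.2 with
        | [] => y
        | b :: t => (y.1, h y.1 y.2.1 b, t))
      (i := fun x => (x, i x, l x)) (o := fun y => y.2.1) (by fun_prop) ?_ (by fun_prop)
      (by fun_prop)
      (fun x y => ∃ l₁, y.1 = x ∧ l x = l₁ ++ y.2.2 ∧ y.2.1 = l₁.foldl (h x) (i x))
      (fun y => y.2.2.length) (.X + P + Q + 2) ?_ ?_ ?_ ?_
    · refine PS.listCases (l := fun y : α × (γ × List β) => y.2.2)
        (g := fun z => (z.1.1, h z.1.1 z.1.2.1 z.2.1, z.2.2)) (by fun_prop) (by fun_prop) ?_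
      refine PS.pair (by fun_prop) (PS.pair ?_ (by fun_prop))
      exact PS.comp (f := fun z : (α × (γ × List β)) × (β × List β) =>
        (z.1.1, z.1.2.1, z.2.1)) hh (by fun_prop)
    · intro x; exact ⟨[], by simp⟩
    · rintro x ⟨y, c, t⟩ ⟨l₁, h1, h2, h3⟩ h4
      dsimp only at h1 h2 h3
      subst h1 h3
      rcases t with _ | ⟨b, t⟩
      · simp at h4
      · exact ⟨⟨l₁ ++ [b], by simpa using h2⟩, by simp⟩
    · rintro x ⟨y, c, t⟩ ⟨l₁, h1, h2, h3⟩ h4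
      dsimp only at h1 h2 h3
      subst h1 h3
      rcases t with _ | ⟨b, t⟩
      · rw [List.append_nil] at h2
        simp [h2]
      · simp at h4
    · rintro x ⟨y, c, t⟩ ⟨l₁, h1, h2, h3⟩
      dsimp only at h1 h2 h3
      subst h1 h3
      have h3 := hsz y l₁ t h2
      have h4 := hQ y
      have h5 := sz_append l₁ t
      have := sz_pos l₁
      rw [← h2] at h5
      simp; omega

@[fun_prop] theorem PS.reverse {l : α → List β} (hl : PS l) : PS (fun x => (l x).reverse) := by
  obtain ⟨Q, hQ⟩ := hl.bound
  have h := PS.foldl (h := fun _ c b => b :: c) hl (PS.const (α := α) ([] : List β))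
    (by fun_prop) (Q + 1) ?_
  · simpa using h
  · intro x l₁ l₂ h
    have := hQ x
    have h5 := sz_append l₁ l₂
    have := sz_pos l₂
    rw [← h] at h5
    simp; omega

/-- Right folds over a list whose intermediate results are of polynomial size. -/
theorem PS.foldr {l : α → List β} {i : α → γ} {h : α → β → γ → γ} (hl : PS l) (hi : PS i)
    (hh : PS fun p : α × (β × γ) => h p.1 p.2.1 p.2.2) (P : Polynomial ℕ)
    (hsz : ∀ x l₁ l₂, l x = l₁ ++ l₂ → sz (l₂.foldr (h x) (i x)) ≤ P.eval (sz x)) :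
    PS (fun x => (l x).foldr (h x) (i x)) := by
  have := PS.foldl (l := fun x => (l x).reverse) (h := fun x c b => h x b c) (by fun_prop) hi
    (PS.comp (f := fun z : α × (γ × β) => (z.1, z.2.2, z.2.1)) hh (by fun_prop)) P ?_
  · simpa using this
  · intro x l₁ l₂ hx
    have := hsz x l₂.reverse l₁.reverse (by rw [← List.reverse_append, ← hx, List.reverse_reverse])
    simpa using this

@[fun_prop] theorem PS.append {f g : α → List β} (hf : PS f) (hg : PS g) :
    PS (fun x => f x ++ g x) := by
  obtain ⟨P, hP⟩ := hf.bound
  obtain ⟨Q, hQ⟩ := hg.bound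
  have h := PS.foldr (h := fun _ b c => b :: c) hf hg (by fun_prop) (P + Q) ?_
  · simpa using h
  · intro x l₁ l₂ h
    have := hP x
    have := hQ x
    have h5 := sz_append l₁ l₂
    have h6 := sz_append l₂ (g x)
    have := sz_pos l₁
    rw [← h] at h5
    simp; omega

theorem PS.map {l : α → List β} {h : α → β → γ} (hl : PS l) (hh : PS fun p : α × β => h p.1 p.2) :
    PS (fun x => (l x).map (h x)) := by
  obtain ⟨P, hP⟩ := hl.bound
  obtain ⟨Q, hQ⟩ := hh.bound
  have h := PS.foldr (i := fun _ => []) (h := fun x b c => h x b :: c) hl (PS.const _)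
    (PS.cons (PS.comp (f := fun z : α × (β × List γ) => (z.1, z.2.1)) hh (by fun_prop))
      (by fun_prop)) (P * (Q.comp (.X + P + 1) + 1) + 1) ?_
  · simpa using h
  · intro x l₁ l₂ hx
    have h1 := hP x
    have h5 := sz_append l₁ l₂
    have := sz_pos l₁
    rw [← hx] at h5
    have h7 : sz (l₂.map (h x)) ≤ P.eval (sz x) * (Q.eval (sz x + P.eval (sz x) + 1) + 1) + 1 := by
      refine sz_list_le ?_ ?_
      · have := length_lt_sz l₂
        simp; omega
      · intro c hc
        obtain ⟨b, hb, rfl⟩ := List.mem_map.1 hc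
        refine (hQ (x, b)).trans (eval_mono _ ?_)
        have := sz_le_of_mem hb
        simp; omega
    simpa using h7

theorem PS.filter {l : α → List β} {h : α → β → Bool} (hl : PS l)
    (hh : PS fun p : α × β => h p.1 p.2) : PS (fun x => (l x).filter (h x)) := by
  obtain ⟨P, hP⟩ := hl.bound
  have key : ∀ x (l : List β), l.foldr (fun b c => bif h x b then b :: c else c) []
      = l.filter (h x) := by
    intro x l
    induction l with
    | nil => rfl
    | cons b l ih => cases hb : h x b <;> simp [ih, hb]
  have h' := PS.foldr (i := fun _ => ([] : List β))
    (h := fun x b c => bif h x b then b :: c else c) hl (PS.const _)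
    (PS.cond (PS.comp (f := fun z : α × (β × List β) => (z.1, z.2.1)) hh (by fun_prop))
      (by fun_prop) (by fun_prop)) P ?_
  · simpa only [key] using h'
  · intro x l₁ l₂ hx
    rw [key]
    have h1 := hP x
    have h5 := sz_append l₁ l₂
    have := sz_pos l₁
    rw [← hx] at h5
    have := sz_sublist (l₂.filter_sublist (p := h x))
    omega

theorem PS.any {l : α → List β} {h : α → β → Bool} (hl : PS l)
    (hh : PS fun p : α × β => h p.1 p.2) : PS (fun x => (l x).any (h x)) := by
  have h : PS fun x => !((l x).filter (h x)).isEmpty := .not (.isEmpty (hl.filter hh))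
  convert h using 2 with x
  rw [Bool.eq_iff_iff]
  simp [List.filter_eq_nil_iff]

theorem PS.all {l : α → List β} {h : α → β → Bool} (hl : PS l)
    (hh : PS fun p : α × β => h p.1 p.2) : PS (fun x => (l x).all (h x)) := by
  have h : PS fun x => !(l x).any (fun b => !h x b) := .not (hl.any (.not hh))
  convert h using 2 with x
  rw [Bool.eq_iff_iff]
  simp

theorem PS.flatMap {l : α → List β} {h : α → β → List γ} (hl : PS l)
    (hh : PS fun p : α × β => h p.1 p.2) : PS (fun x => (l x).flatMap (h x)) := by
  have hm := hl.map hh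
  obtain ⟨P, hP⟩ := hm.bound
  have key : ∀ l : List (List γ), sz l.flatten ≤ sz l := by
    intro l
    induction l with
    | nil => simp
    | cons a l ih =>
      have := sz_append a l.flatten
      simp only [List.flatten_cons, sz_cons] at this ⊢
      omega
  have key' : ∀ l : List (List γ), l.foldr (fun b c => b ++ c) [] = l.flatten := by
    intro l
    induction l with
    | nil => rfl
    | cons a l ih => simp [ih]
  have h' := PS.foldr (i := fun _ => []) (h := fun _ b c => b ++ c) hm (PS.const _)
    (by fun_prop) P ?_
  · simpa only [List.flatMap, key'] using h'
  · intro x l₁ l₂ hx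
    have h1 := hP x
    have h5 := sz_append l₁ l₂
    have := sz_pos l₁
    rw [← hx] at h5
    have := key l₂
    rw [key']
    omega

@[fun_prop] theorem PS.product {f : α → List β} {g : α → List γ} (hf : PS f) (hg : PS g) :
    PS (fun x => f x ×ˢ g x) := by
  have : PS (fun x => (f x).flatMap fun a => (g x).map fun b => (a, b)) := by
    refine hf.flatMap (PS.map (by fun_prop) (by fun_prop))
  exact this

end
-- Equality of values
section
variable {α β γ δ : Type} [Coded α] [Coded β] [Coded γ] [Coded δ]

/-- A list of pairs still to be compared is processed. Splitting a pair of nonempty trees into two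
pairs does not enlarge the list: the two constructors that disappear pay for the new pair and the
new list cell. The total size of the left components decreases. -/
theorem PS.eqTree : PS (fun x : SExp × SExp => decide (x.1 = x.2)) := by
  refine PS.while (c := fun y : List (SExp × SExp) × Bool => y.2 && !y.1.isEmpty)
    (f := fun y => match y.1 with
      | [] => y
      | b :: t =>
        bif b.1.toList.isEmpty then
          bif b.2.toList.isEmpty then (t, true) else ([], false)
        else bif b.2.toList.isEmpty then ([], false)
          else ((b.1.car, b.2.car) :: (b.1.cdr, b.2.cdr) :: t, true))
    (i := fun x => ([x], true)) (o := fun y => y.2) (by fun_prop)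
    ?_ (by fun_prop)
    (by fun_prop)
    (fun x y => sz y.1 ≤ sz [x] ∧ (x.1 = x.2 ↔ y.2 = true ∧ ∀ p ∈ y.1, p.1 = p.2) ∧
      (y.2 = false → y.1 = []))
    (fun y => (y.1.map fun p => p.1.size).sum) (.X + 6) ?_ ?_ ?_ ?_
  · have h := PS.listCases (l := fun y : List (SExp × SExp) × Bool => y.1) (f := fun y => y)
      (g := fun z =>
        bif z.2.1.1.toList.isEmpty then
          bif z.2.1.2.toList.isEmpty then (z.2.2, true) else ([], false)
        else bif z.2.1.2.toList.isEmpty then ([], false)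
          else ((z.2.1.1.car, z.2.1.2.car) :: (z.2.1.1.cdr, z.2.1.2.cdr) :: z.2.2, true))
      (by fun_prop) (by fun_prop) (by fun_prop)
    convert h using 2 with y
    rcases y with ⟨_ | ⟨b, t⟩, c⟩ <;> rfl
  · intro x; simp
  · rintro x ⟨t, b⟩ ⟨h1, h2, h3⟩ h4
    rcases t with _ | ⟨⟨p, q⟩, t⟩
    · simp at h4
    obtain rfl : b = true := by simpa using h4
    have := sz_pos t
    rcases p with _ | ⟨p1, p2⟩ <;> rcases q with _ | ⟨q1, q2⟩
    · simp [SExp.toList] at h1 h2 ⊢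
      exact ⟨⟨by omega, h2⟩, by simp [SExp.size]⟩
    · simp [SExp.toList] at h1 h2 ⊢
      exact ⟨h2, Or.inl (SExp.size_pos _)⟩
    · simp [SExp.toList] at h1 h2 ⊢
      exact ⟨h2, Or.inl (SExp.size_pos _)⟩
    · simp [SExp.toList, SExp.car, SExp.cdr] at h1 h2 ⊢
      refine ⟨⟨?_, by rw [h2, and_assoc]⟩, ?_⟩
      · have a1 : sz (p1.cons p2) = sz p1 + sz p2 + 1 := rfl
        have a2 : sz (q1.cons q2) = sz q1 + sz q2 + 1 := rfl
        omega
      · have a1 : (p1.cons p2).size = p1.size + p2.size + 1 := rfl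
        omega
  · rintro x ⟨t, b⟩ ⟨h1, h2, h3⟩ h4
    cases b
    · simpa using h2
    · simp at h4
      subst h4
      simpa using h2
  · rintro x ⟨t, b⟩ ⟨h1, h2, h3⟩
    have := sz_bool b
    simp at h1 ⊢; omega

-- Representations are injective, so equality of values is equality of trees.
@[fun_prop] theorem PS.eq {f g : α → β} {inst : ∀ x, Decidable (f x = g x)} (hf : PS f)
    (hg : PS g) : PS (fun x => decide (f x = g x)) := by
  have h : PS (fun x => decide (Coded.enc (f x) = Coded.enc (g x))) :=
    PS.comp (f := fun x => (Coded.enc (f x), Coded.enc (g x))) PS.eqTree (by fun_prop)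
  convert h using 2 with x
  rw [decide_eq_decide]
  exact Coded.inj.eq_iff.symm

@[fun_prop] theorem PS.mem {f : α → β} {l : α → List β} {inst : ∀ x, Decidable (f x ∈ l x)}
    (hf : PS f) (hl : PS l) : PS (fun x => decide (f x ∈ l x)) := by
  classical
  have h : PS (fun x => (l x).any fun b => decide (f x = b)) := hl.any (by fun_prop)
  convert h using 2 with x
  rw [Bool.eq_iff_iff]
  simp

/-! ### Exhaustive search -/

/-- Successor of a binary number, most significant bit first, and the carry. -/
def inc (l : List Bool) : List Bool × Bool :=
  l.foldr (fun b c => ((b ^^ c.2) :: c.1, b && c.2)) ([], true)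

/-- The value of a binary number. -/
def val : List Bool → ℕ
  | [] => 0
  | b :: l => b.toNat * 2 ^ l.length + val l

@[simp] theorem length_inc (l : List Bool) : (inc l).1.length = l.length := by
  induction l with
  | nil => rfl
  | cons b l ih => simpa [inc] using ih

theorem val_lt (l : List Bool) : val l < 2 ^ l.length := by
  induction l with
  | nil => simp [val]
  | cons b l ih =>
    simp only [val, List.length_cons, pow_succ]
    cases b <;> simp <;> omega

/-- As long as there is no carry the value grows by exactly one, so iterating `inc` from zero visits
all words of a given length. -/
theorem val_inc (l : List Bool) : val (inc l).1 + (inc l).2.toNat * 2 ^ l.length = val l + 1 := by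
  induction l with
  | nil => rfl
  | cons b l ih =>
    have hl := length_inc l
    have e : inc (b :: l) = ((b ^^ (inc l).2) :: (inc l).1, b && (inc l).2) := rfl
    rw [e]
    simp only [val, hl, List.length_cons, pow_succ]
    cases b <;> cases h : (inc l).2 <;> simp [h] at ih ⊢ <;> omega

theorem val_injective {l l' : List Bool} (h : l.length = l'.length) (hv : val l = val l') :
    l = l' := by
  induction l generalizing l' with
  | nil => exact (List.length_eq_zero_iff.1 h.symm).symm
  | cons b l ih =>
    rcases l' with _ | ⟨b', l'⟩
    · simp at h
    simp only [List.length_cons, Nat.add_right_cancel_iff] at h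
    have h1 := val_lt l
    have h2 := val_lt l'
    simp only [val, h] at hv h1
    cases b <;> cases b' <;> simp at hv ⊢
    · exact ih h hv
    · omega
    · omega
    · exact ih h hv

theorem sz_bits (l : List Bool) : sz l ≤ 4 * l.length + 1 := by
  have := sz_list_le (l := l) le_rfl (fun b _ => sz_bool b)
  omega

@[fun_prop] theorem PS.xor {f g : α → Bool} (hf : PS f) (hg : PS g) :
    PS (fun x => f x ^^ g x) := by
  have h : PS (fun x => bif f x then !g x else g x) := by fun_prop
  convert h using 2 with x
  cases f x <;> simp

theorem ps_inc : PS inc := by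
  refine PS.foldr (i := fun _ => ([], true)) (h := fun _ b c => ((b ^^ c.2) :: c.1, b && c.2))
    (by fun_prop) (by fun_prop) (by fun_prop) (4 * .X + 5) ?_
  intro x l₁ l₂ hx
  change sz (inc l₂) ≤ _
  rw [sz_prod]
  have h1 := sz_bits (inc l₂).1
  have h2 := sz_bool (inc l₂).2
  have h3 := length_lt_sz x
  have h4 : x.length = l₁.length + l₂.length := by simp [hx]
  rw [length_inc] at h1
  simp; omega

-- Reading trees from words

/-- The stack of trees that a word denotes in prefix notation. -/
def parseStack (w : List Bool) : List SExp :=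
  w.foldr (fun b st => bif b then .cons (st.headD .nil) (st.tail.headD .nil) :: st.tail.tail
    else .nil :: st) []

/-- The word is read from the right, so both subtrees are on top of the stack when their `true` is
met. The arbitrary continuation `w` is needed for the induction and for padding. -/
theorem parseStack_word_append (t : SExp) (w : List Bool) :
    parseStack (t.word ++ w) = t :: parseStack w := by
  induction t generalizing w with
  | nil => rfl
  | cons a b iha ihb =>
    have : parseStack ((SExp.cons a b).word ++ w) = .cons
        ((parseStack (a.word ++ (b.word ++ w))).headD .nil)
        ((parseStack (a.word ++ (b.word ++ w))).tail.headD .nil)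
        :: (parseStack (a.word ++ (b.word ++ w))).tail.tail := by
      simp [SExp.word, parseStack]
    rw [this, iha, ihb]
    rfl

/-- Words that denote nothing are read as well, with `nil` for missing operands; even then a letter
adds at most 4 to the size. -/
theorem sz_parseStack (w : List Bool) : sz (parseStack w) ≤ 4 * w.length + 1 := by
  induction w with
  | nil => simp [parseStack]
  | cons b w ih =>
    cases b
    · change sz (SExp.nil :: parseStack w) ≤ _
      rw [sz_cons]
      have : sz SExp.nil = 1 := rfl
      simp; omega
    · change sz (SExp.cons ((parseStack w).headD .nil) ((parseStack w).tail.headD .nil)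
        :: (parseStack w).tail.tail) ≤ _
      have h : ∀ a b : SExp, sz (SExp.cons a b) = sz a + sz b + 1 := fun _ _ => rfl
      have h0 : sz SExp.nil = 1 := rfl
      rw [sz_cons, h]
      rcases h' : parseStack w with _ | ⟨a, _ | ⟨b, st⟩⟩ <;>
        simp [h'] at ih ⊢ <;> omega

theorem ps_parseStack : PS parseStack := by
  refine PS.foldr (i := fun _ => ([] : List SExp)) (h := fun _ b st =>
    bif b then .cons (st.headD .nil) (st.tail.headD .nil) :: st.tail.tail else .nil :: st)
    (by fun_prop) (by fun_prop) (by fun_prop) (4 * .X + 1) ?_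
  intro x l₁ l₂ hx
  change sz (parseStack l₂) ≤ _
  have h1 := sz_parseStack l₂
  have h3 := length_lt_sz x
  have h4 : x.length = l₁.length + l₂.length := by simp [hx]
  simp; omega

open Classical in
/-- The search through all words of a given length. -/
theorem PS.exists_word {l : α → List β} {h : α → List Bool → Bool} (hl : PS l)
    (hh : PS fun p : α × List Bool => h p.1 p.2) :
    PS (fun x => decide (∃ w : List Bool, w.length = (l x).length ∧ h x w = true)) := by
  obtain ⟨Q, hQ⟩ := hl.bound
  refine PS.while (c := fun y : α × List Bool => !h y.1 y.2 && !y.2.all fun b => b)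
    (f := fun y => (y.1, (inc y.2).1)) (i := fun x => (x, (l x).map fun _ => false))
    (o := fun y => h y.1 y.2) ?_ ?_ ?_ hh
    -- All words before the current one have failed. The loop starts with zeros only and stops at a
    -- success or when all digits are one.
    (fun x y => y.1 = x ∧ y.2.length = (l x).length ∧
      ∀ w : List Bool, w.length = (l x).length → val w < val y.2 → h x w = false)
    (fun y => 2 ^ y.2.length - val y.2) (.X + 4 * Q + 2) ?_ ?_ ?_ ?_
  · exact (hh.not).and (.not (PS.all (by fun_prop) (by fun_prop)))
  · have := ps_inc
    fun_prop
  · exact PS.pair (by fun_prop) (hl.map (by fun_prop))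
  · intro x
    have h0 : ∀ l : List β, val (l.map fun _ => false) = 0 := by
      intro l
      induction l with
      | nil => rfl
      | cons a l ih => rw [List.map_cons, val, ih]; simp
    refine ⟨rfl, by simp, fun w _ hw => ?_⟩
    rw [h0] at hw
    omega
  · rintro x ⟨y, w⟩ ⟨h1, h2, h3⟩ h4
    dsimp only at h1 h2 h3 h4
    subst h1
    -- Overflow happens only when all digits are one, and there the loop has stopped.
    have hcarry : (inc w).2 = false := by
      have : ∀ w : List Bool, (inc w).2 = w.all fun b => b := by
        intro w
        induction w with
        | nil => rfl
        | cons b w ih =>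
          change (b && (inc w).2) = _
          rw [ih]; rfl
      rw [this]
      simp only [Bool.and_eq_true, Bool.not_eq_true'] at h4
      exact h4.2
    have hv := val_inc w
    rw [hcarry] at hv
    simp at hv
    have h5 := val_lt w
    refine ⟨⟨rfl, by simpa using h2, ?_⟩, ?_⟩
    · intro w' h6 h7
      rw [hv, Nat.lt_succ_iff] at h7
      rcases h7.lt_or_eq with h7 | h7
      · exact h3 w' h6 h7
      · rw [val_injective (h6.trans h2.symm) h7]
        simp only [Bool.and_eq_true, Bool.not_eq_true'] at h4
        exact h4.1
    · simp [hv]; omega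
  · rintro x ⟨y, w⟩ ⟨h1, h2, h3⟩ h4
    dsimp only at h1 h2 h3 h4 ⊢
    subst h1
    cases h5 : h y w
    · symm
      rw [decide_eq_false_iff_not]
      rintro ⟨w', h6, h7⟩
      have h8 : val w' ≤ val w := by
        have : ∀ w w' : List Bool, w'.length = w.length → (w.all fun b => b) = true →
            val w' ≤ val w := by
          intro w
          induction w with
          | nil => intro w' h _; simp at h; simp [h]
          | cons b w ih =>
            intro w' h h'
            rcases w' with _ | ⟨b', w'⟩
            · simp at h
            simp only [List.length_cons, Nat.add_right_cancel_iff] at h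
            simp only [List.all_cons, Bool.and_eq_true] at h'
            have := ih w' h h'.2
            rw [h'.1]
            have := val_lt w'
            rw [h] at this
            cases b' <;> simp [val, h] <;> omega
        refine this w w' (h6.trans h2.symm) ?_
        simpa [h5] using h4
      rcases h8.lt_or_eq with h8 | h8
      · simp [h3 w' h6 h8] at h7
      · rw [val_injective (h6.trans h2.symm) h8, h5] at h7
        simp at h7
    · symm
      rw [decide_eq_true_iff]
      exact ⟨w, h2, h5⟩
  · rintro x ⟨y, w⟩ ⟨h1, h2, h3⟩
    dsimp only at h1 h2 h3
    subst h1
    have := sz_bits w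
    have := hQ y
    have := length_lt_sz (l y)
    simp; omega

open Classical in
/-- The search for a tree with a property, when there are small trees with the property if there
are any. -/
theorem PS.exists_tree {l : α → List β} {h : α → SExp → Bool} (hl : PS l)
    (hh : PS fun p : α × SExp => h p.1 p.2)
    (hs : ∀ x t, h x t = true → ∃ t : SExp, t.size ≤ (l x).length ∧ h x t = true) :
    PS (fun x => decide (∃ t, h x t = true)) := by
  have h1 : PS fun x => decide (∃ w : List Bool, w.length = (l x).length ∧
      h x ((parseStack w).headD .nil) = true) := by
    have := ps_parseStack
    refine PS.exists_word hl (h := fun x w => h x ((parseStack w).headD .nil)) ?_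
    exact PS.comp (f := fun p : α × List Bool => (p.1, (parseStack p.2).headD .nil)) hh
      (by fun_prop)
  convert h1 using 2 with x
  rw [decide_eq_decide]
  constructor
  · rintro ⟨t, ht⟩
    obtain ⟨t, h2, h3⟩ := hs x t ht
    -- Padding to the prescribed length merely puts empty trees below `t` on the stack.
    refine ⟨t.word ++ List.replicate ((l x).length - t.size) false, by simp; omega, ?_⟩
    rw [parseStack_word_append]
    exact h3
  · rintro ⟨w, _, hw⟩
    exact ⟨_, hw⟩

/-- Languages with a characteristic function that is computed in polynomial space. -/
theorem PS.mem_PSPACE [Fintype α] {f : List α → Bool} (hf : PS f) :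
    ({w | f w = true} : Language α) ∈ PSPACE α := by
  obtain ⟨p, Q, h⟩ := hf
  let B := Finset.univ.sup fun a : α => sz a
  -- The alphabet is finite, so each letter costs at most `B + 1` in the representation of the
  -- input.
  refine mem_PSPACE_of_run p Coded.enc (Q.comp (.C (B + 1) * .X + 1)) fun w =>
    ⟨Coded.enc (f w), ((h w []).mono ?_), ?_⟩
  · have h1 : sz w ≤ w.length * (B + 1) + 1 :=
      sz_list_le le_rfl fun a _ => Finset.le_sup (f := fun a : α => sz a) (Finset.mem_univ a)
    have := eval_mono Q h1
    rw [mul_comm] at this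
    simpa using this
  · change _ ↔ f w = true
    cases f w <;> simp

end

/-! ### Abstract models -/

/-- The information about a tree and an assignment that the semantics depends on. -/
structure Model (V : Type*) where
  rel : Axis → V → V → Prop
  lab : V → Name → Prop
  eqA : Name → Name → V → Prop
  neA : Name → Name → V → Prop

section
variable {V V' : Type*}

def NodeTest.MHolds (M : Model V) (v : V) : NodeTest → Prop
  | .label s => M.lab v s
  | .wildcard => True

mutual
/-- The relation defined by a location path in a model. -/
def LPath.MSem (M : Model V) : LPath → V → V → Prop
  | .step a n fs, u, v => M.rel a u v ∧ n.MHolds M v ∧ Filters.MHolds M fs v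
  | .comp p q, u, v => ∃ w, LPath.MSem M p u w ∧ LPath.MSem M q w v
  | .union p q, u, v => LPath.MSem M p u v ∨ LPath.MSem M q u v
/-- The truth value of a filter expression in a model. -/
def Expr.MHolds (M : Model V) : Expr → V → Prop
  | .path p, v => ∃ w, LPath.MSem M p v w
  | .eq x a, v => M.eqA x a v
  | .ne x a, v => M.neA x a v
  | .or e₁ e₂, v => Expr.MHolds M e₁ v ∨ Expr.MHolds M e₂ v
/-- All filters of the list hold in a model. -/
def Filters.MHolds (M : Model V) : Filters → V → Prop
  | .nil, _ => True
  | .cons e fs, v => Expr.MHolds M e v ∧ Filters.MHolds M fs v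
end

/-- The model given by a tree and an assignment. -/
def XMLTree.model {D : Type*} (t : XMLTree D) (ρ : Name → D) : Model Vertex where
  rel := Axis.Rel t
  lab v s := t.lab v = s
  eqA x a v := ∃ d, t.attr v a = some d ∧ ρ x = d
  neA x a v := ∃ d, t.attr v a = some d ∧ ρ x ≠ d

section
variable {D : Type*} (t : XMLTree D) (ρ : Name → D)

mutual
theorem LPath.mSem_model (p : LPath) (u v : Vertex) :
    p.MSem (t.model ρ) u v ↔ p.Sem t ρ u v := by
  match p with
  | .step a n fs =>
    rw [LPath.MSem, LPath.Sem, Filters.mHolds_model fs v]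
    cases n <;> rfl
  | .comp p q =>
    simp only [LPath.MSem, LPath.Sem]
    exact exists_congr fun w => and_congr (LPath.mSem_model p u w) (LPath.mSem_model q w v)
  | .union p q =>
    simp only [LPath.MSem, LPath.Sem]
    exact or_congr (LPath.mSem_model p u v) (LPath.mSem_model q u v)
theorem Expr.mHolds_model (e : Expr) (v : Vertex) :
    e.MHolds (t.model ρ) v ↔ e.Holds t ρ v := by
  match e with
  | .path p =>
    simp only [Expr.MHolds, Expr.Holds]
    exact exists_congr fun w => LPath.mSem_model p v w
  | .eq x a => simp only [Expr.MHolds, Expr.Holds, XMLTree.model]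
  | .ne x a => simp only [Expr.MHolds, Expr.Holds, XMLTree.model]
  | .or e f =>
    simp only [Expr.MHolds, Expr.Holds]
    exact or_congr (Expr.mHolds_model e v) (Expr.mHolds_model f v)
theorem Filters.mHolds_model (fs : Filters) (v : Vertex) :
    fs.MHolds (t.model ρ) v ↔ fs.Holds t ρ v := by
  match fs with
  | .nil => simp only [Filters.MHolds, Filters.Holds]
  | .cons e fs =>
    simp only [Filters.MHolds, Filters.Holds]
    exact and_congr (Expr.mHolds_model e v) (Filters.mHolds_model fs v)
end

end

/-! ### Bounded morphisms -/

/-- Bounded morphisms between models, defined on the vertices with `S`. -/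
structure BoundedMorphism (M : Model V) (M' : Model V') (S : V → Prop) (f : V → V') : Prop where
  closed : ∀ a u v, M.rel a u v → S v
  forth : ∀ a u v, M.rel a u v → M'.rel a (f u) (f v)
  back : ∀ a u v', S u → M'.rel a (f u) v' → ∃ v, M.rel a u v ∧ f v = v'
  lab : ∀ v s, S v → (M.lab v s ↔ M'.lab (f v) s)
  eqA : ∀ x a v, S v → (M.eqA x a v ↔ M'.eqA x a (f v))
  neA : ∀ x a v, S v → (M.neA x a v ↔ M'.neA x a (f v))

section
variable {M : Model V} {M' : Model V'} {S : V → Prop} {f : V → V'}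

mutual
-- Paths and filters are defined by mutual recursion, so images of steps (`forth`) and liftings of
-- steps (`back`) have to be treated together: the equivalence for filters uses both.
theorem BoundedMorphism.mSem (h : BoundedMorphism M M' S f) (p : LPath) (u : V) (hu : S u) :
    (∀ v, p.MSem M u v → S v ∧ p.MSem M' (f u) (f v)) ∧
      ∀ v', p.MSem M' (f u) v' → ∃ v, S v ∧ p.MSem M u v ∧ f v = v' := by
  match p with
  | .step a n fs =>
    have hn : ∀ v, S v → (n.MHolds M v ↔ n.MHolds M' (f v)) := by
      intro v hv
      cases n with
      | label s => exact h.lab v s hv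
      | wildcard => exact Iff.rfl
    simp only [LPath.MSem]
    constructor
    · rintro v ⟨h1, h2, h3⟩
      have hv := h.closed a u v h1
      exact ⟨hv, h.forth a u v h1, (hn v hv).1 h2, (h.filters_mHolds fs v hv).1 h3⟩
    · rintro v' ⟨h1, h2, h3⟩
      obtain ⟨v, h4, rfl⟩ := h.back a u v' hu h1
      have hv := h.closed a u v h4
      exact ⟨v, hv, ⟨h4, (hn v hv).2 h2, (h.filters_mHolds fs v hv).2 h3⟩, rfl⟩
  | .comp p q =>
    simp only [LPath.MSem]
    constructor
    · rintro v ⟨w, h1, h2⟩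
      obtain ⟨hw, h3⟩ := (h.mSem p u hu).1 w h1
      obtain ⟨hv, h4⟩ := (h.mSem q w hw).1 v h2
      exact ⟨hv, f w, h3, h4⟩
    · rintro v' ⟨w', h1, h2⟩
      obtain ⟨w, hw, h3, rfl⟩ := (h.mSem p u hu).2 w' h1
      obtain ⟨v, hv, h4, rfl⟩ := (h.mSem q w hw).2 v' h2
      exact ⟨v, hv, ⟨w, h3, h4⟩, rfl⟩
  | .union p q =>
    simp only [LPath.MSem]
    constructor
    · rintro v (h1 | h1)
      · exact ⟨((h.mSem p u hu).1 v h1).1, .inl ((h.mSem p u hu).1 v h1).2⟩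
      · exact ⟨((h.mSem q u hu).1 v h1).1, .inr ((h.mSem q u hu).1 v h1).2⟩
    · rintro v' (h1 | h1)
      · obtain ⟨v, hv, h2, h3⟩ := (h.mSem p u hu).2 v' h1
        exact ⟨v, hv, .inl h2, h3⟩
      · obtain ⟨v, hv, h2, h3⟩ := (h.mSem q u hu).2 v' h1
        exact ⟨v, hv, .inr h2, h3⟩
theorem BoundedMorphism.expr_mHolds (h : BoundedMorphism M M' S f) (e : Expr) (v : V)
    (hv : S v) : e.MHolds M v ↔ e.MHolds M' (f v) := by
  match e with
  | .path p =>
    simp only [Expr.MHolds]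
    constructor
    · rintro ⟨w, hw⟩
      exact ⟨f w, ((h.mSem p v hv).1 w hw).2⟩
    · rintro ⟨w', hw⟩
      obtain ⟨w, _, h1, _⟩ := (h.mSem p v hv).2 w' hw
      exact ⟨w, h1⟩
  | .eq x a => simpa only [Expr.MHolds] using h.eqA x a v hv
  | .ne x a => simpa only [Expr.MHolds] using h.neA x a v hv
  | .or e₁ e₂ =>
    simp only [Expr.MHolds]
    exact or_congr (h.expr_mHolds e₁ v hv) (h.expr_mHolds e₂ v hv)
theorem BoundedMorphism.filters_mHolds (h : BoundedMorphism M M' S f) (fs : Filters) (v : V)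
    (hv : S v) : fs.MHolds M v ↔ fs.MHolds M' (f v) := by
  match fs with
  | .nil => simp only [Filters.MHolds]
  | .cons e fs =>
    simp only [Filters.MHolds]
    exact and_congr (h.expr_mHolds e v hv) (h.filters_mHolds fs v hv)
end

theorem BoundedMorphism.exists_mSem (h : BoundedMorphism M M' S f) (p : LPath) (u : V)
    (hu : S u) : (∃ v, p.MSem M u v) ↔ ∃ v', p.MSem M' (f u) v' := by
  simpa only [Expr.MHolds] using h.expr_mHolds (.path p) u hu
end

/-! ### Names -/

def NodeTest.names : NodeTest → List Name
  | .label s => [s]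
  | .wildcard => []

mutual
/-- The names that occur in a location path. -/
def LPath.names : LPath → List Name
  | .step _ n fs => n.names ++ Filters.names fs
  | .comp p q => LPath.names p ++ LPath.names q
  | .union p q => LPath.names p ++ LPath.names q
/-- The names that occur in a filter expression. -/
def Expr.names : Expr → List Name
  | .path p => LPath.names p
  | .eq x a => [x, a]
  | .ne x a => [x, a]
  | .or e₁ e₂ => Expr.names e₁ ++ Expr.names e₂
/-- The names that occur in a list of filter expressions. -/
def Filters.names : Filters → List Name
  | .nil => []
  | .cons e fs => Expr.names e ++ Filters.names fs
end

theorem length_encName (s : Name) : (encName s).length = s.length + 1 := by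
  induction s with
  | nil => rfl
  | cons b s ih => cases b <;> simp [encName, ih]

/-- The total length of a list of names, with their end markers. -/
def namesLen (l : List Name) : ℕ := (l.map fun s => s.length + 1).sum

@[simp] theorem namesLen_nil : namesLen [] = 0 := rfl
@[simp] theorem namesLen_cons (s : Name) (l : List Name) :
    namesLen (s :: l) = s.length + 1 + namesLen l := by simp [namesLen]
@[simp] theorem namesLen_append (l l' : List Name) :
    namesLen (l ++ l') = namesLen l + namesLen l' := by simp [namesLen]

theorem length_le_namesLen (l : List Name) : l.length ≤ namesLen l := by
  induction l with
  | nil => simp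
  | cons s l ih => simp; omega

theorem length_lt_namesLen {s : Name} {l : List Name} (h : s ∈ l) : s.length < namesLen l := by
  induction l with
  | nil => simp at h
  | cons s' l ih =>
    rw [namesLen_cons]
    rcases List.mem_cons.1 h with rfl | h
    · omega
    · have := ih h; omega

mutual
-- Every expression contains a letter outside its names. The bound limits both the number and the
-- lengths of the names, so a label with more letters than the input is foreign to it.
theorem LPath.namesLen_le (p : LPath) : namesLen p.names + 1 ≤ p.enc.length := by
  match p with
  | .step a n fs =>
    have h1 := Filters.namesLen_le fs
    have h2 : a.enc.length = 1 := by cases a <;> rfl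
    have h3 : namesLen n.names ≤ n.enc.length := by
      cases n <;> simp [NodeTest.names, NodeTest.enc, length_encName]
    simp [LPath.names, LPath.enc]; omega
  | .comp p q | .union p q =>
    have h1 := LPath.namesLen_le p
    have h2 := LPath.namesLen_le q
    simp [LPath.names, LPath.enc]; omega
theorem Expr.namesLen_le (e : Expr) : namesLen e.names + 1 ≤ e.enc.length := by
  match e with
  | .path p => simpa [Expr.names, Expr.enc] using LPath.namesLen_le p
  | .eq x a | .ne x a => simp [Expr.names, Expr.enc, length_encName]
  | .or e f =>
    have h1 := Expr.namesLen_le e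
    have h2 := Expr.namesLen_le f
    simp [Expr.names, Expr.enc]; omega
theorem Filters.namesLen_le (fs : Filters) : namesLen fs.names + 1 ≤ fs.enc.length := by
  match fs with
  | .nil => simp [Filters.names, Filters.enc]
  | .cons e fs =>
    have h1 := Expr.namesLen_le e
    have h2 := Filters.namesLen_le fs
    simp [Filters.names, Filters.enc]; omega
end

/-! ### Finite witnesses -/

/-- `h` preserves what holds in `M` for the vertices in `W` and the names in `N`. -/
structure HomOn (M : Model V) (M' : Model V') (N : List Name) (W : Set V) (h : V → V') : Prop where
  rel : ∀ a, ∀ x ∈ W, ∀ y ∈ W, M.rel a x y → M'.rel a (h x) (h y)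
  lab : ∀ x ∈ W, ∀ s ∈ N, M.lab x s → M'.lab (h x) s
  eqA : ∀ v ∈ W, ∀ x ∈ N, ∀ a ∈ N, M.eqA x a v → M'.eqA x a (h v)
  neA : ∀ v ∈ W, ∀ x ∈ N, ∀ a ∈ N, M.neA x a v → M'.neA x a (h v)

theorem HomOn.mono {M : Model V} {M' : Model V'} {N N' : List Name} {W W' : Set V} {h : V → V'}
    (hh : HomOn M M' N W h) (hN : N' ⊆ N) (hW : W' ⊆ W) : HomOn M M' N' W' h where
  rel a x hx y hy := hh.rel a x (hW hx) y (hW hy)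
  lab x hx s hs := hh.lab x (hW hx) s (hN hs)
  eqA v hv x hx a ha := hh.eqA v (hW hv) x (hN hx) a (hN ha)
  neA v hv x hx a ha := hh.neA v (hW hv) x (hN hx) a (hN ha)

/-- Lists of vertices as sets, with one additional element. -/
abbrev withRoot (u : V) (W : List V) : Set V := {x | x = u ∨ x ∈ W}

mutual
/-- The truth of a path is witnessed by few vertices. -/
theorem LPath.exists_witness (M : Model V) (p : LPath) (u v : V) (hp : p.MSem M u v) :
    -- Each witness is the target of some axis step, which later shows that it is a vertex of the
    -- tree or of the certificate. Nothing is negated in the language, so preservation by `h` in one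
    -- direction suffices.
    ∃ W : List V, W.length ≤ p.enc.length ∧ v ∈ W ∧ (∀ w ∈ W, ∃ a x, M.rel a x w) ∧
      ∀ (V' : Type) (M' : Model V') (h : V → V'), HomOn M M' p.names (withRoot u W) h →
        p.MSem M' (h u) (h v) := by
  match p with
  | .step a n fs =>
    simp only [LPath.MSem] at hp
    obtain ⟨h1, h2, h3⟩ := hp
    obtain ⟨W, hW, hR, hw⟩ := Filters.exists_witness M fs v h3
    refine ⟨v :: W, ?_, by simp, List.forall_mem_cons.2 ⟨⟨a, u, h1⟩, hR⟩, ?_⟩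
    · have : 1 ≤ n.enc.length := by cases n <;> simp [NodeTest.enc, length_encName]
      simp [LPath.enc]; omega
    · intro V' M' h hh
      simp only [LPath.MSem]
      refine ⟨hh.rel a u (by simp) v (by simp) h1, ?_, hw V' M' h (hh.mono ?_ ?_)⟩
      · cases n with
        | label s => exact hh.lab v (by simp) s (by simp [LPath.names, NodeTest.names]) h2
        | wildcard => trivial
      · simp [LPath.names]
      · rintro x (rfl | hx) <;> simp [*]
  | .comp p q =>
    simp only [LPath.MSem] at hp
    obtain ⟨w, h1, h2⟩ := hp
    obtain ⟨W₁, hW₁, hw₁, hR₁, H₁⟩ := LPath.exists_witness M p u w h1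
    obtain ⟨W₂, hW₂, hw₂, hR₂, H₂⟩ := LPath.exists_witness M q w v h2
    refine ⟨W₁ ++ W₂, by simp [LPath.enc]; omega, by simp [hw₂],
      List.forall_mem_append.2 ⟨hR₁, hR₂⟩, fun V' M' h hh => ?_⟩
    simp only [LPath.MSem]
    refine ⟨h w, H₁ V' M' h (hh.mono (by simp [LPath.names]) ?_),
      H₂ V' M' h (hh.mono (by simp [LPath.names]) ?_)⟩
    · rintro x (rfl | hx) <;> simp [*]
    · rintro x (rfl | hx) <;> simp [*]
  | .union p q =>
    simp only [LPath.MSem] at hp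
    rcases hp with hp | hp
    · obtain ⟨W, hW, hw, hR, H⟩ := LPath.exists_witness M p u v hp
      refine ⟨W, by simp [LPath.enc]; omega, hw, hR, fun V' M' h hh => ?_⟩
      simp only [LPath.MSem]
      exact .inl (H V' M' h (hh.mono (by simp [LPath.names]) subset_rfl))
    · obtain ⟨W, hW, hw, hR, H⟩ := LPath.exists_witness M q u v hp
      refine ⟨W, by simp [LPath.enc]; omega, hw, hR, fun V' M' h hh => ?_⟩
      simp only [LPath.MSem]
      exact .inr (H V' M' h (hh.mono (by simp [LPath.names]) subset_rfl))
/-- The truth of a filter expression is witnessed by few vertices. -/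
theorem Expr.exists_witness (M : Model V) (e : Expr) (v : V) (he : e.MHolds M v) :
    ∃ W : List V, W.length ≤ e.enc.length ∧ (∀ w ∈ W, ∃ a x, M.rel a x w) ∧
      ∀ (V' : Type) (M' : Model V') (h : V → V'), HomOn M M' e.names (withRoot v W) h →
        e.MHolds M' (h v) := by
  match e with
  | .path p =>
    simp only [Expr.MHolds] at he
    obtain ⟨w, hw⟩ := he
    obtain ⟨W, hW, hw, hR, H⟩ := LPath.exists_witness M p v w hw
    refine ⟨W, by simpa [Expr.enc] using hW, hR, fun V' M' h hh => ?_⟩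
    simp only [Expr.MHolds]
    exact ⟨h w, H V' M' h (hh.mono (by simp [Expr.names]) subset_rfl)⟩
  | .eq x a =>
    simp only [Expr.MHolds] at he
    refine ⟨[], by simp, by simp, fun V' M' h hh => ?_⟩
    simp only [Expr.MHolds]
    exact hh.eqA v (by simp) x (by simp [Expr.names]) a (by simp [Expr.names]) he
  | .ne x a =>
    simp only [Expr.MHolds] at he
    refine ⟨[], by simp, by simp, fun V' M' h hh => ?_⟩
    simp only [Expr.MHolds]
    exact hh.neA v (by simp) x (by simp [Expr.names]) a (by simp [Expr.names]) he
  | .or e f =>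
    simp only [Expr.MHolds] at he
    rcases he with he | he
    · obtain ⟨W, hW, hR, H⟩ := Expr.exists_witness M e v he
      refine ⟨W, by simp [Expr.enc]; omega, hR, fun V' M' h hh => ?_⟩
      simp only [Expr.MHolds]
      exact .inl (H V' M' h (hh.mono (by simp [Expr.names]) subset_rfl))
    · obtain ⟨W, hW, hR, H⟩ := Expr.exists_witness M f v he
      refine ⟨W, by simp [Expr.enc]; omega, hR, fun V' M' h hh => ?_⟩
      simp only [Expr.MHolds]
      exact .inr (H V' M' h (hh.mono (by simp [Expr.names]) subset_rfl))
/-- The truth of a list of filter expressions is witnessed by few vertices. -/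
theorem Filters.exists_witness (M : Model V) (fs : Filters) (v : V) (hf : fs.MHolds M v) :
    ∃ W : List V, W.length + 1 ≤ fs.enc.length ∧ (∀ w ∈ W, ∃ a x, M.rel a x w) ∧
      ∀ (V' : Type) (M' : Model V') (h : V → V'), HomOn M M' fs.names (withRoot v W) h →
        fs.MHolds M' (h v) := by
  match fs with
  | .nil =>
    exact ⟨[], by simp [Filters.enc], by simp, fun V' M' h hh => by simp only [Filters.MHolds]⟩
  | .cons e fs =>
    simp only [Filters.MHolds] at hf
    obtain ⟨W₁, hW₁, hR₁, H₁⟩ := Expr.exists_witness M e v hf.1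
    obtain ⟨W₂, hW₂, hR₂, H₂⟩ := Filters.exists_witness M fs v hf.2
    refine ⟨W₁ ++ W₂, by simp [Filters.enc]; omega, List.forall_mem_append.2 ⟨hR₁, hR₂⟩,
      fun V' M' h hh => ?_⟩
    simp only [Filters.MHolds]
    refine ⟨H₁ V' M' h (hh.mono (by simp [Filters.names]) ?_),
      H₂ V' M' h (hh.mono (by simp [Filters.names]) ?_)⟩
    · rintro x (rfl | hx) <;> simp [*]
    · rintro x (rfl | hx) <;> simp [*]
end

end

/-! ### Certificates -/

/-- A vertex of a certificate is the list of the records on the way to the root, its own record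
first. -/
abbrev CVert : Type := List SExp

/-- The vertices of a certificate. -/
def verts (c : SExp) : List CVert := c.car.toList.map SExp.toList

/-- All values that an association list gives to a name. -/
def lookup (l : List SExp) (k : Name) : List SExp :=
  (l.filter fun e => decide (e.car = enc k)).map SExp.cdr

/-- The element name in a record. -/
def labelOf (v : CVert) : Name := (v.headD .nil).car.cdr.toList.map fun b => !b.toList.isEmpty

/-- The values of an attribute in a record; only the first one counts. -/
def attrOf (v : CVert) (a : Name) : List SExp := lookup (v.headD .nil).cdr.toList a

/-- The value of a variable. -/
def varOf (c : SExp) (x : Name) : SExp := (lookup c.cdr.toList x).headD .nil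

/-- `u` is a proper suffix of `v`. -/
def isAncestor (u v : CVert) : Bool :=
  (v.foldl (fun s _ => (s.1.tail, s.2 || decide (u = s.1.tail))) (v, false)).2

/-- The axes on the vertices of a certificate. -/
def crel : Axis → CVert → CVert → Prop
  | .self, u, v => v = u
  | .child, u, v => v.tail = u
  | .descendant, u, v => ∃ l, l ≠ [] ∧ v = l ++ u

/-- The model described by a certificate. -/
def cmodel (c : SExp) : Model CVert where
  rel a u v := u ∈ verts c ∧ v ∈ verts c ∧ crel a u v
  lab v s := labelOf v = s
  eqA x a v := attrOf v a ≠ [] ∧ (attrOf v a).headD .nil = varOf c x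
  neA x a v := attrOf v a ≠ [] ∧ (attrOf v a).headD .nil ≠ varOf c x

/-- The vertices of a certificate are nonempty lists and closed under nonempty tails. -/
def closed (c : SExp) : Bool :=
  (verts c).all fun v => !v.isEmpty && (v.tail.isEmpty || decide (v.tail ∈ verts c))

/-- The root of a certificate. -/
def croot (c : SExp) : CVert := (verts c).headD []

/-- The fold uses the entries of `v` only as a clock: after `k + 1` rounds its first component is
`v.drop (k + 1)`. -/
theorem isAncestor_iff (u v : CVert) : isAncestor u v = true ↔ ∃ l, l ≠ [] ∧ v = l ++ u := by
  have key : ∀ (w : CVert) (v : CVert) (b : Bool),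
      (w.foldl (fun s _ => (s.1.tail, s.2 || decide (u = s.1.tail))) (v, b)).2 = true ↔
        b = true ∨ ∃ k < w.length, u = v.drop (k + 1) := by
    intro w
    induction w with
    | nil => simp
    | cons x w ih =>
      intro v b
      rw [List.foldl_cons, ih]
      simp only [Bool.or_eq_true, decide_eq_true_eq, List.length_cons, or_assoc]
      refine or_congr_right ?_
      constructor
      · rintro (h | ⟨k, hk, h⟩)
        · exact ⟨0, by omega, by simpa using h⟩
        · exact ⟨k + 1, by omega, by simpa using h⟩
      · rintro ⟨_ | k, hk, h⟩
        · exact .inl (by simpa using h)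
        · exact .inr ⟨k, by omega, by simpa using h⟩
  rw [isAncestor, key]
  simp only [Bool.false_eq_true, false_or]
  constructor
  · rintro ⟨k, hk, rfl⟩
    refine ⟨v.take (k + 1), ?_, (List.take_append_drop _ _).symm⟩
    cases v <;> simp at hk ⊢
  · rintro ⟨l, hl, rfl⟩
    have := List.length_pos_iff.2 hl
    refine ⟨l.length - 1, by simp; omega, ?_⟩
    rw [Nat.sub_add_cancel this, List.drop_left]

/-- Every path contains a step, and all axes are restricted to the vertices of the certificate.
Relations can therefore be stored as finite lists of pairs of vertices. -/
theorem mem_of_mSem (c : SExp) (p : LPath) (u v : CVert) (h : p.MSem (cmodel c) u v) :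
    u ∈ verts c ∧ v ∈ verts c := by
  match p with
  | .step a n fs => simp only [LPath.MSem] at h; exact ⟨h.1.1, h.1.2.1⟩
  | .comp p q =>
    simp only [LPath.MSem] at h
    obtain ⟨w, h1, h2⟩ := h
    exact ⟨(mem_of_mSem c p u w h1).1, (mem_of_mSem c q w v h2).2⟩
  | .union p q =>
    simp only [LPath.MSem] at h
    rcases h with h | h
    · exact mem_of_mSem c p u v h
    · exact mem_of_mSem c q u v h

/-! ### Evaluation of words -/

/-- The kinds of expressions. -/
inductive Tag where
  | name | star | path | expr | filt
  deriving DecidableEq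

/-- Small trees that represent numbers. -/
def unary : ℕ → SExp
  | 0 => .nil
  | n + 1 => .cons .nil (unary n)

theorem unary_injective : Function.Injective unary := by
  intro m
  induction m with
  | zero => intro n h; cases n <;> simp_all [unary]
  | succ m ih =>
    intro n h
    cases n with
    | zero => simp [unary] at h
    | succ n => simp only [unary, SExp.cons.injEq, true_and] at h; rw [ih h]

def Tag.index : Tag → ℕ
  | .name => 0 | .star => 1 | .path => 2 | .expr => 3 | .filt => 4

def Sym.index : Sym → ℕ
  | .self => 0 | .child => 1 | .descendant => 2 | .star => 3 | .bit0 => 4 | .bit1 => 5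
  | .eon => 6 | .lbr => 7 | .rbr => 8 | .slash => 9 | .bar => 10 | .or => 11 | .eq => 12 | .ne => 13

instance : Coded Tag := ⟨fun s => unary s.index, fun a b h => by
  have := unary_injective h
  cases a <;> cases b <;> first | rfl | simp [Tag.index] at this⟩

instance : Coded Sym := ⟨fun s => unary s.index, fun a b h => by
  have := unary_injective h
  revert this
  clear h
  revert a b
  decide⟩

/-- The value of an expression: its kind, a name, a binary relation (for paths), and the set of
vertices at which it holds. -/
abbrev Item : Type := Tag × Name × List (CVert × CVert) × List CVert

namespace Item
abbrev tag (i : Item) : Tag := i.1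
abbrev nm (i : Item) : Name := i.2.1
abbrev pairs (i : Item) : List (CVert × CVert) := i.2.2.1
abbrev set (i : Item) : List CVert := i.2.2.2
abbrev dflt : Item := (.name, [], [], [])

/-- Paths are expressions. -/
def isExpr (i : Item) : Bool := decide (i.tag = .path) || decide (i.tag = .expr)
def isTest (i : Item) : Bool := decide (i.tag = .name) || decide (i.tag = .star)
end Item

def Sym.isAxis (s : Sym) : Bool :=
  decide (s = .self) || decide (s = .child) || decide (s = .descendant)
def Sym.isPath (s : Sym) : Bool := s.isAxis || decide (s = .slash) || decide (s = .bar)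
def Sym.isNullary (s : Sym) : Bool :=
  decide (s = .star) || decide (s = .eon) || decide (s = .rbr)
def Sym.isUnary (s : Sym) : Bool := decide (s = .bit0) || decide (s = .bit1)
def Sym.isName (s : Sym) : Bool := decide (s = .eon) || s.isUnary
def Sym.isCmp (s : Sym) : Bool := decide (s = .eq) || decide (s = .ne)

/-- The two topmost values fit the symbol. -/
def okSym (s : Sym) (i j : Item) : Bool :=
  bif s.isNullary then true
  else bif s.isUnary then decide (i.tag = .name)
  else bif s.isAxis then i.isTest && decide (j.tag = .filt)
  else bif s = .lbr then i.isExpr && decide (j.tag = .filt)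
  else bif s = .or then i.isExpr && j.isExpr
  else bif s.isCmp then decide (i.tag = .name) && decide (j.tag = .name)
  else decide (i.tag = .path) && decide (j.tag = .path)

def newTag (s : Sym) : Tag :=
  bif s.isName then .name
  else bif s = .star then .star
  else bif s.isPath then .path
  else bif decide (s = .lbr) || decide (s = .rbr) then .filt
  else .expr

def newName (s : Sym) (i : Item) : Name :=
  bif s = .bit0 then false :: i.nm else bif s = .bit1 then true :: i.nm else []

def newPairs (c : SExp) (s : Sym) (i j : Item) : List (CVert × CVert) :=
  (verts c ×ˢ verts c).filter fun x =>
    bif s = .slash then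
      (verts c).any fun w => decide ((x.1, w) ∈ i.pairs) && decide ((w, x.2) ∈ j.pairs)
    else bif s = .bar then decide (x ∈ i.pairs) || decide (x ∈ j.pairs)
    else (bif s = .self then decide (x.2 = x.1)
        else bif s = .child then decide (x.2.tail = x.1)
        else decide (s = .descendant) && isAncestor x.1 x.2) &&
      ((decide (i.tag = .star) || decide (labelOf x.2 = i.nm)) && decide (x.2 ∈ j.set))

def newSet (c : SExp) (s : Sym) (i j : Item) (r : List (CVert × CVert)) : List CVert :=
  (verts c).filter fun v =>
    bif s.isPath then (verts c).any fun w => decide ((v, w) ∈ r)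
    else bif s = .or then decide (v ∈ i.set) || decide (v ∈ j.set)
    else bif s = .lbr then decide (v ∈ i.set) && decide (v ∈ j.set)
    -- Presence of the attribute is required for both comparisons; the exclusive or negates the
    -- equality test for `ne`.
    else bif s.isCmp then !(attrOf v j.nm).isEmpty &&
      (decide (s = .ne) ^^ decide ((attrOf v j.nm).headD .nil = varOf c i.nm))
    else true

def newItem (c : SExp) (s : Sym) (i j : Item) : Item :=
  (newTag s, newName s i, newPairs c s i j, newSet c s i j (newPairs c s i j))

/-- The number of stack positions that a symbol consumes. -/
def remaining (s : Sym) (st : List Item) : List Item :=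
  bif s.isNullary then st else bif s.isUnary then st.tail else st.tail.tail

/-- Processing one symbol, from right to left. The second component is `false` after an error. -/
def evalSym (c : SExp) (s : Sym) (st : List Item × Bool) : List Item × Bool :=
  bif st.2 && (okSym s (st.1.headD Item.dflt) (st.1.tail.headD Item.dflt) &&
    -- The default item is of kind `name` and would fit some symbols, so the depth of the stack is
    -- tested separately.
    (s.isNullary || (!st.1.isEmpty && (s.isUnary || !st.1.tail.isEmpty)))) then
    (newItem c s (st.1.headD Item.dflt) (st.1.tail.headD Item.dflt) :: remaining s st.1, true)
  else ([], false)

def eval (c : SExp) (w : List Sym) : List Item × Bool := w.foldr (evalSym c) ([], true)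

/-- The word consists of two paths. -/
def isPair (r : List Item × Bool) : Bool :=
  r.2 && (r.1.tail.tail.isEmpty && !r.1.tail.isEmpty &&
    (decide ((r.1.headD Item.dflt).tag = .path) &&
      decide ((r.1.tail.headD Item.dflt).tag = .path)))

/-- `c` describes a counterexample for the containment given by `w`. -/
def isCex (w : List Sym) (c : SExp) : Bool :=
  closed c && isPair (eval c w) &&
    (decide (croot c ∈ ((eval c w).1.headD Item.dflt).set) &&
      !decide (croot c ∈ ((eval c w).1.tail.headD Item.dflt).set))

/-! ### The evaluation is in polynomial space -/

section
variable {α : Type} [Coded α]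

@[fun_prop] theorem PS.verts {f : α → SExp} (hf : PS f) : PS (fun x => verts (f x)) := by
  unfold XPathVars.verts
  exact PS.map (by fun_prop) (by fun_prop)

@[fun_prop] theorem PS.lookup {l : α → List SExp} {k : α → Name} (hl : PS l) (hk : PS k) :
    PS (fun x => lookup (l x) (k x)) := by
  unfold XPathVars.lookup
  exact PS.map (PS.filter hl (by fun_prop)) (by fun_prop)

@[fun_prop] theorem PS.labelOf {v : α → CVert} (hv : PS v) : PS (fun x => labelOf (v x)) := by
  unfold XPathVars.labelOf
  exact PS.map (by fun_prop) (by fun_prop)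

@[fun_prop] theorem PS.attrOf {v : α → CVert} {a : α → Name} (hv : PS v) (ha : PS a) :
    PS (fun x => attrOf (v x) (a x)) := by
  unfold XPathVars.attrOf
  fun_prop

@[fun_prop] theorem PS.varOf {c : α → SExp} {a : α → Name} (hc : PS c) (ha : PS a) :
    PS (fun x => varOf (c x) (a x)) := by
  unfold XPathVars.varOf
  fun_prop

@[fun_prop] theorem PS.closed {f : α → SExp} (hf : PS f) : PS (fun x => closed (f x)) := by
  unfold XPathVars.closed
  exact PS.all (by fun_prop) (by fun_prop)

@[fun_prop] theorem PS.croot {f : α → SExp} (hf : PS f) : PS (fun x => croot (f x)) := by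
  unfold XPathVars.croot
  fun_prop

@[fun_prop] theorem PS.isAncestor {u v : α → CVert} (hu : PS u) (hv : PS v) :
    PS (fun x => isAncestor (u x) (v x)) := by
  unfold XPathVars.isAncestor
  obtain ⟨P, hP⟩ := hv.bound
  refine PS.comp (g := fun s : CVert × Bool => s.2) (by fun_prop)
    (PS.foldl (h := fun x (s : CVert × Bool) _ => (s.1.tail, s.2 || decide (u x = s.1.tail)))
      (by fun_prop) (by fun_prop) (by fun_prop) (P + 4) ?_)
  intro x l₁ l₂ _
  have h : ∀ (l : CVert) (s : CVert × Bool),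
      sz (l.foldl (fun s _ => (s.1.tail, s.2 || decide (u x = s.1.tail))) s) ≤ sz s.1 + 4 := by
    intro l
    induction l with
    | nil => intro s; have := sz_bool s.2; rw [List.foldl_nil, sz_prod]; omega
    | cons a l ih =>
      intro s
      refine (ih _).trans ?_
      have := sz_sublist (List.tail_sublist s.1)
      simpa using this
  have h1 := h l₁ (v x, false)
  have h2 := hP x
  simp at h1 ⊢
  omega

@[fun_prop] theorem PS.okSym {s : α → Sym} {i j : α → Item} (hs : PS s) (hi : PS i) (hj : PS j) :
    PS (fun x => okSym (s x) (i x) (j x)) := by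
  unfold XPathVars.okSym Sym.isNullary Sym.isUnary Sym.isAxis Sym.isCmp Item.isExpr Item.isTest
    Item.tag
  fun_prop

@[fun_prop] theorem PS.newTag {s : α → Sym} (hs : PS s) : PS (fun x => newTag (s x)) := by
  unfold XPathVars.newTag Sym.isName Sym.isUnary Sym.isPath Sym.isAxis
  fun_prop

@[fun_prop] theorem PS.newName {s : α → Sym} {i : α → Item} (hs : PS s) (hi : PS i) :
    PS (fun x => newName (s x) (i x)) := by
  unfold XPathVars.newName Item.nm
  fun_prop

@[fun_prop] theorem PS.newPairs {c : α → SExp} {s : α → Sym} {i j : α → Item} (hc : PS c)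
    (hs : PS s) (hi : PS i) (hj : PS j) : PS (fun x => newPairs (c x) (s x) (i x) (j x)) := by
  unfold XPathVars.newPairs
  refine PS.filter (by fun_prop) (PS.cond (by fun_prop)
    (PS.any (by fun_prop) ?_) (PS.cond (by fun_prop) ?_ ?_))
  all_goals
    dsimp only [Item.pairs, Item.tag, Item.nm, Item.set]
    fun_prop

@[fun_prop] theorem PS.newSet {c : α → SExp} {s : α → Sym} {i j : α → Item}
    {r : α → List (CVert × CVert)} (hc : PS c)
    (hs : PS s) (hi : PS i) (hj : PS j) (hr : PS r) :
    PS (fun x => newSet (c x) (s x) (i x) (j x) (r x)) := by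
  unfold XPathVars.newSet
  refine PS.filter (by fun_prop) (PS.cond ?_ (PS.any (by fun_prop) (by fun_prop)) ?_)
  all_goals
    dsimp only [Sym.isPath, Sym.isAxis, Sym.isCmp, Item.nm, Item.set]
    fun_prop

@[fun_prop] theorem PS.evalSym {c : α → SExp} {s : α → Sym} {st : α → List Item × Bool}
    (hc : PS c) (hs : PS s) (hst : PS st) : PS (fun x => evalSym (c x) (s x) (st x)) := by
  unfold XPathVars.evalSym remaining newItem Sym.isNullary Sym.isUnary
  fun_prop

end


theorem eval_cons (c : SExp) (s : Sym) (w : List Sym) :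
    eval c (s :: w) = evalSym c s (eval c w) := rfl

/-- A bound for the values on the stack after reading `n` symbols. -/
def Fits (c : SExp) (n : ℕ) (st : List Item) : Prop :=
  st.length ≤ n ∧ ∀ i ∈ st, i.nm.length ≤ n ∧ sz i.pairs ≤ sz (verts c ×ˢ verts c) ∧
    sz i.set ≤ sz (verts c)

theorem Fits.tail {c : SExp} {n : ℕ} {st : List Item} (h : Fits c n st) : Fits c n st.tail :=
  ⟨by have := h.1; simp; omega, fun i hi => h.2 i (List.mem_of_mem_tail hi)⟩

/-- Relations and sets are filtered from fixed lists and do not grow with the word. Only names grow,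
by at most one letter per symbol. -/
theorem fits_eval (c : SExp) (w : List Sym) : Fits c w.length (eval c w).1 := by
  induction w with
  | nil => exact ⟨by simp [eval], by simp [eval]⟩
  | cons s w ih =>
    rw [eval_cons, evalSym]
    generalize eval c w = r at ih
    obtain ⟨st, b⟩ := r
    rw [Bool.cond_eq_ite]
    split_ifs
    · have hr : Fits c w.length (remaining s st) := by
        unfold remaining
        cases s.isNullary <;> cases s.isUnary
        exacts [ih.tail.tail, ih.tail, ih, ih]
      have hn : (st.headD Item.dflt).nm.length ≤ w.length := by
        rcases st with _ | ⟨i, st⟩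
        · exact Nat.zero_le _
        · exact (ih.2 i (by simp)).1
      refine ⟨by have := hr.1; simp; omega, ?_⟩
      intro i hi
      rcases List.mem_cons.1 hi with rfl | hi
      · refine ⟨?_, sz_sublist List.filter_sublist, sz_sublist List.filter_sublist⟩
        change (newName s (st.headD Item.dflt)).length ≤ w.length + 1
        unfold newName
        generalize st.headD Item.dflt = i at hn
        cases decide (s = Sym.bit0) <;> cases decide (s = Sym.bit1) <;> simp <;>
          omega
      · obtain ⟨h1, h2, h3⟩ := hr.2 i hi
        exact ⟨by simp; omega, h2, h3⟩
    · exact ⟨by simp, by simp⟩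

theorem sz_tag (t : Tag) : sz t ≤ 9 := by cases t <;> decide

theorem ps_eval : PS (fun x : List Sym × SExp => eval x.2 x.1) := by
  obtain ⟨P, hP⟩ := PS.bound (f := fun x : List Sym × SExp => verts x.2 ×ˢ verts x.2)
    (by fun_prop)
  obtain ⟨Q, hQ⟩ := PS.bound (f := fun x : List Sym × SExp => verts x.2) (by fun_prop)
  refine PS.foldr (l := fun x : List Sym × SExp => x.1) (i := fun _ => ([], true))
    (h := fun x s st => evalSym x.2 s st) (by fun_prop) (by fun_prop) (by fun_prop)
    (.X * (4 * .X + P + Q + 14) + 5) ?_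
  rintro ⟨w, c⟩ w₁ w₂ hw
  dsimp only at hw ⊢
  change sz (eval c w₂) ≤ _
  have h1 := fits_eval c w₂
  have h2 := hP (w, c)
  have h3 := hQ (w, c)
  have hlen : w₂.length ≤ sz (w, c) := by
    have := length_lt_sz w
    have : w.length = w₁.length + w₂.length := by simp [hw]
    simp; omega
  have h4 : sz (eval c w₂).1 ≤ sz (w, c) *
      (4 * sz (w, c) + P.eval (sz (w, c)) + Q.eval (sz (w, c)) + 13 + 1) + 1 := by
    refine sz_list_le (h1.1.trans hlen) ?_
    intro i hi
    obtain ⟨h5, h6, h7⟩ := h1.2 i hi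
    have h8 := sz_bits i.nm
    have h9 := sz_tag i.tag
    have h10 : sz i = sz i.tag + (sz i.nm + (sz i.pairs + sz i.set + 1) + 1) + 1 := rfl
    dsimp only at h2 h3
    omega
  have h5 := sz_bool (eval c w₂).2
  rw [sz_prod (eval c w₂)]
  simp only [Polynomial.eval_add, Polynomial.eval_mul, Polynomial.eval_X, Polynomial.eval_ofNat]
  rw [show ∀ n : ℕ, n + 13 + 1 = n + 14 from fun _ => rfl] at h4
  omega

section
variable {α : Type} [Coded α]

@[fun_prop] theorem PS.eval {c : α → SExp} {w : α → List Sym} (hc : PS c) (hw : PS w) :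
    PS (fun x => eval (c x) (w x)) :=
  PS.comp (f := fun x => (w x, c x)) ps_eval (by fun_prop)

@[fun_prop] theorem PS.isPair {r : α → List Item × Bool} (hr : PS r) :
    PS (fun x => isPair (r x)) := by
  unfold XPathVars.isPair
  dsimp only [Item.tag]
  fun_prop

@[fun_prop] theorem PS.isCex {c : α → SExp} {w : α → List Sym} (hc : PS c) (hw : PS w) :
    PS (fun x => isCex (w x) (c x)) := by
  unfold XPathVars.isCex
  dsimp only [Item.set]
  fun_prop

end

/-! ### Correctness of the evaluation -/

/-- These four predicates are the invariants of the evaluation. An item of a path also stores the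
domain of its relation, so it can serve as a filter unchanged; the notation has no mark for that
coercion. -/
def RepPath (c : SExp) (p : LPath) (i : Item) : Prop :=
  i.tag = .path ∧ (∀ u v, (u, v) ∈ i.pairs ↔ p.MSem (cmodel c) u v) ∧
    ∀ u, u ∈ i.set ↔ ∃ v, p.MSem (cmodel c) u v

def RepExpr (c : SExp) (e : Expr) (i : Item) : Prop :=
  i.isExpr = true ∧ ∀ u, u ∈ i.set ↔ u ∈ verts c ∧ e.MHolds (cmodel c) u

def RepFilt (c : SExp) (fs : Filters) (i : Item) : Prop :=
  i.tag = .filt ∧ ∀ u, u ∈ i.set ↔ u ∈ verts c ∧ fs.MHolds (cmodel c) u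

def RepTest (c : SExp) (n : NodeTest) (i : Item) : Prop :=
  i.isTest = true ∧ ∀ v, (i.tag = .star ∨ labelOf v = i.nm) ↔ n.MHolds (cmodel c) v

theorem RepPath.repExpr {c : SExp} {p : LPath} {i : Item} (h : RepPath c p i) :
    RepExpr c (.path p) i := by
  refine ⟨by simp [Item.isExpr, h.1], fun u => ?_⟩
  rw [h.2.2]
  simp only [Expr.MHolds]
  exact ⟨fun ⟨v, hv⟩ => ⟨(mem_of_mSem c p u v hv).1, v, hv⟩, fun h => h.2⟩

theorem eval_encName (c : SExp) (s : Name) (w : List Sym) {st : List Item}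
    (hw : eval c w = (st, true)) :
    ∃ i : Item, i.tag = .name ∧ i.nm = s ∧ eval c (encName s ++ w) = (i :: st, true) := by
  induction s with
  | nil =>
    refine ⟨newItem c .eon (st.headD Item.dflt) (st.tail.headD Item.dflt), rfl, rfl, ?_⟩
    simp [encName, eval_cons, hw, evalSym, okSym, Sym.isNullary, remaining]
  | cons b s ih =>
    obtain ⟨i, h1, h2, h3⟩ := ih
    cases b
    · refine ⟨newItem c .bit0 i (st.headD Item.dflt), rfl, ?_, ?_⟩
      · simp [newItem, newName, h2]
      · simp [encName, eval_cons, h3, evalSym, okSym, Sym.isNullary, Sym.isUnary, remaining, h1]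
    · refine ⟨newItem c .bit1 i (st.headD Item.dflt), rfl, ?_, ?_⟩
      · simp [newItem, newName, h2]
      · simp [encName, eval_cons, h3, evalSym, okSym, Sym.isNullary, Sym.isUnary, remaining, h1]

theorem eval_test (c : SExp) (n : NodeTest) (w : List Sym) {st : List Item}
    (hw : eval c w = (st, true)) :
    ∃ i : Item, RepTest c n i ∧ eval c (n.enc ++ w) = (i :: st, true) := by
  cases n with
  | label s =>
    obtain ⟨i, h1, h2, h3⟩ := eval_encName c s w hw
    refine ⟨i, ⟨by simp [Item.isTest, h1], fun v => ?_⟩, h3⟩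
    simp [h1, h2, NodeTest.MHolds, cmodel]
  | wildcard =>
    refine ⟨newItem c .star (st.headD Item.dflt) (st.tail.headD Item.dflt), ⟨rfl, fun v => ?_⟩, ?_⟩
    · simp [newItem, newTag, Sym.isName, Sym.isUnary, NodeTest.MHolds]
    · simp [NodeTest.enc, eval_cons, hw, evalSym, okSym, Sym.isNullary, remaining]

theorem mem_newSet_of_isPath (c : SExp) (s : Sym) (i j : Item) (r : List (CVert × CVert))
    (hs : s.isPath = true) (u : CVert) :
    u ∈ newSet c s i j r ↔ u ∈ verts c ∧ ∃ w ∈ verts c, (u, w) ∈ r := by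
  simp [newSet, hs]

theorem repPath_newItem (c : SExp) (p : LPath) (s : Sym) (i j : Item) (hs : s.isPath = true)
    (hp : ∀ u v, (u, v) ∈ newPairs c s i j ↔ p.MSem (cmodel c) u v) :
    RepPath c p (newItem c s i j) := by
  refine ⟨?_, hp, fun u => ?_⟩
  · have h1 : s.isName = false := by revert hs; cases s <;> decide
    have h2 : decide (s = .star) = false := by revert hs; cases s <;> decide
    simp only [newItem, newTag, h1, h2, hs, cond_false, cond_true]
  · change u ∈ newSet c s i j (newPairs c s i j) ↔ _
    rw [mem_newSet_of_isPath c s i j _ hs]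
    constructor
    · rintro ⟨_, w, _, h⟩
      exact ⟨w, (hp u w).1 h⟩
    · rintro ⟨w, h⟩
      obtain ⟨h1, h2⟩ := mem_of_mSem c p u w h
      exact ⟨h1, w, h2, (hp u w).2 h⟩

theorem eval_axis (c : SExp) (a : Axis) (n : NodeTest) (fs : Filters) {i j : Item}
    (hi : RepTest c n i) (hj : RepFilt c fs j) (w : List Sym) {st : List Item}
    (hw : eval c w = (i :: j :: st, true)) :
    ∃ k : Item, RepPath c (.step a n fs) k ∧ eval c (a.enc ++ w) = (k :: st, true) := by
  obtain ⟨h1, h2⟩ := hi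
  obtain ⟨h3, h4⟩ := hj
  cases a
  · refine ⟨newItem c .self i j, repPath_newItem _ _ _ _ _ rfl fun u v => ?_, ?_⟩
    · simp only [LPath.MSem, ← h2]
      simp [newPairs, cmodel, crel, h4]
      tauto
    · simp [Axis.enc, eval_cons, hw, evalSym, okSym, Sym.isNullary, Sym.isUnary, Sym.isAxis,
        remaining, h1, h3]
  · refine ⟨newItem c .child i j, repPath_newItem _ _ _ _ _ rfl fun u v => ?_, ?_⟩
    · simp only [LPath.MSem, ← h2]
      simp [newPairs, cmodel, crel, h4]
      tauto
    · simp [Axis.enc, eval_cons, hw, evalSym, okSym, Sym.isNullary, Sym.isUnary, Sym.isAxis,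
        remaining, h1, h3]
  · refine ⟨newItem c .descendant i j, repPath_newItem _ _ _ _ _ rfl fun u v => ?_, ?_⟩
    · simp only [LPath.MSem, ← h2]
      simp [newPairs, cmodel, crel, h4, isAncestor_iff]
      tauto
    · simp [Axis.enc, eval_cons, hw, evalSym, okSym, Sym.isNullary, Sym.isUnary, Sym.isAxis,
        remaining, h1, h3]

theorem eval_slash (c : SExp) (p q : LPath) {i j : Item} (hi : RepPath c p i)
    (hj : RepPath c q j) (w : List Sym) {st : List Item} (hw : eval c w = (i :: j :: st, true)) :
    ∃ k : Item, RepPath c (.comp p q) k ∧ eval c (.slash :: w) = (k :: st, true) := by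
  refine ⟨newItem c .slash i j, repPath_newItem _ _ _ _ _ rfl fun u v => ?_, ?_⟩
  · simp only [LPath.MSem, ← hi.2.1, ← hj.2.1]
    simp only [newPairs, List.mem_filter, List.mem_product, decide_true, cond_true,
      List.any_eq_true, Bool.and_eq_true, decide_eq_true_eq]
    constructor
    · rintro ⟨_, x, _, h⟩
      exact ⟨x, h⟩
    · rintro ⟨x, h1, h2⟩
      have h3 := mem_of_mSem c p u x ((hi.2.1 u x).1 h1)
      have h4 := mem_of_mSem c q x v ((hj.2.1 x v).1 h2)
      exact ⟨⟨h3.1, h4.2⟩, x, h3.2, h1, h2⟩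
  · simp [eval_cons, hw, evalSym, okSym, Sym.isNullary, Sym.isUnary, Sym.isAxis, Sym.isCmp,
      remaining, hi.1, hj.1]

theorem eval_bar (c : SExp) (p q : LPath) {i j : Item} (hi : RepPath c p i)
    (hj : RepPath c q j) (w : List Sym) {st : List Item} (hw : eval c w = (i :: j :: st, true)) :
    ∃ k : Item, RepPath c (.union p q) k ∧ eval c (.bar :: w) = (k :: st, true) := by
  refine ⟨newItem c .bar i j, repPath_newItem _ _ _ _ _ rfl fun u v => ?_, ?_⟩
  · simp only [LPath.MSem, ← hi.2.1, ← hj.2.1]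
    simp only [newPairs, List.mem_filter, List.mem_product, decide_true, cond_true,
      reduceCtorEq, decide_false, cond_false, Bool.or_eq_true, decide_eq_true_eq]
    constructor
    · rintro ⟨_, h⟩
      exact h
    · rintro (h | h)
      · exact ⟨mem_of_mSem c p u v ((hi.2.1 u v).1 h), .inl h⟩
      · exact ⟨mem_of_mSem c q u v ((hj.2.1 u v).1 h), .inr h⟩
  · simp [eval_cons, hw, evalSym, okSym, Sym.isNullary, Sym.isUnary, Sym.isAxis, Sym.isCmp,
      remaining, hi.1, hj.1]

theorem eval_or (c : SExp) (e f : Expr) {i j : Item} (hi : RepExpr c e i)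
    (hj : RepExpr c f j) (w : List Sym) {st : List Item} (hw : eval c w = (i :: j :: st, true)) :
    ∃ k : Item, RepExpr c (.or e f) k ∧ eval c (.or :: w) = (k :: st, true) := by
  refine ⟨newItem c .or i j, ⟨rfl, fun u => ?_⟩, ?_⟩
  · change u ∈ newSet c .or i j _ ↔ _
    simp [newSet, Sym.isPath, Sym.isAxis, hi.2, hj.2, Expr.MHolds]
    tauto
  · simp [eval_cons, hw, evalSym, okSym, Sym.isNullary, Sym.isUnary, Sym.isAxis,
      remaining, hi.1, hj.1]

theorem eval_eq (c : SExp) (x a : Name) {i j : Item} (hi : i.tag = .name ∧ i.nm = x)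
    (hj : j.tag = .name ∧ j.nm = a) (w : List Sym) {st : List Item}
    (hw : eval c w = (i :: j :: st, true)) :
    ∃ k : Item, RepExpr c (.eq x a) k ∧ eval c (.eq :: w) = (k :: st, true) := by
  refine ⟨newItem c .eq i j, ⟨rfl, fun u => ?_⟩, ?_⟩
  · change u ∈ newSet c .eq i j _ ↔ _
    simp [newSet, Sym.isPath, Sym.isAxis, Sym.isCmp, hi.2, hj.2, Expr.MHolds, cmodel]
  · simp [eval_cons, hw, evalSym, okSym, Sym.isNullary, Sym.isUnary, Sym.isAxis, Sym.isCmp,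
      remaining, hi.1, hj.1]

theorem eval_ne (c : SExp) (x a : Name) {i j : Item} (hi : i.tag = .name ∧ i.nm = x)
    (hj : j.tag = .name ∧ j.nm = a) (w : List Sym) {st : List Item}
    (hw : eval c w = (i :: j :: st, true)) :
    ∃ k : Item, RepExpr c (.ne x a) k ∧ eval c (.ne :: w) = (k :: st, true) := by
  refine ⟨newItem c .ne i j, ⟨rfl, fun u => ?_⟩, ?_⟩
  · change u ∈ newSet c .ne i j _ ↔ _
    simp [newSet, Sym.isPath, Sym.isAxis, Sym.isCmp, hi.2, hj.2, Expr.MHolds, cmodel]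
  · simp [eval_cons, hw, evalSym, okSym, Sym.isNullary, Sym.isUnary, Sym.isAxis, Sym.isCmp,
      remaining, hi.1, hj.1]

theorem eval_rbr (c : SExp) (w : List Sym) {st : List Item} (hw : eval c w = (st, true)) :
    ∃ k : Item, RepFilt c .nil k ∧ eval c (.rbr :: w) = (k :: st, true) := by
  refine ⟨newItem c .rbr (st.headD Item.dflt) (st.tail.headD Item.dflt), ⟨rfl, fun u => ?_⟩, ?_⟩
  · change u ∈ newSet c .rbr _ _ _ ↔ _
    simp [newSet, Sym.isPath, Sym.isAxis, Sym.isCmp, Filters.MHolds]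
  · simp [eval_cons, hw, evalSym, okSym, Sym.isNullary, remaining]

theorem eval_lbr (c : SExp) (e : Expr) (fs : Filters) {i j : Item} (hi : RepExpr c e i)
    (hj : RepFilt c fs j) (w : List Sym) {st : List Item} (hw : eval c w = (i :: j :: st, true)) :
    ∃ k : Item, RepFilt c (.cons e fs) k ∧ eval c (.lbr :: w) = (k :: st, true) := by
  refine ⟨newItem c .lbr i j, ⟨rfl, fun u => ?_⟩, ?_⟩
  · change u ∈ newSet c .lbr i j _ ↔ _
    simp [newSet, Sym.isPath, Sym.isAxis, hi.2, hj.2, Filters.MHolds]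
    tauto
  · simp [eval_cons, hw, evalSym, okSym, Sym.isNullary, Sym.isUnary, Sym.isAxis,
      remaining, hi.1, hj.1]

mutual
-- In prefix notation read from the right, the second operand is evaluated first and lies below the
-- first one when the operator arrives. The continuation `w` and its stack are arbitrary so that the
-- induction goes through.
theorem LPath.eval_enc (c : SExp) (p : LPath) (w : List Sym) (st : List Item)
    (hw : eval c w = (st, true)) :
    ∃ i : Item, RepPath c p i ∧ eval c (p.enc ++ w) = (i :: st, true) := by
  match p with
  | .step a n fs =>
    obtain ⟨j, hj, h1⟩ := Filters.eval_enc c fs w st hw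
    obtain ⟨i, hi, h2⟩ := eval_test c n _ h1
    obtain ⟨k, hk, h3⟩ := eval_axis c a n fs hi hj _ h2
    exact ⟨k, hk, by simpa [LPath.enc] using h3⟩
  | .comp p q =>
    obtain ⟨j, hj, h1⟩ := LPath.eval_enc c q w st hw
    obtain ⟨i, hi, h2⟩ := LPath.eval_enc c p _ _ h1
    obtain ⟨k, hk, h3⟩ := eval_slash c p q hi hj _ h2
    exact ⟨k, hk, by simpa [LPath.enc] using h3⟩
  | .union p q =>
    obtain ⟨j, hj, h1⟩ := LPath.eval_enc c q w st hw
    obtain ⟨i, hi, h2⟩ := LPath.eval_enc c p _ _ h1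
    obtain ⟨k, hk, h3⟩ := eval_bar c p q hi hj _ h2
    exact ⟨k, hk, by simpa [LPath.enc] using h3⟩
theorem Expr.eval_enc (c : SExp) (e : Expr) (w : List Sym) (st : List Item)
    (hw : eval c w = (st, true)) :
    ∃ i : Item, RepExpr c e i ∧ eval c (e.enc ++ w) = (i :: st, true) := by
  match e with
  | .path p =>
    obtain ⟨i, hi, h⟩ := LPath.eval_enc c p w st hw
    exact ⟨i, hi.repExpr, by simpa [Expr.enc] using h⟩
  | .eq x a =>
    obtain ⟨j, hj, hj', h1⟩ := eval_encName c a w hw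
    obtain ⟨i, hi, hi', h2⟩ := eval_encName c x _ h1
    obtain ⟨k, hk, h3⟩ := eval_eq c x a ⟨hi, hi'⟩ ⟨hj, hj'⟩ _ h2
    exact ⟨k, hk, by simpa [Expr.enc] using h3⟩
  | .ne x a =>
    obtain ⟨j, hj, hj', h1⟩ := eval_encName c a w hw
    obtain ⟨i, hi, hi', h2⟩ := eval_encName c x _ h1
    obtain ⟨k, hk, h3⟩ := eval_ne c x a ⟨hi, hi'⟩ ⟨hj, hj'⟩ _ h2
    exact ⟨k, hk, by simpa [Expr.enc] using h3⟩
  | .or e f =>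
    obtain ⟨j, hj, h1⟩ := Expr.eval_enc c f w st hw
    obtain ⟨i, hi, h2⟩ := Expr.eval_enc c e _ _ h1
    obtain ⟨k, hk, h3⟩ := eval_or c e f hi hj _ h2
    exact ⟨k, hk, by simpa [Expr.enc] using h3⟩
theorem Filters.eval_enc (c : SExp) (fs : Filters) (w : List Sym) (st : List Item)
    (hw : eval c w = (st, true)) :
    ∃ i : Item, RepFilt c fs i ∧ eval c (fs.enc ++ w) = (i :: st, true) := by
  match fs with
  | .nil => simpa [Filters.enc] using eval_rbr c w hw
  | .cons e fs =>
    obtain ⟨j, hj, h1⟩ := Filters.eval_enc c fs w st hw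
    obtain ⟨i, hi, h2⟩ := Expr.eval_enc c e _ _ h1
    obtain ⟨k, hk, h3⟩ := eval_lbr c e fs hi hj _ h2
    exact ⟨k, hk, by simpa [Filters.enc] using h3⟩
end

theorem eval_encPair (c : SExp) (p q : LPath) : ∃ i j : Item, RepPath c p i ∧ RepPath c q j ∧
    eval c (encPair p q) = ([i, j], true) := by
  obtain ⟨j, hj, h1⟩ := LPath.eval_enc c q [] [] rfl
  obtain ⟨i, hi, h2⟩ := LPath.eval_enc c p _ _ h1
  exact ⟨i, j, hi, hj, by simpa [encPair] using h2⟩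

theorem isPair_encPair (c : SExp) (p q : LPath) : isPair (eval c (encPair p q)) = true := by
  obtain ⟨i, j, hi, hj, h⟩ := eval_encPair c p q
  simp [isPair, h, hi.1, hj.1]

/-- What the check of a certificate means. -/
theorem isCex_encPair (c : SExp) (p q : LPath) : isCex (encPair p q) c = true ↔
    closed c = true ∧ (∃ v, p.MSem (cmodel c) (croot c) v) ∧
      ¬∃ v, q.MSem (cmodel c) (croot c) v := by
  obtain ⟨i, j, hi, hj, h⟩ := eval_encPair c p q
  rw [isCex, isPair_encPair]
  simp only [h, List.headD_cons, List.tail_cons, Bool.and_true,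
    Bool.and_eq_true, decide_eq_true_eq, Bool.not_eq_true', decide_eq_false_iff_not,
    hi.2.2, hj.2.2]

/-! ### Ill-formed words -/

/-- The words whose value has the given kind. -/
def Generates : Tag → List Sym → Prop
  | .name, w => ∃ s, w = encName s
  | .star, w => w = [.star]
  | .path, w => ∃ p : LPath, w = p.enc
  | .expr, w => ∃ e : Expr, w = e.enc
  | .filt, w => ∃ fs : Filters, w = fs.enc

theorem generates_expr {i : Item} (hi : i.isExpr = true) {w : List Sym}
    (h : Generates i.tag w) : ∃ e : Expr, w = e.enc := by
  simp only [Item.isExpr, Bool.or_eq_true, decide_eq_true_eq] at hi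
  rcases hi with hi | hi <;> rw [hi] at h
  · obtain ⟨p, rfl⟩ := h
    exact ⟨.path p, by simp only [Expr.enc]⟩
  · exact h

theorem generates_test {i : Item} (hi : i.isTest = true) {w : List Sym}
    (h : Generates i.tag w) : ∃ n : NodeTest, w = n.enc := by
  simp only [Item.isTest, Bool.or_eq_true, decide_eq_true_eq] at hi
  rcases hi with hi | hi <;> rw [hi] at h
  · obtain ⟨s, rfl⟩ := h
    exact ⟨.label s, rfl⟩
  · exact ⟨.wildcard, h⟩

theorem generates_nullary {s : Sym} (hs : s.isNullary = true) : Generates (newTag s) [s] := by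
  cases s <;> first | (simp [Sym.isNullary] at hs; done) | skip
  · exact rfl
  · exact ⟨[], rfl⟩
  · exact ⟨.nil, by simp [Filters.enc]⟩

theorem generates_unary {s : Sym} (hs : s.isUnary = true) {i j : Item}
    (hok : okSym s i j = true) {w : List Sym} (hw : Generates i.tag w) :
    Generates (newTag s) (s :: w) := by
  cases s <;> first | (simp [Sym.isUnary] at hs; done) | skip
  all_goals
    simp [okSym, Sym.isNullary, Sym.isUnary] at hok
    rw [hok] at hw
    obtain ⟨s, rfl⟩ := hw
  · exact ⟨false :: s, rfl⟩
  · exact ⟨true :: s, rfl⟩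

theorem generates_binary {s : Sym} (hs : s.isNullary = false) (hs' : s.isUnary = false)
    {i j : Item} (hok : okSym s i j = true) {w w' : List Sym} (hw : Generates i.tag w)
    (hw' : Generates j.tag w') : Generates (newTag s) (s :: (w ++ w')) := by
  cases s <;> first | (simp [Sym.isNullary] at hs; done) | (simp [Sym.isUnary] at hs'; done) | skip
  all_goals
    simp [okSym, Sym.isNullary, Sym.isUnary, Sym.isAxis, Sym.isCmp] at hok
    try rw [hok.2] at hw'
  · obtain ⟨n, rfl⟩ := generates_test hok.1 hw
    obtain ⟨fs, rfl⟩ := hw'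
    exact ⟨.step .self n fs, by simp [LPath.enc, Axis.enc]⟩
  · obtain ⟨n, rfl⟩ := generates_test hok.1 hw
    obtain ⟨fs, rfl⟩ := hw'
    exact ⟨.step .child n fs, by simp [LPath.enc, Axis.enc]⟩
  · obtain ⟨n, rfl⟩ := generates_test hok.1 hw
    obtain ⟨fs, rfl⟩ := hw'
    exact ⟨.step .descendant n fs, by simp [LPath.enc, Axis.enc]⟩
  · obtain ⟨e, rfl⟩ := generates_expr hok.1 hw
    obtain ⟨fs, rfl⟩ := hw'
    exact ⟨.cons e fs, by simp [Filters.enc]⟩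
  · rw [hok.1] at hw
    obtain ⟨p, rfl⟩ := hw
    obtain ⟨q, rfl⟩ := hw'
    exact ⟨.comp p q, by simp [LPath.enc]⟩
  · rw [hok.1] at hw
    obtain ⟨p, rfl⟩ := hw
    obtain ⟨q, rfl⟩ := hw'
    exact ⟨.union p q, by simp [LPath.enc]⟩
  · obtain ⟨e, rfl⟩ := generates_expr hok.1 hw
    obtain ⟨f, rfl⟩ := generates_expr hok.2 hw'
    exact ⟨.or e f, by simp [Expr.enc]⟩
  · rw [hok.1] at hw
    obtain ⟨x, rfl⟩ := hw
    obtain ⟨a, rfl⟩ := hw'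
    exact ⟨.eq x a, by simp [Expr.enc]⟩
  · rw [hok.1] at hw
    obtain ⟨x, rfl⟩ := hw
    obtain ⟨a, rfl⟩ := hw'
    exact ⟨.ne x a, by simp [Expr.enc]⟩

/-- Every item on the stack comes from a segment of the word, and its kind names the syntactic
category of that segment. A final stack of two paths thus splits the word into two encoded paths. -/
theorem exists_generates (c : SExp) (w : List Sym) : ∀ st, eval c w = (st, true) →
    ∃ ws : List (List Sym), w = ws.flatten ∧ List.Forall₂ (fun i w => Generates i.tag w) st ws := by
  induction w with
  | nil =>
    intro st h
    obtain rfl : [] = st := congrArg Prod.fst h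
    exact ⟨[], rfl, .nil⟩
  | cons s w ih =>
    intro st h
    rw [eval_cons, evalSym, Bool.cond_eq_ite] at h
    generalize hr : eval c w = r at h ih
    obtain ⟨st', b⟩ := r
    split_ifs at h with hc
    swap
    · simp at h
    simp only [Bool.and_eq_true, Bool.or_eq_true] at hc
    obtain ⟨hb, hok, hlen⟩ := hc
    dsimp only at hb hok hlen h
    subst hb
    obtain ⟨ws, rfl, hws⟩ := ih st' rfl
    obtain rfl := congrArg Prod.fst h
    dsimp only at *
    clear h hr ih
    cases h1 : s.isNullary
    · rcases hws with _ | @⟨i, w, st, ws, hi, hws⟩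
      · simp [h1] at hlen
      cases h2 : s.isUnary
      · rcases hws with _ | @⟨j, w', st, ws, hj, hws⟩
        · simp [h1, h2] at hlen
        refine ⟨(s :: (w ++ w')) :: ws, by simp, .cons (generates_binary h1 h2 hok hi hj) ?_⟩
        simpa [remaining, h1, h2] using hws
      · refine ⟨(s :: w) :: ws, by simp, .cons (generates_unary h2 hok hi) ?_⟩
        simpa [remaining, h1, h2] using hws
    · refine ⟨[s] :: ws, by simp, .cons (generates_nullary h1) ?_⟩
      simpa [remaining, h1] using hws

theorem exists_encPair_of_isPair (c : SExp) (w : List Sym) (h : isPair (eval c w) = true) :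
    ∃ p q : LPath, w = encPair p q := by
  generalize hr : eval c w = r at h
  obtain ⟨st, b⟩ := r
  simp only [isPair, Bool.and_eq_true, decide_eq_true_eq] at h
  obtain ⟨rfl, ⟨h1, h2⟩, h3, h4⟩ := h
  obtain ⟨ws, rfl, hws⟩ := exists_generates c w st hr
  rcases hws with _ | @⟨i, w, st, ws, hi, hws⟩
  · simp at h2
  rcases hws with _ | @⟨j, w', st, ws, hj, hws⟩
  · simp at h2
  rcases hws with _ | _
  swap
  · simp at h1
  simp only [List.headD_cons, List.tail_cons] at h3 h4
  rw [h3] at hi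
  rw [h4] at hj
  obtain ⟨p, rfl⟩ := hi
  obtain ⟨q, rfl⟩ := hj
  exact ⟨p, q, by simp [encPair]⟩


/-! ### From certificates to trees -/

theorem SExp.word_injective : Function.Injective SExp.word := by
  intro a b h
  have h1 := parseStack_word_append a []
  rw [h, parseStack_word_append b []] at h1
  exact (List.cons.inj h1).1.symm

instance : Countable SExp := SExp.word_injective.countable

section
variable {c : SExp}

theorem closed_iff : closed c = true ↔
    ∀ v ∈ verts c, v ≠ [] ∧ (v.tail = [] ∨ v.tail ∈ verts c) := by
  simp [closed]

/-- The children of a vertex. -/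
def children (c : SExp) (u : CVert) : List CVert :=
  ((verts c).filter fun v => decide (v.tail = u)).dedup

theorem mem_children {u v : CVert} : v ∈ children c u ↔ v ∈ verts c ∧ v.tail = u := by
  simp [children]

/-- The vertex at a given address below the root `r`. -/
def node (c : SExp) (r : CVert) (a : Vertex) : Option CVert :=
  a.foldl (fun o i => o.bind fun u => (children c u)[i]?) (some r)

variable {r : CVert}

theorem node_append_singleton (a : Vertex) (i : ℕ) :
    node c r (a ++ [i]) = (node c r a).bind fun u => (children c u)[i]? := by
  simp [node]

theorem node_append_singleton_eq_some {a : Vertex} {i : ℕ} {v : CVert} :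
    node c r (a ++ [i]) = some v ↔ ∃ u, node c r a = some u ∧ (children c u)[i]? = some v := by
  rw [node_append_singleton, Option.bind_eq_some_iff]

theorem exists_node_of_append {a w : Vertex} {v : CVert} (h : node c r (a ++ w) = some v) :
    ∃ u, node c r a = some u := by
  induction w using List.reverseRecOn generalizing v with
  | nil => exact ⟨v, by simpa using h⟩
  | append_singleton w i ih =>
    rw [← List.append_assoc, node_append_singleton_eq_some] at h
    obtain ⟨u, hu, _⟩ := h
    exact ih hu

theorem node_mem (hr : r ∈ verts c) {a : Vertex} {v : CVert} (h : node c r a = some v) :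
    v ∈ verts c := by
  induction a using List.reverseRecOn with
  | nil => obtain rfl : r = v := by simpa [node] using h
           exact hr
  | append_singleton a i ih =>
    rw [node_append_singleton_eq_some] at h
    obtain ⟨u, _, hu⟩ := h
    exact (mem_children.1 (List.mem_of_getElem? hu)).1

/-- Going down one level puts one record in front of the vertex; closedness excludes the empty list,
whose tail would be itself. -/
theorem node_append (hc : closed c = true) {a w : Vertex} {u v : CVert}
    (hu : node c r a = some u) (h : node c r (a ++ w) = some v) :
    ∃ l : CVert, l.length = w.length ∧ v = l ++ u := by
  induction w using List.reverseRecOn generalizing v with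
  | nil =>
    rw [List.append_nil, hu] at h
    exact ⟨[], rfl, by simpa using h.symm⟩
  | append_singleton w i ih =>
    rw [← List.append_assoc, node_append_singleton_eq_some] at h
    obtain ⟨x, hx, hv⟩ := h
    obtain ⟨l, hl, rfl⟩ := ih hx
    obtain ⟨hv1, hv2⟩ := mem_children.1 (List.mem_of_getElem? hv)
    rcases v with _ | ⟨y, v⟩
    · exact absurd rfl (closed_iff.1 hc _ hv1).1
    · exact ⟨y :: l, by simp [hl], by simpa using hv2⟩

/-- A vertex contains its whole branch. So two addresses of it have the same length, their parents
are the common tail, and the last position is unique because lists of children have no duplicates.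
-/
theorem node_injective (hc : closed c = true) {a b : Vertex} {u : CVert}
    (ha : node c r a = some u) (hb : node c r b = some u) : a = b := by
  have hlen : a.length = b.length := by
    obtain ⟨l, hl, h⟩ := node_append hc (a := []) (w := a) rfl ha
    obtain ⟨l', hl', h'⟩ := node_append hc (a := []) (w := b) rfl hb
    rw [← hl, ← hl', List.append_cancel_right (h.symm.trans h')]
  induction a using List.reverseRecOn generalizing b u with
  | nil => exact (List.length_eq_zero_iff.1 hlen.symm).symm
  | append_singleton a i ih =>
    rcases List.eq_nil_or_concat b with rfl | ⟨b, j, rfl⟩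
    · simp at hlen
    rw [List.concat_eq_append] at hb hlen ⊢
    rw [node_append_singleton_eq_some] at ha hb
    obtain ⟨x, hx, ha⟩ := ha
    obtain ⟨y, hy, hb⟩ := hb
    obtain rfl : x = y := by
      rw [← (mem_children.1 (List.mem_of_getElem? ha)).2,
        ← (mem_children.1 (List.mem_of_getElem? hb)).2]
    rw [ih hx hy (by simpa using hlen)]
    have hi := (List.getElem?_eq_some_iff.1 ha).1
    rw [(List.getElem?_inj hi (List.nodup_dedup _)).1 (ha.trans hb.symm)]

/-- By closedness the suffixes of `l ++ u` that extend `u` all belong to the certificate, and they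
lead down to it one child at a time. -/
theorem exists_node (hc : closed c = true) (hr : r ∈ verts c) {a : Vertex} {u : CVert}
    (hu : node c r a = some u) (l : CVert) (hl : l ++ u ∈ verts c) :
    ∃ w : Vertex, w.length = l.length ∧ node c r (a ++ w) = some (l ++ u) := by
  induction l with
  | nil => exact ⟨[], rfl, by simpa using hu⟩
  | cons x l ih =>
    have hne : u ≠ [] := (closed_iff.1 hc u (node_mem hr hu)).1
    obtain ⟨w, hw, h⟩ := ih (by
      rcases (closed_iff.1 hc _ hl).2 with h | h
      · simp [hne] at h
      · exact h)
    obtain ⟨i, hi⟩ := List.mem_iff_getElem?.1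
      (mem_children (c := c).2 ⟨hl, show (x :: l ++ u).tail = l ++ u from rfl⟩)
    refine ⟨w ++ [i], by simp [hw], ?_⟩
    rw [← List.append_assoc, node_append_singleton_eq_some]
    exact ⟨_, h, hi⟩

theorem finite_node (hc : closed c = true) (hr : r ∈ verts c) :
    {a : Vertex | ∃ u, node c r a = some u}.Finite := by
  refine Set.Finite.of_injOn (f := node c r) (t := some '' {v | v ∈ verts c}) ?_ ?_
    ((List.finite_toSet (verts c)).image _)
  · rintro a ⟨u, hu⟩
    exact ⟨u, node_mem hr hu, hu.symm⟩
  · rintro a ⟨u, hu⟩ b _ h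
    exact node_injective hc hu (h ▸ hu)

theorem lookup_ne_nil {l : List SExp} {k : Name} (h : lookup l k ≠ []) :
    enc k ∈ l.map SExp.car := by
  simp only [lookup, ne_eq, List.map_eq_nil_iff, List.filter_eq_nil_iff, decide_eq_true_eq,
    not_forall, not_not] at h
  obtain ⟨e, he, h⟩ := h
  exact List.mem_map.2 ⟨e, he, h⟩

variable {D : Type*}

/-- The tree described by a certificate. -/
noncomputable def toTree (hc : closed c = true) (hr : r ∈ verts c) (ι : SExp → D) : XMLTree D where
  dom := (finite_node hc hr).toFinset
  root_mem := by simp [node]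
  parent_mem v i h := by
    simp only [Set.Finite.mem_toFinset, Set.mem_ofPred_eq] at h ⊢
    obtain ⟨u, hu⟩ := h
    exact exists_node_of_append hu
  sibling_mem v i h := by
    simp only [Set.Finite.mem_toFinset, Set.mem_ofPred_eq] at h ⊢
    obtain ⟨u, hu⟩ := h
    rw [node_append_singleton_eq_some] at hu
    obtain ⟨x, hx, hu⟩ := hu
    have hi := (List.getElem?_eq_some_iff.1 hu).1
    exact ⟨_, node_append_singleton_eq_some.2 ⟨x, hx,
      List.getElem?_eq_getElem (show i < (children c x).length by omega)⟩⟩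
  lab v := labelOf ((node c r v).getD [])
  attr v a := (attrOf ((node c r v).getD []) a).head?.map ι
  finite_attr := by
    refine Set.Finite.subset (s := ⋃ v ∈ {v | v ∈ verts c},
      {a | enc a ∈ (v.headD .nil).cdr.toList.map SExp.car}) ?_ ?_
    · refine Set.Finite.biUnion (List.finite_toSet _) fun v _ => ?_
      exact Set.Finite.preimage (f := (enc : Name → SExp)) inj.injOn (List.finite_toSet _)
    · rintro a ⟨v, hv, h⟩
      simp only [Set.Finite.mem_toFinset, Set.mem_ofPred_eq] at hv
      obtain ⟨u, hu⟩ := hv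
      rw [Set.mem_iUnion₂]
      refine ⟨u, node_mem hr hu, lookup_ne_nil fun h' => h ?_⟩
      rw [hu, Option.getD_some, attrOf, h']
      rfl

/-- Any vertex `r` can be the root, because no axis leads upwards. Injectivity of `ι` preserves
equality and inequality of the stored values. -/
theorem boundedMorphism_toTree (hc : closed c = true) (hr : r ∈ verts c) {ι : SExp → D}
    (hι : Function.Injective ι) :
    BoundedMorphism ((toTree hc hr ι).model fun x => ι (varOf c x)) (cmodel c)
      (fun v => ∃ u, node c r v = some u) (fun v => (node c r v).getD []) where
  closed a u v h := by simpa [XMLTree.model, Axis.Rel, toTree] using h.2.1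
  forth a u v h := by
    obtain ⟨h1, h2, h3⟩ := h
    simp only [toTree, Set.Finite.mem_toFinset, Set.mem_ofPred_eq] at h1 h2
    obtain ⟨u', hu⟩ := h1
    obtain ⟨v', hv⟩ := h2
    simp only [hu, hv, Option.getD_some]
    refine ⟨node_mem hr hu, node_mem hr hv, ?_⟩
    cases a with
    | self =>
      dsimp only at h3
      subst h3
      rw [hu] at hv
      exact (Option.some.inj hv).symm
    | child =>
      obtain ⟨i, rfl⟩ := h3
      rw [node_append_singleton_eq_some] at hv
      obtain ⟨x, hx, hv⟩ := hv
      obtain rfl : u' = x := Option.some.inj (hu.symm.trans hx)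
      exact (mem_children.1 (List.mem_of_getElem? hv)).2
    | descendant =>
      obtain ⟨w, hw, rfl⟩ := h3
      obtain ⟨l, hl, h⟩ := node_append hc hu hv
      refine ⟨l, ?_, h⟩
      rintro rfl
      exact hw (List.length_eq_zero_iff.1 hl.symm)
  back a u v' := by
    rintro ⟨u', hu⟩ h
    simp only [hu, Option.getD_some] at h
    obtain ⟨h1, h2, h3⟩ := h
    have key : ∀ v, node c r v = some v' →
        (∀ (h : u ∈ (toTree hc hr ι).dom) (h' : v ∈ (toTree hc hr ι).dom),
          Axis.Rel (toTree hc hr ι) a u v) →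
        ∃ v, ((toTree hc hr ι).model fun x => ι (varOf c x)).rel a u v ∧
          (node c r v).getD [] = v' := by
      intro v hv h
      exact ⟨v, h (by simp [toTree, hu]) (by simp [toTree, hv]), by rw [hv]; rfl⟩
    cases a with
    | self =>
      refine key u ?_ fun h h' => ⟨h, h', rfl⟩
      rw [hu]
      exact congrArg some h3.symm
    | child =>
      obtain ⟨i, hi⟩ := List.mem_iff_getElem?.1 (mem_children.2 ⟨h2, h3⟩)
      exact key (u ++ [i]) (node_append_singleton_eq_some.2 ⟨u', hu, hi⟩)
        fun h h' => ⟨h, h', i, rfl⟩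
    | descendant =>
      obtain ⟨l, hl, rfl⟩ := h3
      obtain ⟨w, hw, h⟩ := exists_node hc hr hu l h2
      refine key (u ++ w) h fun h h' => ⟨h, h', w, ?_, rfl⟩
      rintro rfl
      exact hl (List.length_eq_zero_iff.1 hw.symm)
  lab v s _ := Iff.rfl
  eqA x a v _ := by
    simp only [XMLTree.model, toTree, cmodel]
    rcases attrOf ((node c r v).getD []) a with _ | ⟨d, l⟩
    · simp
    · simp [hι.eq_iff]
  neA x a v _ := by
    simp only [XMLTree.model, toTree, cmodel]
    rcases attrOf ((node c r v).getD []) a with _ | ⟨d, l⟩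
    · simp
    · simp [hι.eq_iff, eq_comm]

end

/-- A certificate for a counterexample refutes containment. -/
theorem not_contained_of_isCex (D : Type*) [Infinite D] (p q : LPath) (c : SExp)
    (h : isCex (encPair p q) c = true) : ¬Contained D p q := by
  obtain ⟨hc, ⟨v, hv⟩, hq⟩ := (isCex_encPair c p q).1 h
  have hr := (mem_of_mSem c p _ v hv).1
  -- The infinity of `D` is needed here: there are countably many trees, so distinct values of the
  -- certificate get distinct values in `D`.
  obtain ⟨g, hg⟩ := exists_injective_nat SExp
  have hι : Function.Injective (fun x => Infinite.natEmbedding D (g x)) :=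
    (Infinite.natEmbedding D).injective.comp hg
  have hb := boundedMorphism_toTree hc hr hι
  intro hcon
  have key : ∀ p : LPath, Matches (toTree hc hr fun x => Infinite.natEmbedding D (g x))
      (fun x => Infinite.natEmbedding D (g (varOf c x))) p ↔
        ∃ v, p.MSem (cmodel c) (croot c) v := by
    intro p
    rw [Matches]
    simp only [← LPath.mSem_model]
    exact hb.exists_mSem p [] ⟨_, rfl⟩
  exact hq ((key q).1 (hcon _ _ ((key p).2 ⟨v, hv⟩)))


/-! ### Small certificates -/

section
variable (W : List Vertex) (M : ℕ)

/-- The depth of the closest proper ancestor in `W`. -/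
def up (w : Vertex) : ℕ := Nat.findGreatest (fun k => w.take k ∈ W) (w.length - 1)

/-- The number of vertices strictly between `w` and its closest proper ancestor in `W` that are
kept. -/
def kept (w : Vertex) : ℕ := min (w.length - up W w - 1) M

theorem up_lt {w : Vertex} (hw : w ≠ []) : up W w < w.length := by
  have h1 := Nat.findGreatest_le (P := fun k => w.take k ∈ W) (w.length - 1)
  have h2 := List.length_pos_iff.2 hw
  unfold up
  omega

/-- The branch of the truncated tree that leads from `w` to the root. Its vertices are `(w, j)`,
the `j`-th vertex above `w`. -/
def chain (w : Vertex) : List (Vertex × ℕ) :=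
  (List.range (kept W M w + 1)).map (fun j => (w, j)) ++
    if _h : w = [] then [] else chain (w.take (up W w))
termination_by w.length
decreasing_by
  have := up_lt W _h
  simp; omega

variable {W M}

theorem take_up_mem (h0 : [] ∈ W) (w : Vertex) : w.take (up W w) ∈ W := by
  refine Nat.findGreatest_spec (P := fun k => w.take k ∈ W) (Nat.zero_le _) ?_
  simpa using h0

theorem le_up {w : Vertex} {k : ℕ} (hk : k < w.length) (h : w.take k ∈ W) : k ≤ up W w :=
  Nat.le_findGreatest (P := fun k => w.take k ∈ W) (by omega) h

theorem length_take_up {w : Vertex} (hw : w ≠ []) : (w.take (up W w)).length = up W w := by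
  have := up_lt W hw
  simp; omega

theorem kept_le (w : Vertex) : kept W M w ≤ M := min_le_right _ _

theorem kept_add_lt {w : Vertex} (hw : w ≠ []) : up W w + kept W M w + 1 ≤ w.length := by
  have h1 := up_lt W hw
  have h2 : kept W M w ≤ w.length - up W w - 1 := min_le_left _ _
  omega

theorem kept_nil : kept W M [] = 0 := by simp [kept]

theorem chain_of_ne_nil {w : Vertex} (hw : w ≠ []) : chain W M w =
    (List.range (kept W M w + 1)).map (fun j => (w, j)) ++ chain W M (w.take (up W w)) := by
  rw [chain]
  simp [hw]

theorem chain_nil : chain W M [] = [([], 0)] := by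
  rw [chain]
  simp [kept_nil]

theorem kept_lt_length_chain (w : Vertex) : kept W M w < (chain W M w).length := by
  rw [chain]
  simp; omega

theorem drop_chain_of_lt {w : Vertex} {j : ℕ} (hj : j < kept W M w) :
    (chain W M w).drop j = (w, j) :: (chain W M w).drop (j + 1) := by
  rw [List.drop_eq_getElem_cons (by have := kept_lt_length_chain (W := W) (M := M) w; omega)]
  congr 1
  rw [List.getElem_eq_iff, chain, List.getElem?_append_left (by simp; omega)]
  simp [show j < kept W M w + 1 by omega]

theorem drop_chain_kept {w : Vertex} (hw : w ≠ []) :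
    (chain W M w).drop (kept W M w) = (w, kept W M w) :: chain W M (w.take (up W w)) := by
  rw [chain_of_ne_nil hw, List.range_succ, List.map_append, List.append_assoc,
    List.drop_left' (by simp)]
  rfl

theorem chain_eq_cons (w : Vertex) : ∃ l, chain W M w = (w, 0) :: l := by
  rw [chain, List.range_succ_eq_map]
  exact ⟨_, rfl⟩

theorem exists_drop_chain {w : Vertex} {j : ℕ} (hj : j ≤ kept W M w) :
    ∃ l, (chain W M w).drop j = (w, j) :: l := by
  rcases hj.lt_or_eq with hj | rfl
  · exact ⟨_, drop_chain_of_lt hj⟩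
  · by_cases hw : w = []
    · subst hw
      rw [kept_nil]
      exact chain_eq_cons []
    · exact ⟨_, drop_chain_kept hw⟩

/-- Beyond its first `kept W M w + 1` entries, the branch of `w` is the branch of the closest proper
ancestor in `W`. Hence a vertex of the truncated tree is determined by the first entry of its
branch. -/
theorem exists_eq_drop_chain (h0 : [] ∈ W) {w : Vertex} (hw : w ∈ W) {k : ℕ}
    (hk : k < (chain W M w).length) : ∃ w' ∈ W, ∃ j ≤ kept W M w',
      (chain W M w).drop k = (chain W M w').drop j := by
  by_cases hk' : k ≤ kept W M w
  · exact ⟨w, hw, k, hk', rfl⟩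
  by_cases hn : w = []
  · subst hn
    rw [chain_nil] at hk
    simp only [List.length_singleton] at hk
    omega
  have hlen := length_take_up (W := W) hn
  have hup := up_lt W hn
  have h1 : (chain W M w).length = kept W M w + 1 + (chain W M (w.take (up W w))).length := by
    rw [chain_of_ne_nil hn]; simp
  obtain ⟨w', hw', j, hj, h⟩ := exists_eq_drop_chain h0 (take_up_mem h0 w)
    (k := k - (kept W M w + 1)) (by omega)
  refine ⟨w', hw', j, hj, ?_⟩
  rw [← h, chain_of_ne_nil hn, List.drop_append, List.drop_of_length_le (by simp; omega)]
  simp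
termination_by w.length

theorem length_le_of_mem_chain {w : Vertex} {x : Vertex × ℕ} (hx : x ∈ chain W M w) :
    x.1.length ≤ w.length := by
  by_cases hn : w = []
  · subst hn
    rw [chain_nil] at hx
    simp_all
  rw [chain_of_ne_nil hn, List.mem_append] at hx
  have hlen := length_take_up (W := W) hn
  have hup := up_lt W hn
  rcases hx with hx | hx
  · simp only [List.mem_map] at hx
    obtain ⟨j, _, rfl⟩ := hx
    exact le_rfl
  · have := length_le_of_mem_chain hx
    omega
termination_by w.length

theorem nodup_chain (w : Vertex) : (chain W M w).Nodup := by
  have h1 : ((List.range (kept W M w + 1)).map (fun j => (w, j))).Nodup :=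
    (List.nodup_range).map fun a b h => (Prod.ext_iff.1 h).2
  by_cases hn : w = []
  · subst hn
    rw [chain_nil]
    simp
  have hlen := length_take_up (W := W) hn
  have hup := up_lt W hn
  rw [chain_of_ne_nil hn]
  refine h1.append (nodup_chain _) ?_
  intro x hx hx'
  have := length_le_of_mem_chain hx'
  obtain ⟨j, _, rfl⟩ := List.mem_map.1 hx
  simp only at this
  omega
termination_by w.length

theorem mem_chain (h0 : [] ∈ W) {w : Vertex} (hw : w ∈ W) {x : Vertex × ℕ}
    (hx : x ∈ chain W M w) : x.1 ∈ W ∧ x.2 ≤ M := by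
  obtain ⟨k, hk, rfl⟩ := List.mem_iff_getElem.1 hx
  obtain ⟨w', hw', j, hj, h⟩ := exists_eq_drop_chain h0 hw hk
  obtain ⟨l, hl⟩ := exists_drop_chain hj
  rw [hl, List.drop_eq_getElem_cons hk] at h
  rw [(List.cons.inj h).1]
  exact ⟨hw', hj.trans (kept_le w')⟩

/-- The entries are distinct elements of `W × {0, …, M}`, whatever the depth of the original tree.
-/
theorem length_chain_le (h0 : [] ∈ W) {w : Vertex} (hw : w ∈ W) :
    (chain W M w).length ≤ W.length * (M + 1) := by
  have h : chain W M w ⊆ W ×ˢ List.range (M + 1) := by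
    rintro ⟨w', j⟩ hx
    have := mem_chain h0 hw hx
    rw [List.mem_product, List.mem_range]
    exact ⟨this.1, by omega⟩
  refine ((nodup_chain w).subperm h).length_le.trans_eq ?_
  rw [List.length_product, List.length_range]

/-- Prefixes in `W` correspond to suffixes of branches. -/
theorem exists_chain_eq_append (h0 : [] ∈ W) {x y : Vertex} (hx : x ∈ W) (hxy : x <+: y)
    (hne : x.length < y.length) : ∃ l, l ≠ [] ∧ chain W M y = l ++ chain W M x := by
  have hn : y ≠ [] := by rintro rfl; simp at hne
  have hlen := length_take_up (W := W) hn
  have hup := up_lt W hn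
  have hle : x.length ≤ up W y := le_up hne (by rwa [← List.prefix_iff_eq_take.1 hxy])
  rw [chain_of_ne_nil hn]
  have hpre : x <+: y.take (up W y) := List.prefix_take_iff.2 ⟨hxy, hle⟩
  rcases hle.lt_or_eq with hlt | heq
  · obtain ⟨l, hl, h⟩ := exists_chain_eq_append h0 (y := y.take (up W y)) hx hpre (by omega)
    exact ⟨_ ++ l, by simp [hl], by rw [h, List.append_assoc]⟩
  · rw [← hpre.eq_of_length (by omega)]
    exact ⟨_, by simp, rfl⟩
termination_by y.length

/-- No vertex lies strictly between a member of `W` and its child, so nothing is inserted there.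
This is why child steps survive truncation. -/
theorem chain_concat {x : Vertex} {i : ℕ} (hx : x ∈ W) :
    chain W M (x ++ [i]) = (x ++ [i], 0) :: chain W M x := by
  have hn : x ++ [i] ≠ [] := by simp
  have h1 : x.length ≤ up W (x ++ [i]) := le_up (by simp) (by simpa using hx)
  have h2 := kept_add_lt (W := W) (M := M) hn
  have h3 : up W (x ++ [i]) = x.length := by simp at h2; omega
  have h4 : kept W M (x ++ [i]) = 0 := by simp at h2; omega
  rw [chain_of_ne_nil hn, h3, h4]
  simp

/-! ### From the truncated tree back to the tree -/

variable (W M) in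
/-- The vertex of the tree that corresponds to `(w, j)`, if the vertices of the branch above `w`
are placed above the gap at `J w` and below it. -/
def place (J : Vertex → ℕ) (x : Vertex × ℕ) : Vertex :=
  if x.2 < J x.1 then x.1.take (x.1.length - x.2)
  else x.1.take (up W x.1 + 1 + kept W M x.1 - x.2)

theorem exists_take_succ {w : Vertex} {k : ℕ} (hk : k < w.length) :
    ∃ i, w.take (k + 1) = w.take k ++ [i] :=
  ⟨w[k], by rw [List.take_append_getElem]⟩

/-- The gaps are in the branches, and there is one in every shortened branch. -/
def IsGap (W : List Vertex) (M : ℕ) (J : Vertex → ℕ) : Prop :=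
  ∀ w ∈ W, J w ≤ kept W M w ∧ (J w = 0 → kept W M w = w.length - up W w - 1)

variable {J : Vertex → ℕ}

/-- If `J w = 0`, the formula for the upper part applies even to `w`. It still returns `w`, because
`IsGap` allows the value 0 only if nothing was removed above `w`. -/
theorem place_zero (hJ : IsGap W M J) {w : Vertex} (hw : w ∈ W) : place W M J (w, 0) = w := by
  by_cases hn : w = []
  · subst hn
    simp [place]
  have h1 := up_lt W hn
  obtain ⟨h2, h3⟩ := hJ w hw
  unfold place
  split_ifs with h
  · simp
  · rw [h3 (by simpa using h)]
    exact List.take_of_length_le (by simp only; omega)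

theorem place_prefix (x : Vertex × ℕ) : place W M J x <+: x.1 := by
  unfold place
  split_ifs <;> exact List.take_prefix _ _

/-- The lower part of a branch is placed without holes ending at `w`, the upper part without holes
starting just below the closest ancestor in `W`. Consecutive entries remain parent and child unless
the upper one is `(w, J w)` with `J w ≠ 0`. There at least the order survives, since the original
stretch is no shorter than the kept one. -/
theorem place_step (h0 : [] ∈ W) (hJ : IsGap W M J) {w : Vertex} (hw : w ∈ W) {k : ℕ}
    {x y : Vertex × ℕ} {l : List (Vertex × ℕ)} (h : (chain W M w).drop k = x :: y :: l) :
    (place W M J y <+: place W M J x ∧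
      (place W M J y).length < (place W M J x).length) ∧
    ((y.2 = J y.1 → y.2 = 0) →
      ∃ i, place W M J x = place W M J y ++ [i]) := by
  have hk : k < (chain W M w).length := by
    by_contra hk
    rw [List.drop_of_length_le (by omega)] at h
    simp at h
  obtain ⟨w, hw, j, hj, hd⟩ := exists_eq_drop_chain h0 hw hk
  rw [h] at hd
  clear h hk
  by_cases hn : w = []
  · subst hn
    obtain rfl : j = 0 := by simpa [kept_nil] using hj
    rw [chain_nil] at hd
    simp at hd
  have h1 := kept_add_lt (W := W) (M := M) hn
  obtain ⟨h2, h3⟩ := hJ w hw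
  rcases hj.lt_or_eq with hj | rfl
  · obtain ⟨l', hl'⟩ := exists_drop_chain (W := W) (M := M) (w := w) (j := j + 1) hj
    rw [drop_chain_of_lt hj, hl'] at hd
    simp only [List.cons.injEq] at hd
    obtain ⟨rfl, rfl, -⟩ := hd
    have h4 : place W M J (w, j) = w.take (if j < J w then w.length - j
      else up W w + 1 + kept W M w - j) := by
      unfold place; split_ifs <;> rfl
    have h5 : place W M J (w, j + 1) = w.take (if j + 1 < J w then
      w.length - (j + 1) else up W w + 1 + kept W M w - (j + 1)) := by
      unfold place; split_ifs <;> rfl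
    rw [h4, h5]
    constructor
    · have : (if j + 1 < J w then w.length - (j + 1) else up W w + 1 + kept W M w - (j + 1)) <
          if j < J w then w.length - j else up W w + 1 + kept W M w - j := by
        split_ifs <;> omega
      have h6 : (if j < J w then w.length - j else up W w + 1 + kept W M w - j) ≤ w.length := by
        split_ifs <;> omega
      refine ⟨List.take_prefix_take_left this.le, ?_⟩
      rw [List.length_take, List.length_take]
      omega
    · intro h6
      have h7 : j + 1 ≠ J w := fun h => absurd (h6 h) (by simp)
      have : (if j < J w then w.length - j else up W w + 1 + kept W M w - j) =
          (if j + 1 < J w then w.length - (j + 1) else up W w + 1 + kept W M w - (j + 1)) + 1 := by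
        split_ifs <;> omega
      rw [this]
      refine exists_take_succ ?_
      split_ifs <;> omega
  · rw [drop_chain_kept hn] at hd
    obtain ⟨l', hl'⟩ := chain_eq_cons (W := W) (M := M) (w.take (up W w))
    rw [hl'] at hd
    simp only [List.cons.injEq] at hd
    obtain ⟨rfl, rfl, -⟩ := hd
    rw [place_zero hJ (take_up_mem h0 w)]
    have h4 : place W M J (w, kept W M w) = w.take (up W w + 1) := by
      unfold place
      rw [if_neg (by simp only; omega)]
      simp only
      congr 1
      omega
    rw [h4]
    have h5 := up_lt W hn
    obtain ⟨i, hi⟩ := exists_take_succ h5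
    rw [hi]
    exact ⟨⟨List.prefix_append _ _, by simp⟩, fun _ => ⟨i, rfl⟩⟩

theorem place_append (h0 : [] ∈ W) (hJ : IsGap W M J) {w : Vertex} (hw : w ∈ W) {k : ℕ}
    {x y : Vertex × ℕ} {l l' : List (Vertex × ℕ)}
    (h : (chain W M w).drop k = x :: (l ++ y :: l')) :
    place W M J y <+: place W M J x ∧
      (place W M J y).length < (place W M J x).length := by
  induction l generalizing x k with
  | nil => exact (place_step h0 hJ hw h).1
  | cons z l ih =>
    obtain ⟨h1, h2⟩ := (place_step h0 hJ hw h).1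
    obtain ⟨h3, h4⟩ := ih (k := k + 1) (x := z) (by rw [← List.tail_drop, h]; rfl)
    exact ⟨h3.trans h1, h4.trans h2⟩

end

/-! ### The certificate of a tree -/

theorem mem_lookup_filterMap {N : List Name} {f : Name → Option SExp} {a : Name} {e : SExp} :
    e ∈ lookup (N.filterMap fun b => (f b).map (SExp.cons (enc b))) a ↔ a ∈ N ∧ f a = some e := by
  simp only [lookup, List.mem_map, List.mem_filter, List.mem_filterMap, Option.map_eq_some_iff,
    decide_eq_true_eq]
  constructor
  · rintro ⟨_, ⟨⟨b, hb, d, hd, rfl⟩, h⟩, rfl⟩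
    obtain rfl := inj h
    exact ⟨hb, hd⟩
  · rintro ⟨ha, h⟩
    exact ⟨_, ⟨⟨a, ha, e, h, rfl⟩, rfl⟩, rfl⟩

/-- A name may occur repeatedly in `N`, but all its entries carry the same value, so reading the
first one is correct. -/
theorem lookup_filterMap {N : List Name} {f : Name → Option SExp} {a : Name} {e : SExp}
    (ha : a ∈ N) : (lookup (N.filterMap fun b => (f b).map (SExp.cons (enc b))) a ≠ [] ∧
      (lookup (N.filterMap fun b => (f b).map (SExp.cons (enc b))) a).headD .nil = e) ↔
      f a = some e := by
  constructor
  · rintro ⟨h1, rfl⟩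
    obtain ⟨e, l, h⟩ := List.exists_cons_of_ne_nil h1
    rw [h]
    exact (mem_lookup_filterMap.1 (h ▸ List.mem_cons_self)).2
  · intro h
    have h1 := mem_lookup_filterMap.2 ⟨ha, h⟩
    obtain ⟨e', l, h2⟩ := List.exists_cons_of_ne_nil (List.ne_nil_of_mem h1)
    rw [h2]
    have h3 := (mem_lookup_filterMap.1 (h2 ▸ List.mem_cons_self)).2
    exact ⟨by simp, Option.some.inj (h3.symm.trans h)⟩

theorem toList_enc_list {α : Type} [Coded α] (l : List α) : (enc l).toList = l.map enc := by
  induction l with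
  | nil => rfl
  | cons a l ih => simp [SExp.toList, ih]

section
open Classical in
/-- A data value is represented by the variables that have this value. -/
noncomputable def valueCode {D : Type*} (ρ : Name → D) (N : List Name) (d : D) : SExp :=
  enc (N.filter fun x => decide (ρ x = d))

/-- The code of `ρ x` contains `x`, so any value with the same code equals `ρ x`. Values that no
variable in `N` has share the empty code, which comparisons with variables in `N` cannot detect. -/
theorem valueCode_inj {D : Type*} {ρ : Name → D} {N : List Name} {x : Name} (hx : x ∈ N) {d : D} :
    valueCode ρ N (ρ x) = valueCode ρ N d ↔ ρ x = d := by
  refine ⟨fun h => ?_, fun h => by rw [h]⟩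
  have h := inj h
  have h1 : x ∈ N.filter fun y => @decide (ρ y = ρ x) (Classical.propDecidable _) := by simp [hx]
  rw [h] at h1
  simpa [hx] using h1

variable {D : Type*} (t : XMLTree D) (ρ : Name → D) (N : List Name) (n M : ℕ) (W : List Vertex)

/-- The record of a vertex of the truncated tree. -/
noncomputable def record (x : Vertex × ℕ) : SExp :=
  .cons (.cons (.cons (unary (W.idxOf x.1)) (unary x.2))
      (enc (if x.2 = 0 then (t.lab x.1).take (n + 1) else List.replicate (n + 1) true)))
    (enc (if x.2 = 0 then
      N.filterMap fun a => ((t.attr x.1 a).map (valueCode ρ N)).map (SExp.cons (enc a)) else []))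

/-- The certificate for the tree truncated to the branches that lead to `W`. -/
noncomputable def cert : SExp :=
  -- The root comes first because `croot` reads the first vertex.
  .cons (enc ([record t ρ N n W ([], 0)] :: W.flatMap fun w =>
      (List.range (chain W M w).length).map fun k => ((chain W M w).drop k).map (record t ρ N n W)))
    (enc (N.filterMap fun x => (some (valueCode ρ N (ρ x))).map (SExp.cons (enc x))))

variable {t ρ N n M W}

/-- Records begin with the position of the vertex in `W` and its index, which keeps vertices with
equal labels and attributes apart. One membership suffices, as `idxOf` separates members of `W` from
everything else. -/
theorem record_inj {x y : Vertex × ℕ} (hx : x.1 ∈ W)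
    (h : record t ρ N n W x = record t ρ N n W y) : x = y := by
  simp only [record, SExp.cons.injEq] at h
  exact Prod.ext ((List.idxOf_inj hx).1 (unary_injective h.1.1.1)) (unary_injective h.1.1.2)

theorem verts_cert : verts (cert t ρ N n M W) = [record t ρ N n W ([], 0)] :: W.flatMap fun w =>
      (List.range (chain W M w).length).map fun k =>
        ((chain W M w).drop k).map (record t ρ N n W) := by
  rw [verts, cert, SExp.car, toList_enc_list, List.map_map]
  exact List.map_id'' (fun l => SExp.toList_enc l) _

theorem mem_verts_cert (h0 : [] ∈ W) {v : CVert} : v ∈ verts (cert t ρ N n M W) ↔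
    ∃ w ∈ W, ∃ k < (chain W M w).length, ((chain W M w).drop k).map (record t ρ N n W) = v := by
  have : v ∈ verts (cert t ρ N n M W) ↔ v = [record t ρ N n W ([], 0)] ∨
    ∃ w ∈ W, ∃ k < (chain W M w).length, ((chain W M w).drop k).map (record t ρ N n W) = v := by
    simp [verts_cert]
  rw [this, or_iff_right_iff_imp]
  rintro rfl
  exact ⟨[], h0, 0, by simp [chain_nil], by simp [chain_nil]⟩

theorem croot_cert : croot (cert t ρ N n M W) = (chain W M []).map (record t ρ N n W) := by
  rw [croot, verts_cert, chain_nil]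
  rfl

theorem closed_cert (h0 : [] ∈ W) : closed (cert t ρ N n M W) = true := by
  rw [closed_iff]
  intro v hv
  obtain ⟨w, hw, k, hk, rfl⟩ := (mem_verts_cert h0).1 hv
  refine ⟨by simp; omega, ?_⟩
  by_cases hk' : k + 1 < (chain W M w).length
  · exact .inr ((mem_verts_cert h0).2 ⟨w, hw, k + 1, hk', by simp [List.tail_drop]⟩)
  · exact .inl (by simp; omega)

theorem labelOf_cons (x : Vertex × ℕ) (l : CVert) : labelOf (record t ρ N n W x :: l) =
    if x.2 = 0 then (t.lab x.1).take (n + 1) else List.replicate (n + 1) true := by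
  rw [labelOf, record, List.headD_cons, SExp.car, SExp.cdr, toList_enc_list, List.map_map]
  refine List.map_id'' (fun b => ?_) _
  cases b <;> rfl

/-- Labels are cut after `n + 1` letters to keep the certificate small. A name of at most `n`
letters does not notice this, and it differs from the `n + 1` letters of a neutral vertex. -/
theorem labelOf_cons_eq {x : Vertex × ℕ} {l : CVert} {s : Name} (hs : s.length ≤ n) :
    labelOf (record t ρ N n W x :: l) = s ↔ x.2 = 0 ∧ t.lab x.1 = s := by
  rw [labelOf_cons]
  split_ifs with h
  · simp only [h, true_and]
    constructor
    · rintro rfl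
      rw [List.length_take] at hs
      rw [List.take_of_length_le (by omega)]
    · rintro rfl
      exact List.take_of_length_le (by omega)
  · simp only [h, false_and, iff_false]
    rintro rfl
    simp at hs

theorem attrOf_cons {x : Vertex × ℕ} {l : CVert} {a : Name} (ha : a ∈ N) {e : SExp} :
    (attrOf (record t ρ N n W x :: l) a ≠ [] ∧
      (attrOf (record t ρ N n W x :: l) a).headD .nil = e) ↔
      x.2 = 0 ∧ ∃ d, t.attr x.1 a = some d ∧ valueCode ρ N d = e := by
  rw [attrOf, record, List.headD_cons, SExp.cdr, SExp.toList_enc]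
  split_ifs with h
  · rw [lookup_filterMap (f := fun a => (t.attr x.1 a).map (valueCode ρ N)) ha,
      Option.map_eq_some_iff]
    simp only [h, true_and]
  · simp [lookup, h]

theorem varOf_cert {x : Name} (hx : x ∈ N) :
    varOf (cert t ρ N n M W) x = valueCode ρ N (ρ x) := by
  rw [varOf, cert, SExp.cdr, SExp.toList_enc]
  exact ((lookup_filterMap (f := fun x => some (valueCode ρ N (ρ x))) hx).2 rfl).2

theorem eqA_cert {x : Vertex × ℕ} {l : CVert} {a y : Name} (ha : a ∈ N) (hy : y ∈ N) :
    (cmodel (cert t ρ N n M W)).eqA y a (record t ρ N n W x :: l) ↔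
      x.2 = 0 ∧ (t.model ρ).eqA y a x.1 := by
  simp only [cmodel, XMLTree.model]
  rw [varOf_cert hy, attrOf_cons ha]
  simp only [← valueCode_inj hy, eq_comm]

theorem neA_cert {x : Vertex × ℕ} {l : CVert} {a y : Name} (ha : a ∈ N) (hy : y ∈ N) :
    (cmodel (cert t ρ N n M W)).neA y a (record t ρ N n W x :: l) ↔
      x.2 = 0 ∧ (t.model ρ).neA y a x.1 := by
  simp only [cmodel, XMLTree.model]
  rw [varOf_cert hy]
  have h := fun e => attrOf_cons (t := t) (ρ := ρ) (n := n) (W := W) (x := x) (l := l) ha (e := e)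
  constructor
  · rintro ⟨h1, h2⟩
    obtain ⟨h3, d, h4, h5⟩ := (h _).1 ⟨h1, rfl⟩
    refine ⟨h3, d, h4, fun h6 => h2 ?_⟩
    rw [← h5, (valueCode_inj hy).2 h6]
  · rintro ⟨h3, d, h4, h5⟩
    obtain ⟨h1, h2⟩ := (h _).2 ⟨h3, d, h4, rfl⟩
    refine ⟨h1, fun h6 => h5 ((valueCode_inj hy).1 ?_)⟩
    rw [← h2, h6]

-- The homomorphisms between the tree and its certificate

/-- A vertex in `W` as a vertex of the certificate. -/
noncomputable def embed (t : XMLTree D) (ρ : Name → D) (N : List Name) (n M : ℕ)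
    (W : List Vertex) (w : Vertex) : CVert := (chain W M w).map (record t ρ N n W)

theorem embed_eq_cons (w : Vertex) :
    ∃ l, embed t ρ N n M W w = record t ρ N n W (w, 0) :: l := by
  obtain ⟨l, hl⟩ := chain_eq_cons (W := W) (M := M) w
  exact ⟨_, by rw [embed, hl]; rfl⟩

theorem embed_mem (h0 : [] ∈ W) {w : Vertex} (hw : w ∈ W) :
    embed t ρ N n M W w ∈ verts (cert t ρ N n M W) :=
  (mem_verts_cert h0).2 ⟨w, hw, 0, by have := kept_lt_length_chain (W := W) (M := M) w; omega, rfl⟩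

/-- This carries the match of p over to the certificate. Members of `W` keep their labels and
comparisons with variables as far as names in `N` can tell, and child and descendant among them can
be read off the branches. -/
theorem homOn_embed (h0 : [] ∈ W) (hN : ∀ s ∈ N, s.length ≤ n) :
    HomOn (t.model ρ) (cmodel (cert t ρ N n M W)) N {w | w ∈ W} (embed t ρ N n M W) where
  rel a u hu v hv h := by
    obtain ⟨-, -, h⟩ := h
    refine ⟨embed_mem h0 hu, embed_mem h0 hv, ?_⟩
    cases a with
    | self => obtain rfl : v = u := h; rfl
    | child =>
      obtain ⟨i, rfl⟩ := h
      simp only [crel, embed]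
      rw [chain_concat hu]
      rfl
    | descendant =>
      obtain ⟨w, hw, rfl⟩ := h
      obtain ⟨l, hl, h⟩ := exists_chain_eq_append (M := M) h0 hu (List.prefix_append u w)
        (by simpa using List.length_pos_iff.2 hw)
      exact ⟨l.map (record t ρ N n W), by simpa using hl, by simp only [embed, h, List.map_append]⟩
  lab w _ s hs h := by
    obtain ⟨l, hl⟩ := embed_eq_cons (t := t) (ρ := ρ) (N := N) (n := n) (W := W) (M := M) w
    rw [hl]
    exact (labelOf_cons_eq (hN s hs)).2 ⟨rfl, h⟩
  eqA w _ x hx a ha h := by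
    obtain ⟨l, hl⟩ := embed_eq_cons (t := t) (ρ := ρ) (N := N) (n := n) (W := W) (M := M) w
    rw [hl]
    exact (eqA_cert ha hx).2 ⟨rfl, h⟩
  neA w _ x hx a ha h := by
    obtain ⟨l, hl⟩ := embed_eq_cons (t := t) (ρ := ρ) (N := N) (n := n) (W := W) (M := M) w
    rw [hl]
    exact (neA_cert ha hx).2 ⟨rfl, h⟩

theorem mem_dom_of_prefix {u v : Vertex} (hv : v ∈ t.dom) (h : u <+: v) : u ∈ t.dom := by
  obtain ⟨w, rfl⟩ := h
  induction w using List.reverseRecOn with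
  | nil => simpa using hv
  | append_singleton w i ih => exact ih (t.parent_mem (u ++ w) i (by simpa using hv))

open Classical in
/-- The truncated vertex that a record describes. -/
noncomputable def decode (t : XMLTree D) (ρ : Name → D) (N : List Name) (n : ℕ)
    (W : List Vertex) (e : SExp) : Vertex × ℕ :=
  if h : ∃ x : Vertex × ℕ, x.1 ∈ W ∧ record t ρ N n W x = e then h.choose else ([], 0)

theorem decode_record {x : Vertex × ℕ} (hx : x.1 ∈ W) :
    decode t ρ N n W (record t ρ N n W x) = x := by
  have h : ∃ y : Vertex × ℕ, y.1 ∈ W ∧ record t ρ N n W y = record t ρ N n W x := ⟨x, hx, rfl⟩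
  rw [decode, dif_pos h]
  exact record_inj h.choose_spec.1 h.choose_spec.2

/-- Pigeonhole: a shortened branch has `M` neutral vertices with distinct records, more than `H` can
contain. A branch that was not shortened needs no gap and gets `J w = 0`. -/
theorem exists_isGap (H : List SExp) (hH : H.length < M) : ∃ J : Vertex → ℕ, IsGap W M J ∧
    ∀ w ∈ W, J w ≠ 0 → record t ρ N n W (w, J w) ∉ H := by
  have key : ∀ w, ∃ j, w ∈ W → (j ≤ kept W M w ∧ (j = 0 → kept W M w = w.length - up W w - 1)) ∧
      (j ≠ 0 → record t ρ N n W (w, j) ∉ H) := by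
    intro w
    by_cases hg : w.length - up W w - 1 ≤ M
    · exact ⟨0, fun _ => ⟨⟨Nat.zero_le _, fun _ => min_eq_left hg⟩, fun h => absurd rfl h⟩⟩
    have hk : kept W M w = M := min_eq_right (by omega)
    by_cases hw : w ∈ W
    · by_contra! hcon
      have hsub : (List.range M).map (fun j => record t ρ N n W (w, j + 1)) ⊆ H := by
        intro e he
        obtain ⟨j, hj, rfl⟩ := List.mem_map.1 he
        rw [List.mem_range] at hj
        exact ((hcon (j + 1)).2 ⟨by omega, by simp⟩).2
      have hnd : ((List.range M).map (fun j => record t ρ N n W (w, j + 1))).Nodup := by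
        refine List.nodup_range.map fun i j h => ?_
        have := (Prod.ext_iff.1 (record_inj hw h)).2
        simpa using this
      have := (hnd.subperm hsub).length_le
      simp at this
      omega
    · exact ⟨0, fun h => absurd h hw⟩
  choose J hJ using key
  exact ⟨J, fun w hw => (hJ w hw).1, fun w hw => (hJ w hw).2⟩

/-- This carries a match of q back to the tree. Neutral vertices have no label in `N` and no
attributes, so only axes matter for them. A child step broken by `place` has a gap vertex as its
upper end, and `X` contains no gap vertex. -/
theorem homOn_place (h0 : [] ∈ W) (hW : ∀ w ∈ W, w ∈ t.dom) (hN : ∀ s ∈ N, s.length ≤ n)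
    {J : Vertex → ℕ} (hJ : IsGap W M J) {X : Set CVert}
    (hX : ∀ w ∈ W, J w ≠ 0 → ∀ v ∈ X, v.headD .nil ≠ record t ρ N n W (w, J w))
    (hXv : ∀ v ∈ X, v ∈ verts (cert t ρ N n M W)) :
    HomOn (cmodel (cert t ρ N n M W)) (t.model ρ) N X
      (fun v => place W M J (decode t ρ N n W (v.headD .nil))) := by
  have hv : ∀ v ∈ verts (cert t ρ N n M W), ∃ w ∈ W, ∃ k x l, (chain W M w).drop k = x :: l ∧
      x.1 ∈ W ∧ v = record t ρ N n W x :: l.map (record t ρ N n W) ∧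
      decode t ρ N n W (v.headD .nil) = x := by
    intro v hv
    obtain ⟨w, hw, k, hk, rfl⟩ := (mem_verts_cert h0).1 hv
    have h1 := mem_chain h0 hw (List.getElem_mem hk)
    refine ⟨w, hw, k, _, _, List.drop_eq_getElem_cons hk, h1.1, ?_, ?_⟩
    · rw [List.drop_eq_getElem_cons hk]; rfl
    · rw [List.drop_eq_getElem_cons hk]
      exact decode_record h1.1
  have hdom : ∀ v ∈ verts (cert t ρ N n M W),
      place W M J (decode t ρ N n W (v.headD .nil)) ∈ t.dom := by
    intro v h
    obtain ⟨_, _, _, x, _, _, hx, _, h⟩ := hv v h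
    rw [h]
    exact mem_dom_of_prefix (hW _ hx) (place_prefix x)
  refine ⟨?_, ?_, ?_, ?_⟩
  · rintro a u hu v hv' ⟨h1, h2, h⟩
    refine ⟨hdom u h1, hdom v h2, ?_⟩
    obtain ⟨_, _, _, y, l', _, hy, hu', hdu⟩ := hv u h1
    obtain ⟨w, hw, k, x, l, hd, hx, hv'', hdv⟩ := hv v h2
    simp only [hdu, hdv]
    cases a with
    | self =>
      obtain rfl : v = u := h
      obtain rfl : x = y := hdv.symm.trans hdu
      rfl
    | child =>
      have h : v.tail = u := h
      rw [hv'', List.tail_cons, hu', List.map_eq_cons_iff] at h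
      obtain ⟨z, l, rfl, h, -⟩ := h
      obtain rfl := record_inj hy h.symm
      -- If this child step were broken, `u` would be a gap vertex, contrary to `hX`.
      refine (place_step h0 hJ hw hd).2 fun h3 => ?_
      by_contra h4
      refine hX y.1 hy (h3 ▸ h4) u hu ?_
      rw [← h3, hu']
      rfl
    | descendant =>
      obtain ⟨l₀, hl₀, h⟩ := h
      obtain ⟨e, l₀, rfl⟩ := List.exists_cons_of_ne_nil hl₀
      rw [hv'', List.cons_append, List.cons.injEq, hu', List.map_eq_append_iff] at h
      obtain ⟨-, a, b, rfl, -, h⟩ := h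
      rw [List.map_eq_cons_iff] at h
      obtain ⟨z, b, rfl, h, -⟩ := h
      obtain rfl := record_inj hy h.symm
      obtain ⟨⟨w', h5⟩, h6⟩ := place_append h0 hJ hw hd
      refine ⟨w', ?_, h5.symm⟩
      rintro rfl
      rw [← h5] at h6
      simp at h6
  · intro v hv' s hs h
    obtain ⟨_, _, _, ⟨x, j⟩, l, _, hx, hv', hd⟩ := hv v (hXv v hv')
    simp only [hd]
    rw [hv'] at h
    obtain ⟨h1, h2⟩ := (labelOf_cons_eq (hN s hs)).1 h
    obtain rfl : j = 0 := h1
    rwa [place_zero hJ hx]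
  · intro v hv' y hy a ha h
    obtain ⟨_, _, _, ⟨x, j⟩, l, _, hx, hv', hd⟩ := hv v (hXv v hv')
    simp only [hd]
    rw [hv'] at h
    obtain ⟨h1, h2⟩ := (eqA_cert ha hy).1 h
    obtain rfl : j = 0 := h1
    rwa [place_zero hJ hx]
  · intro v hv' y hy a ha h
    obtain ⟨_, _, _, ⟨x, j⟩, l, _, hx, hv', hd⟩ := hv v (hXv v hv')
    simp only [hd]
    rw [hv'] at h
    obtain ⟨h1, h2⟩ := (neA_cert ha hy).1 h
    obtain rfl : j = 0 := h1
    rwa [place_zero hJ hx]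

end


section
variable {D : Type*} {t : XMLTree D} {ρ : Name → D} {N : List Name} {n M : ℕ} {W : List Vertex}

/-! ### The size of the certificates -/

theorem size_unary (k : ℕ) : (unary k).size = 2 * k + 1 := by
  induction k with
  | zero => rfl
  | succ k ih => simp [unary, SExp.size, ih]; omega

theorem sz_names_le (hN : ∀ s ∈ N, s.length ≤ n) (hl : N.length ≤ n) :
    sz N ≤ n * (4 * n + 2) + 1 :=
  sz_list_le hl fun s hs => by have := sz_bits s; have := hN s hs; omega

theorem sz_valueCode_le (d : D) : sz (valueCode ρ N d) ≤ sz N :=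
  sz_sublist List.filter_sublist

theorem sz_assoc_le (hN : ∀ s ∈ N, s.length ≤ n) (hl : N.length ≤ n) (f : Name → Option D) :
    sz (N.filterMap fun a => ((f a).map (valueCode ρ N)).map (SExp.cons (enc a))) ≤
      11 * (n + 3) ^ 3 := by
  have h1 := sz_names_le hN hl
  refine (sz_list_le (n := n) (B := 10 * (n + 3) ^ 2)
    ((List.length_filterMap_le _ _).trans hl) fun e he => ?_).trans (by nlinarith)
  simp only [List.mem_filterMap, Option.map_eq_some_iff] at he
  obtain ⟨a, ha, _, ⟨d, -, rfl⟩, rfl⟩ := he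
  have h2 := sz_bits a
  have h3 := hN a ha
  have h4 := sz_valueCode_le (ρ := ρ) (N := N) d
  have h5 : sz (SExp.cons (enc a) (valueCode ρ N d)) = sz a + sz (valueCode ρ N d) + 1 := rfl
  nlinarith

theorem sz_record_le (hN : ∀ s ∈ N, s.length ≤ n) (hl : N.length ≤ n) (hW : W.length ≤ n + 1)
    {x : Vertex × ℕ} (hx : x.2 ≤ n + 2) : sz (record t ρ N n W x) ≤ 20 * (n + 3) ^ 3 := by
  have h1 := size_unary (W.idxOf x.1)
  have h2 := List.idxOf_le_length (l := W) (a := x.1)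
  have h3 := size_unary x.2
  have h4 : sz (if x.2 = 0 then (t.lab x.1).take (n + 1) else List.replicate (n + 1) true) ≤
      4 * (n + 1) + 1 := by
    refine (sz_bits _).trans ?_
    split_ifs <;> simp
  have h5 : sz (if x.2 = 0 then
      N.filterMap fun a => ((t.attr x.1 a).map (valueCode ρ N)).map (SExp.cons (enc a)) else []) ≤
      11 * (n + 3) ^ 3 := by
    split_ifs
    · exact sz_assoc_le hN hl _
    · have := Nat.one_le_pow 3 (n + 3) (by omega)
      rw [sz_nil]
      omega
  have h6 : sz (record t ρ N n W x) = (unary (W.idxOf x.1)).size + (unary x.2).size + 1 +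
      sz (if x.2 = 0 then (t.lab x.1).take (n + 1) else List.replicate (n + 1) true) + 1 +
      sz (if x.2 = 0 then N.filterMap fun a =>
        ((t.attr x.1 a).map (valueCode ρ N)).map (SExp.cons (enc a)) else []) + 1 := rfl
  have h7 : n + 3 ≤ (n + 3) ^ 3 := Nat.le_self_pow (by norm_num) _
  omega

/-- There are at most `(n + 3) ^ 3` listed vertices, each a branch of at most `(n + 3) ^ 2` records
of size at most `20 * (n + 3) ^ 3`. Constants are absorbed by raising the exponent, since `n + 3 ≥
3`. -/
theorem size_cert_le (hN : ∀ s ∈ N, s.length ≤ n) (hl : N.length ≤ n) (hW : W.length ≤ n + 1)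
    (h0 : [] ∈ W) : (cert t ρ N n (n + 2) W).size ≤ (n + 3) ^ 13 := by
  have hlen : ∀ w ∈ W, (chain W (n + 2) w).length ≤ (n + 3) ^ 2 := fun w hw =>
    (length_chain_le h0 hw).trans (by nlinarith)
  have h1 : ∀ l : List (Vertex × ℕ), l.length ≤ (n + 3) ^ 2 → (∀ x ∈ l, x.2 ≤ n + 2) →
      sz (l.map (record t ρ N n W)) ≤ 22 * (n + 3) ^ 5 := by
    intro l h2 h3
    refine (sz_list_le (n := (n + 3) ^ 2) (B := 20 * (n + 3) ^ 3) (by simpa using h2) ?_).trans ?_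
    · intro e he
      obtain ⟨x, hx, rfl⟩ := List.mem_map.1 he
      exact sz_record_le hN hl hW (h3 x hx)
    · have h4 : (n + 3) ^ 2 ≤ (n + 3) ^ 5 := Nat.pow_le_pow_right (by omega) (by norm_num)
      have h5 : 1 ≤ (n + 3) ^ 5 := Nat.one_le_pow _ _ (by omega)
      calc _ = 20 * (n + 3) ^ 5 + (n + 3) ^ 2 + 1 := by ring
        _ ≤ _ := by omega
  have h2 : sz (verts (cert t ρ N n (n + 2) W)) ≤ 24 * (n + 3) ^ 9 := by
    refine (sz_list_le (n := (n + 3) ^ 3) (B := 22 * (n + 3) ^ 5) ?_ ?_).trans ?_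
    · rw [verts_cert, List.length_cons, List.length_flatMap]
      have h3 : (W.map fun w => ((List.range (chain W (n + 2) w).length).map fun k =>
          ((chain W (n + 2) w).drop k).map (record t ρ N n W)).length).sum ≤
          W.length * (n + 3) ^ 2 := by
        refine (List.sum_le_card_nsmul _ ((n + 3) ^ 2) ?_).trans_eq (by simp)
        intro k hk
        obtain ⟨w, hw, rfl⟩ := List.mem_map.1 hk
        simpa using hlen w hw
      nlinarith
    · intro v hv
      obtain ⟨w, hw, k, hk, rfl⟩ := (mem_verts_cert h0).1 hv
      refine h1 _ (by have := hlen w hw; simp; omega) fun x hx => ?_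
      exact (mem_chain h0 hw (List.mem_of_mem_drop hx)).2
    · have h4 : (n + 3) ^ 3 ≤ (n + 3) ^ 9 := Nat.pow_le_pow_right (by omega) (by norm_num)
      have h5 : (n + 3) ^ 8 ≤ (n + 3) ^ 9 := Nat.pow_le_pow_right (by omega) (by norm_num)
      have h6 : 1 ≤ (n + 3) ^ 9 := Nat.one_le_pow _ _ (by omega)
      calc _ = 22 * (n + 3) ^ 8 + (n + 3) ^ 3 + 1 := by ring
        _ ≤ _ := by omega
  have h3 : (cert t ρ N n (n + 2) W).size = sz (verts (cert t ρ N n (n + 2) W)) +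
      sz (N.filterMap fun x => (some (valueCode ρ N (ρ x))).map (SExp.cons (enc x))) + 1 := by
    rw [verts_cert]; rfl
  have h4 := sz_assoc_le (ρ := ρ) hN hl fun x => some (ρ x)
  simp only [Option.map_some] at h3 h4
  have h5 : (n + 3) ^ 3 ≤ (n + 3) ^ 9 := Nat.pow_le_pow_right (by omega) (by norm_num)
  have h6 : 1 ≤ (n + 3) ^ 9 := Nat.one_le_pow _ _ (by omega)
  have h7 : 81 * (n + 3) ^ 9 ≤ (n + 3) ^ 13 := by
    have : 3 ^ 4 ≤ (n + 3) ^ 4 := Nat.pow_le_pow_left (by omega) 4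
    calc 81 * (n + 3) ^ 9 ≤ (n + 3) ^ 4 * (n + 3) ^ 9 := Nat.mul_le_mul_right _ this
      _ = _ := by ring
  omega

end

/-! ### The small model property -/

/-- If containment fails, there is a small certificate. -/
theorem exists_isCex_of_not_contained {D : Type*} (p q : LPath) (h : ¬Contained D p q) :
    ∃ c : SExp, c.size ≤ ((encPair p q).length + 3) ^ 13 ∧ isCex (encPair p q) c = true := by
  simp only [Contained, not_forall] at h
  obtain ⟨t, ρ, ⟨v, hv⟩, hq⟩ := h
  obtain ⟨W₀, hW₀, hv₀, hR, H⟩ := LPath.exists_witness (t.model ρ) p [] v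
    ((LPath.mSem_model t ρ p [] v).2 hv)
  set n := (encPair p q).length with hn
  have hlen : n = p.enc.length + q.enc.length := by simp [hn, encPair]
  have hp' := p.namesLen_le
  have hq' := q.namesLen_le
  have hNl : namesLen (p.names ++ q.names) ≤ n := by rw [namesLen_append]; omega
  have hN : ∀ s ∈ p.names ++ q.names, s.length ≤ n := fun s hs => by
    have := length_lt_namesLen hs
    omega
  have hl := (length_le_namesLen (p.names ++ q.names)).trans hNl
  generalize hNN : p.names ++ q.names = N at *
  have h0 : [] ∈ [] :: W₀ := List.mem_cons_self
  have hW : ∀ w ∈ [] :: W₀, w ∈ t.dom := by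
    refine List.forall_mem_cons.2 ⟨t.root_mem, fun w hw => ?_⟩
    obtain ⟨a, x, h⟩ := hR w hw
    exact h.2.1
  generalize hWW : ([] : Vertex) :: W₀ = W at *
  refine ⟨cert t ρ N n (n + 2) W,
    size_cert_le hN hl (by rw [← hWW, List.length_cons]; omega) h0, ?_⟩
  rw [isCex_encPair, croot_cert]
  refine ⟨closed_cert h0, ⟨embed t ρ N n (n + 2) W v, H _ _ _ ((homOn_embed h0 hN).mono ?_ ?_)⟩, ?_⟩
  · rw [← hNN]; simp
  · rintro x (rfl | hx)
    · exact h0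
    · rw [Set.mem_ofPred_eq, ← hWW]
      exact List.mem_cons_of_mem _ hx
  rintro ⟨y, hy⟩
  obtain ⟨Y, hY, hyY, hR', H'⟩ := LPath.exists_witness _ q _ y hy
  -- The root and the witnesses of q are at most `n + 1` vertices; hence the choice `M = n + 2`.
  obtain ⟨J, hJ, hJ'⟩ := exists_isGap (t := t) (ρ := ρ) (N := N) (n := n) (W := W) (M := n + 2)
    ((embed t ρ N n (n + 2) W [] :: Y).map (·.headD .nil)) (by simp; omega)
  have := H' _ _ _ ((homOn_place (t := t) (ρ := ρ) h0 hW hN hJ (X := withRoot _ Y) ?_ ?_).mono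
    (by rw [← hNN]; simp) subset_rfl)
  -- The root of the certificate is placed at the root of `t`, so the match of q carried back starts
  -- there.
  · obtain ⟨l, hl⟩ := embed_eq_cons (t := t) (ρ := ρ) (N := N) (n := n) (W := W) (M := n + 2) []
    rw [embed] at hl
    rw [hl, List.headD_cons, decode_record h0, place_zero hJ h0] at this
    exact hq ⟨_, (LPath.mSem_model t ρ q [] _).1 this⟩
  · rintro w hw hJw v hv h
    refine hJ' w hw hJw ?_
    rw [← h]
    refine List.mem_map_of_mem ?_
    rcases hv with rfl | hv
    · exact List.mem_cons_self
    · exact List.mem_cons_of_mem _ hv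
  · rintro w (rfl | hw)
    · exact embed_mem h0 h0
    · obtain ⟨a, x, h⟩ := hR' w hw
      exact h.2.1

/-! ### The algorithm -/

/-- The search takes its bound as the length of a list; powers of `w.length + 3` are obtained as
lengths of iterated products. -/
theorem PS.exists_length_pow {α : Type} [Coded α] (k : ℕ) :
    ∃ f : List α → List Bool, PS f ∧ ∀ w, (f w).length = (w.length + 3) ^ k := by
  induction k with
  | zero => exact ⟨fun _ => [true], by fun_prop, fun _ => by simp⟩
  | succ k ih =>
    obtain ⟨f, hf, h⟩ := ih
    refine ⟨fun w => (f w ×ˢ (true :: true :: true :: w.map fun _ => true)).map fun _ => true,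
      ?_, fun w => ?_⟩
    · have h1 : PS fun w : List α => w.map fun _ => true := PS.map (by fun_prop) (by fun_prop)
      exact PS.map (PS.product hf (PS.cons (by fun_prop) (PS.cons (by fun_prop)
        (PS.cons (by fun_prop) h1)))) (by fun_prop)
    · rw [List.length_map, List.length_product, h]
      simp [pow_succ]

/-- The containment problem is decided by a search for counterexamples. -/
theorem mem_containment_iff (D : Type*) [Infinite D] (w : List Sym) : w ∈ containment D ↔
    isPair (eval .nil w) = true ∧
      ¬∃ c, (isPair (eval .nil w) && isCex w c) = true := by
  constructor
  · rintro ⟨p, q, rfl, h⟩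
    refine ⟨isPair_encPair _ p q, ?_⟩
    rintro ⟨c, hc⟩
    exact not_contained_of_isCex D p q c (Bool.and_eq_true_iff.1 hc).2 h
  · rintro ⟨h1, h2⟩
    -- The kinds of the items are computed without looking at the certificate, so the empty one is
    -- enough to test the syntax.
    obtain ⟨p, q, rfl⟩ := exists_encPair_of_isPair _ w h1
    refine ⟨p, q, rfl, ?_⟩
    by_contra h
    obtain ⟨c, -, hc⟩ := exists_isCex_of_not_contained p q h
    exact h2 ⟨c, Bool.and_eq_true_iff.2 ⟨h1, hc⟩⟩

/-- The containment problem is in polynomial space. -/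
theorem containment_mem_PSPACE (D : Type*) [Infinite D] : containment D ∈ PSPACE Sym := by
  classical
  obtain ⟨l, hl, hlen⟩ := PS.exists_length_pow (α := Sym) 13
  have h1 := PS.exists_tree (h := fun w c => isPair (eval .nil w) && isCex w c) hl (by fun_prop) ?_
  · have h2 : PS fun w : List Sym => isPair (eval .nil w) &&
        !decide (∃ c, (isPair (eval .nil w) && isCex w c) = true) := by fun_prop
    have h3 : containment D = {w | (isPair (eval .nil w) &&
        !decide (∃ c, (isPair (eval .nil w) && isCex w c) = true)) = true} := by
      refine Set.ext fun w => ?_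
      rw [Set.mem_ofPred_eq, Bool.and_eq_true_iff, Bool.not_eq_true', decide_eq_false_iff_not]
      exact mem_containment_iff D w
    rw [h3]
    exact h2.mem_PSPACE
  · intro w c hc
    obtain ⟨h1, h2⟩ := Bool.and_eq_true_iff.1 hc
    obtain ⟨p, q, rfl⟩ := exists_encPair_of_isPair _ w h1
    -- A certificate of any size refutes containment over ℕ, and that failure has a small
    -- certificate. Certificates do not mention the data values, so ℕ can stand in for `D`.
    obtain ⟨c, h3, h4⟩ := exists_isCex_of_not_contained (D := ℕ) p q
      (not_contained_of_isCex ℕ p q c h2)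
    exact ⟨c, by rwa [hlen], Bool.and_eq_true_iff.2 ⟨h1, h4⟩⟩

end XPathVars

/-- Under the XPath semantics for variables, containment of XPath expressions with child and
descendant axes, filters, disjunction, wildcard, variables and inequalities is in PSPACE, for
every infinite set `D` of data values. -/
theorem theorem5p1 (D : Type*) [Infinite D] :
    XPathVars.containment D ∈ XPathVars.PSPACE XPathVars.Sym :=
  XPathVars.containment_mem_PSPACE D
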